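/- **Setting.** Let $\mathcal N\subset\mathbf Z^2$ be finite with $0\in\mathcal N=-\mathcal N$. A *rule* is a map $\pi:2^{\mathcal N}\to[0,1]$ that is monotone ($S_1\subset S_2$ implies $\pi(S_1)\le\pi(S_2)$), grows by contact ($\pi(\emptyset)=0$), is symmetric ($\pi(-S)=\pi(S)$) and solidifies ($\pi(S)=1$ whenever $0\in S$). A rule $\pi_d$ with values in $\{0,1\}$ is a (monotone) cellular automaton (CA); it acts on subsets of $\mathbf Z^2$ by $\mathcal T(A)=A\cup\{x:\pi_d((A-x)\cap\mathcal N)=1\}$, and on subsets $B$ of $\mathbf R^2$ by $\bar{\mathcal T}(B)=\{x\in\mathbf R^2: 0\in\mathcal T((B-x)\cap\mathbf Z^2)\}$. For a unit vector $u\in S^1$ let $H_u^-=\{x\in\mathbf R^2:\langle x,u\rangle\le 0\}$. The CA is *supercritical* if for every $u\in S^1$ there is $w(u)>0$ with $\bar{\mathcal T}(H_u^-)=H_u^-+w(u)u$. A set $A$ *fills space* if $\bigcup_{t\ge0}\mathcal T^t(A)=\mathbf Z^2$. An assignment of numbers $\xi_{x,t}(S)\in\{0,1\}$ ($x\in\mathbf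 Z^2$, $t=0,1,\dots$, $S\subset\mathcal N$) and an initial set $A_0\subset\mathbf Z^2$ determine sets by $A_{t+1}=\{x:\xi_{x,t}((A_t-x)\cap\mathcal N)=1\}$. The CA is *locally regular* if for every initial set $A_0$ that fills space there is a constant $C$ such that, for every deterministic assignment $\xi$ in which each $\xi_{x,t}$ is monotone in $S$, equals $1$ when $0\in S$, and equals $0$ when $\pi_d(S)=0$, every $x\in A_t$ at distance at least $C$ from $A_0$ has a set $G\subset A_t$, entirely within distance $C$ of $x$, that fills space. A rule $\pi$ is a *$p$-perturbation* of the CA if $\pi_d(S)=1$ exactly when $\pi(S)>0$, and $p=\min\{\pi(S):\pi(S)>0\}$. Its random dynamics are driven by i.i.d. random vectors $\xi_{x,t}=(\xi_{x,t}(S))_{S\subset\mathcal N}$, where $\xi_{x,t}(S)$ is Bernoulli($\pi(S)$) and, almost surely, $\xi_{x,t}(S_1)=1$ implies $\xi_{x,t}(S_2)=1$ whenever $S_1\subset S_2$. **Theorem 1.** Let a locally regular supercritical CA and a number $p$ be given. For every $p$-perturbation $\pi$ of the CA and every $u\in S^1$ there is a deterministic speed $w_\pi(u)>0$ such that the following holds.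 For every $\varepsilon>0$ there is a constant $c_\varepsilon>0$, depending only on the CA, on $p$ and on $\varepsilon$ (not on $u$, $t$ or $\pi$), such that, if the dynamics of $\pi$ start from $A_0=H_u^-\cap\mathbf Z^2$, then for every $t=0,1,2,\dots$, with probability at least $1-\exp(-c_\varepsilon t)$, the inclusions $$H_u^-+t\,(w_\pi(u)-\varepsilon)\,u\;\subset\;A_t\;\subset\;H_u^-+t\,(w_\pi(u)+\varepsilon)\,u$$ hold within the lattice ball of radius $t^2$, that is, for all sites $x\in\mathbf Z^2$ with $\|x\|_2\le t^2$. -/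

import Mathlib

open MeasureTheory ProbabilityTheory
open scoped Pointwise

noncomputable section

/-- Sites of the integer lattice `ℤ²`. -/
abbrev Site : Type := ℤ × ℤ

/-- The Euclidean plane `ℝ²`. -/
abbrev Plane : Type := EuclideanSpace ℝ (Fin 2)

/-- The inclusion `ℤ² ⊂ ℝ²`. -/
def toPlane (x : Site) : Plane := !₂[(x.1 : ℝ), (x.2 : ℝ)]

/-- The set `2^N` of subsets of the neighborhood `N`. -/
abbrev LocalConfig (N : Finset Site) : Type := ↥N.powerset

open Classical in
/-- What the site `x` sees of the occupied set `A`: the configuration `(A - x) ∩ N`. -/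
def view (N : Finset Site) (A : Set Site) (x : Site) : LocalConfig N :=
  ⟨N.filter (fun y => x + y ∈ A), Finset.mem_powerset.2 (Finset.filter_subset _ _)⟩

/-- A map `π : 2^N → [0,1]` on a finite neighborhood `N` of the origin that satisfies the standing
assumptions: monotone, growing only by contact, symmetric and solidifying. -/
structure IsRule (N : Finset Site) (π : LocalConfig N → ℝ) : Prop where
  zero_mem : (0 : Site) ∈ N
  neg_eq : -N = N
  nonneg : ∀ S, 0 ≤ π S
  le_one : ∀ S, π S ≤ 1
  mono : ∀ S₁ S₂ : LocalConfig N, (S₁ : Finset Site) ⊆ S₂ → π S₁ ≤ π S₂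
  contact : ∀ S : LocalConfig N, (S : Finset Site) = ∅ → π S = 0
  symm : ∀ S S' : LocalConfig N, (S' : Finset Site) = -(S : Finset Site) → π S' = π S
  solid : ∀ S : LocalConfig N, (0 : Site) ∈ (S : Finset Site) → π S = 1

/-- A monotone cellular automaton: a rule with values in `{0,1}`. -/
structure IsCA (N : Finset Site) (D : LocalConfig N → ℝ) : Prop extends IsRule N D where
  zero_or_one : ∀ S, D S = 0 ∨ D S = 1

/-- The transformation `𝒯`: adjoin to `A` every site that sees a sufficient configuration. -/
def step {N : Finset Site} (D : LocalConfig N → ℝ) (A : Set Site) : Set Site :=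
  A ∪ {x | D (view N A x) = 1}

/-- The induced transformation `𝒯̄(B) = {x ∈ ℝ² : 0 ∈ 𝒯((B - x) ∩ ℤ²)}` of subsets of the plane. -/
def planeStep {N : Finset Site} (D : LocalConfig N → ℝ) (B : Set Plane) : Set Plane :=
  {x | (0 : Site) ∈ step D {z | toPlane z + x ∈ B}}

/-- The closed half-space `H_u⁻ = {x : ⟨x, u⟩ ≤ 0}`. -/
def halfSpace (u : Plane) : Set Plane := {x | inner ℝ x u ≤ 0}

/-- The translated half-space `H_u⁻ + s • u`. -/
def shiftedHalfSpace (u : Plane) (s : ℝ) : Set Plane := (fun x => x + s • u) '' halfSpace u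

/-- Supercriticality: every half-space is moved outward with a strictly positive speed,
`𝒯̄(H_u⁻) = H_u⁻ + w(u) • u` with `w(u) > 0`. -/
def Supercritical {N : Finset Site} (D : LocalConfig N → ℝ) : Prop :=
  ∀ u : Plane, ‖u‖ = 1 → ∃ w : ℝ, 0 < w ∧ planeStep D (halfSpace u) = shiftedHalfSpace u w

/-- The set `A` fills space under the deterministic dynamics: `⋃ₜ 𝒯ᵗ(A) = ℤ²`. -/
def FillsSpace {N : Finset Site} (D : LocalConfig N → ℝ) (A : Set Site) : Prop :=
  ⋃ t : ℕ, (step D)^[t] A = Set.univ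

/-- The sets `A₀, A₁, …` determined by an assignment `ξ`:
`A_{t+1} = {x : ξ_{x,t}((A_t - x) ∩ N) = 1}`. -/
def evolve {N : Finset Site} (ξ : Site → ℕ → LocalConfig N → Bool) (A₀ : Set Site) :
    ℕ → Set Site
  | 0 => A₀
  | t + 1 => {x | ξ x t (view N (evolve ξ A₀ t) x) = true}

/-- The deterministic assignments of `0`s and `1`s that a perturbation of `D` can produce: monotone
in the configuration, `1` on configurations that contain the origin (solidification), and `0` on
configurations that are not sufficient for `D`. -/
structure IsAssignment {N : Finset Site} (D : LocalConfig N → ℝ)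
    (ξ : Site → ℕ → LocalConfig N → Bool) : Prop where
  mono : ∀ x t (S₁ S₂ : LocalConfig N), (S₁ : Finset Site) ⊆ S₂ →
    ξ x t S₁ = true → ξ x t S₂ = true
  solid : ∀ x t (S : LocalConfig N), (0 : Site) ∈ (S : Finset Site) → ξ x t S = true
  sufficient : ∀ x t (S : LocalConfig N), ξ x t S = true → D S = 1

/-- Local regularity: for every initial set `A₀` (that fills space) there is a constant `C` such
that, for every deterministic assignment, every `x ∈ A_t` at distance at least `C` from `A₀` has a
set `G ⊆ A_t` within distance `C` of `x` that fills space. -/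
def LocallyRegular {N : Finset Site} (D : LocalConfig N → ℝ) : Prop :=
  ∀ A₀ : Set Site, FillsSpace D A₀ → ∃ C : ℝ,
    ∀ ξ : Site → ℕ → LocalConfig N → Bool, IsAssignment D ξ →
      ∀ (t : ℕ) (x : Site), x ∈ evolve ξ A₀ t →
        (∀ a ∈ A₀, C ≤ dist (toPlane x) (toPlane a)) →
          ∃ G : Set Site, G ⊆ evolve ξ A₀ t ∧ (∀ g ∈ G, dist (toPlane x) (toPlane g) ≤ C) ∧
            FillsSpace D G

/-- `π` is a `p`-perturbation of the cellular automaton `D`: `D(S) = 1` exactly when `π(S) > 0`,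
and `p` is the least positive value of `π`. -/
structure IsPerturbation {N : Finset Site} (D : LocalConfig N → ℝ) (p : ℝ)
    (π : LocalConfig N → ℝ) : Prop where
  rule : IsRule N π
  support : ∀ S, D S = 1 ↔ 0 < π S
  least : IsLeast {q : ℝ | 0 < q ∧ ∃ S, π S = q} p

/-- The random vectors that drive the dynamics of `π`: `ξ_{x,t}`, for `x ∈ ℤ²` and `t ∈ ℕ`, are
i.i.d., the coordinate `ξ_{x,t}(S)` is Bernoulli(`π(S)`), and the coordinates are coupled
monotonically. -/
structure IsDriving {N : Finset Site} (π : LocalConfig N → ℝ) {Ω : Type*} [MeasurableSpace Ω]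
    (μ : Measure Ω) (ξ : Ω → Site → ℕ → LocalConfig N → Bool) : Prop where
  measurable : ∀ x t, Measurable (fun ω => ξ ω x t)
  indep : iIndepFun (fun (z : Site × ℕ) ω => ξ ω z.1 z.2) μ
  ident : ∀ x t x' t', IdentDistrib (fun ω => ξ ω x t) (fun ω => ξ ω x' t') μ μ
  bernoulli : ∀ x t S, μ.real {ω | ξ ω x t S = true} = π S
  mono : ∀ x t (S₁ S₂ : LocalConfig N), (S₁ : Finset Site) ⊆ S₂ →
    ∀ᵐ ω ∂μ, ξ ω x t S₁ = true → ξ ω x t S₂ = true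

/-- The sites of the half-space: `H_u⁻ ∩ ℤ²`. -/
def halfSpaceSites (u : Plane) : Set Site := {x | toPlane x ∈ halfSpace u}

/-- Within the lattice ball of radius `r`, the set `A` lies between `H_u⁻ + s₁ • u` and
`H_u⁻ + s₂ • u`. -/
def BetweenHalfSpaces (u : Plane) (r s₁ s₂ : ℝ) (A : Set Site) : Prop :=
  ∀ x : Site, ‖toPlane x‖ ≤ r →
    (toPlane x ∈ shiftedHalfSpace u s₁ → x ∈ A) ∧ (x ∈ A → toPlane x ∈ shiftedHalfSpace u s₂)

end

/-!
The dynamics started from a half-space are compared with themselves over long blocks of time.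

*Law.* A functional of the occupied set that depends on finitely many sites is local. The transition
operator `transfer π`, defined with one uniform variable per site, maps local functionals to local
functionals, and its powers give the expectation of a local functional at time `t` for every driving
family (`IsDriving.integral_evolve`). Everything else is an estimate on this operator, uniform in
`π` and `u`; by translation invariance it concerns the probabilities `occProb π u t s` and
`vacProb π u t s` that a site at height `s` above the half-space is occupied or vacant at time `t`.

*Regularity.* The constant of local regularity may depend on the initial set, but copies of bad
examples for larger and larger constants can be placed side by side in one initial set, so that a
single constant serves all initial sets (`exists_uniform_regular`). Hence every occupied site of a
set `A` reached from a half-space has near it a configuration that fills space, which up to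
translation is one of finitely many, and there is a time `τ` after which the deterministic dynamics
started from `A` have covered `step D A`, even if the set that they start from is enlarged
(`exists_fill_time`). Since a random step has probability at least a power of `p` to do in a box
what the deterministic one does, a site of `step D A` remains vacant for a time `j * τ` with
probability exponentially small in `j`.

*Concentration.* So replacing `A` by `step D A` shortens the expected hitting time of the origin,
truncated at a power of `j`, by at most a constant times `j` (`hit_sub_hit_step_le`). A random step
leads to a set between `A` and `step D A`, hence the conditional expectations of the hitting time
form a martingale with increments of order `j`. At the time scale `K = j ^ 4` the exponential moment
of the centered hitting time with parameter `j ^ (-3)` is bounded (`expHit_le`), and the hitting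
time differs from its mean by a small multiple of `K` with probability at most exponentially small
in `j` (`exists_concentration`).

*Window.* The front gains at most `2 * radius N` per step, so raising the height by
`2 * radius N * i` raises the mean hitting time by nearly `i` (`hit_add_le`). Therefore the heights
at which occupation at time `K` is neither very probable nor very improbable lie in an interval that
is short compared with `K` (`exists_window`).

*Exponential bounds.* A site that is occupied at time `n + K` is so because of some occupied site of
a box at time `n`. The number of sites of the box is polynomial in `K`, while the errors above are
exponentially small in `K ^ (1 / 4)`; so the resulting recursions over blocks of length `K` give
bounds that decay exponentially in the number of blocks (`exists_scale`), with speeds above and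
below that differ by at most `ε`. The speed `speed π u` lies between the two for every `ε`
(`exists_exp_bound`), and it is positive by the same recursion, started from the deterministic speed
(`speed_pos`).

*All times.* For large `t` the inclusions follow by a union bound over the sites of the ball. For
the finitely many remaining `t` it suffices that they hold with probability bounded below, uniformly
in `π` and `u`. This happens if the front moves in each step by exactly the smaller of
`speed π u + ε` and the deterministic speed. Each site below that height becomes occupied with
probability at least `p`, and each site above it stays vacant with probability bounded below,
because the speed would otherwise be larger (`exists_one_step_gap`).
-/

noncomputable section

variable {N : Finset Site} {D : LocalConfig N → ℝ} {π : LocalConfig N → ℝ} {p : ℝ} {u : Plane}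

/-! ### Boxes, levels and half-spaces of the lattice -/

/-- The lattice box of sup-norm radius `r` around `x`. -/
def box (x : Site) (r : ℕ) : Finset Site :=
  Finset.Icc (x.1 - r, x.2 - r) (x.1 + r, x.2 + r)

lemma mem_box {x y : Site} {r : ℕ} : y ∈ box x r ↔ |y.1 - x.1| ≤ r ∧ |y.2 - x.2| ≤ r := by
  simp only [box, Finset.mem_Icc, Prod.le_def, abs_le]
  constructor <;> rintro ⟨⟨h1, h2⟩, h3, h4⟩ <;> refine ⟨⟨?_, ?_⟩, ?_, ?_⟩ <;> linarith

lemma self_mem_box (x : Site) (r : ℕ) : x ∈ box x r := by simp [mem_box]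

lemma card_box (x : Site) (r : ℕ) : (box x r).card = (2 * r + 1) ^ 2 := by
  have h : box x r =
      Finset.Icc (x.1 - (r : ℤ)) (x.1 + r) ×ˢ Finset.Icc (x.2 - (r : ℤ)) (x.2 + r) := by
    ext y
    simp only [box, Finset.mem_Icc, Prod.le_def, Finset.mem_product]
    tauto
  rw [h, Finset.card_product, Int.card_Icc, Int.card_Icc, pow_two]
  congr 1 <;> omega

lemma box_mono (x : Site) {r r' : ℕ} (h : r ≤ r') : box x r ⊆ box x r' := by
  intro y hy
  rw [mem_box] at hy ⊢
  have : (r : ℤ) ≤ r' := by exact_mod_cast h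
  exact ⟨hy.1.trans this, hy.2.trans this⟩

lemma mem_box_trans {x y z : Site} {r r' : ℕ} (hy : y ∈ box x r) (hz : z ∈ box y r') :
    z ∈ box x (r + r') := by
  simp only [mem_box, abs_le] at *
  push_cast
  refine ⟨⟨?_, ?_⟩, ?_, ?_⟩ <;>
    linarith [hy.1.1, hy.1.2, hy.2.1, hy.2.2, hz.1.1, hz.1.2, hz.2.1, hz.2.2]

lemma mem_box_comm {x y : Site} {r : ℕ} : y ∈ box x r ↔ x ∈ box y r := by
  simp only [mem_box, abs_sub_comm]

lemma mem_box_add_right {x y z : Site} {r : ℕ} : y + z ∈ box (x + z) r ↔ y ∈ box x r := by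
  simp [mem_box]

/-- A radius, at least `1`, of a box around the origin that contains `N`. -/
def radius (N : Finset Site) : ℕ := N.sup (fun y => max y.1.natAbs y.2.natAbs) + 1

lemma one_le_radius (N : Finset Site) : 1 ≤ radius N := by simp [radius]

lemma add_mem_box {N : Finset Site} {y : Site} (hy : y ∈ N) (x : Site) :
    x + y ∈ box x (radius N) := by
  have h : max y.1.natAbs y.2.natAbs ≤ N.sup (fun y => max y.1.natAbs y.2.natAbs) :=
    Finset.le_sup (f := fun y : Site => max y.1.natAbs y.2.natAbs) hy
  simp only [mem_box, radius, Prod.fst_add, Prod.snd_add, add_sub_cancel_left, Int.abs_eq_natAbs]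
  omega

/-- The level `⟨x, u⟩` of a site in the direction `u`. -/
def lev (u : Plane) (x : Site) : ℝ := inner ℝ (toPlane x) u

lemma lev_eq (u : Plane) (x : Site) : lev u x = x.1 * u 0 + x.2 * u 1 := by
  simp [lev, toPlane, EuclideanSpace.inner_eq_star_dotProduct, dotProduct, Fin.sum_univ_two]
  ring

lemma lev_add (u : Plane) (x y : Site) : lev u (x + y) = lev u x + lev u y := by
  simp [lev_eq]; ring

lemma lev_sub (u : Plane) (x y : Site) : lev u (x - y) = lev u x - lev u y := by
  simp [lev_eq]; ring

@[simp] lemma lev_zero (u : Plane) : lev u 0 = 0 := by simp [lev_eq]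

lemma sq_add_sq_of_norm {u : Plane} (hu : ‖u‖ = 1) : u 0 ^ 2 + u 1 ^ 2 = 1 := by
  have := EuclideanSpace.norm_sq_eq u
  simp [hu, Fin.sum_univ_two] at this
  linarith

lemma abs_lev_sub_le {u : Plane} (hu : ‖u‖ = 1) {x y : Site} {r : ℕ} (h : y ∈ box x r) :
    |lev u y - lev u x| ≤ 2 * r := by
  rw [mem_box] at h
  have h1 : |(y.1 : ℝ) - x.1| ≤ r := by exact_mod_cast h.1
  have h2 : |(y.2 : ℝ) - x.2| ≤ r := by exact_mod_cast h.2
  have hs := sq_add_sq_of_norm hu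
  have h3 : |u 0| ≤ 1 := by rw [abs_le]; constructor <;> nlinarith [sq_nonneg (u 1)]
  have h4 : |u 1| ≤ 1 := by rw [abs_le]; constructor <;> nlinarith [sq_nonneg (u 0)]
  have e : lev u y - lev u x = (y.1 - x.1) * u 0 + (y.2 - x.2) * u 1 := by simp [lev_eq]; ring
  rw [e]
  refine (abs_add_le _ _).trans ?_
  rw [abs_mul, abs_mul]
  have := mul_le_mul h1 h3 (abs_nonneg _) (by positivity)
  have := mul_le_mul h2 h4 (abs_nonneg _) (by positivity)
  linarith

lemma abs_lev_le {u : Plane} (hu : ‖u‖ = 1) {y : Site} {r : ℕ} (h : y ∈ box 0 r) :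
    |lev u y| ≤ 2 * r := by
  simpa using abs_lev_sub_le hu h

/-- The sites of level at most `s` in the direction `u`. -/
def Hs (u : Plane) (s : ℝ) : Set Site := {x | lev u x ≤ s}

lemma mem_Hs {u : Plane} {s : ℝ} {x : Site} : x ∈ Hs u s ↔ lev u x ≤ s := Iff.rfl

lemma Hs_mono (u : Plane) {s s' : ℝ} (h : s ≤ s') : Hs u s ⊆ Hs u s' :=
  fun _ hx => le_trans (mem_Hs.1 hx) h

lemma halfSpaceSites_eq (u : Plane) : halfSpaceSites u = Hs u 0 := rfl

lemma mem_shiftedHalfSpace {u : Plane} (hu : ‖u‖ = 1) (s : ℝ) (x : Plane) :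
    x ∈ shiftedHalfSpace u s ↔ inner ℝ x u ≤ s := by
  have huu : inner ℝ u u = (1 : ℝ) := by rw [real_inner_self_eq_norm_sq, hu]; norm_num
  simp only [shiftedHalfSpace, halfSpace, Set.mem_image, Set.mem_ofPred_eq]
  constructor
  · rintro ⟨y, hy, rfl⟩
    rw [inner_add_left, inner_smul_left, huu]; simp; linarith
  · intro h
    refine ⟨x - s • u, ?_, by simp⟩
    rw [inner_sub_left, inner_smul_left, huu]; simp; linarith

/-- The set `A - z`. -/
def shift (z : Site) (A : Set Site) : Set Site := {y | y + z ∈ A}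

lemma mem_shift {z y : Site} {A : Set Site} : y ∈ shift z A ↔ y + z ∈ A := Iff.rfl

lemma shift_Hs (u : Plane) (z : Site) (s : ℝ) : shift z (Hs u s) = Hs u (s - lev u z) := by
  ext y
  rw [mem_shift, mem_Hs, mem_Hs, lev_add]
  constructor <;> intro h <;> linarith

lemma exists_lev_le {u : Plane} (hu : ‖u‖ = 1) (r : ℕ) :
    ∃ z ∈ box 0 (4 * r), lev u z ≤ - (2 * r) := by
  have hs := sq_add_sq_of_norm hu
  have hr : (0 : ℝ) ≤ r := by positivity
  have h4 : |(4 * r : ℤ)| ≤ ((4 * r : ℕ) : ℤ) := by push_cast; rw [abs_of_nonneg (by positivity)]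
  have h4' : |-(4 * r : ℤ)| ≤ ((4 * r : ℕ) : ℤ) := by rw [abs_neg]; exact h4
  have h0 : |(0 : ℤ)| ≤ ((4 * r : ℕ) : ℤ) := by simp
  have key : 1 / 2 ≤ u 0 ∨ u 0 ≤ -(1 / 2) ∨ 1 / 2 ≤ u 1 ∨ u 1 ≤ -(1 / 2) := by
    by_contra! h
    nlinarith [h.1, h.2.1, h.2.2.1, h.2.2.2]
  rcases key with h | h | h | h
  · refine ⟨(-(4 * r), 0), mem_box.2 ⟨by simp, by simp⟩, ?_⟩
    rw [lev_eq]; push_cast; nlinarith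
  · refine ⟨(4 * r, 0), mem_box.2 ⟨by simp, by simp⟩, ?_⟩
    rw [lev_eq]; push_cast; nlinarith
  · refine ⟨(0, -(4 * r)), mem_box.2 ⟨by simp, by simp⟩, ?_⟩
    rw [lev_eq]; push_cast; nlinarith
  · refine ⟨(0, 4 * r), mem_box.2 ⟨by simp, by simp⟩, ?_⟩
    rw [lev_eq]; push_cast; nlinarith

/-! ### The deterministic dynamics -/

lemma mem_view {A : Set Site} {x y : Site} :
    y ∈ (view N A x : Finset Site) ↔ y ∈ N ∧ x + y ∈ A := by
  simp [view]

lemma view_congr {A B : Set Site} {x x' : Site} (h : ∀ y ∈ N, x + y ∈ A ↔ x' + y ∈ B) :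
    view N A x = view N B x' := by
  apply Subtype.ext
  ext y
  rw [mem_view, mem_view]
  exact and_congr_right (h y)

lemma view_congr_box {A B : Set Site} {x : Site}
    (h : ∀ y ∈ box x (radius N), y ∈ A ↔ y ∈ B) : view N A x = view N B x :=
  view_congr fun _ hy => h _ (add_mem_box hy x)

lemma view_shift (A : Set Site) (x z : Site) : view N (shift z A) x = view N A (x + z) :=
  view_congr fun y _ => by rw [mem_shift, add_right_comm]

lemma view_mono {A B : Set Site} (h : A ⊆ B) (x : Site) :
    (view N A x : Finset Site) ⊆ view N B x := by
  intro y hy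
  rw [mem_view] at hy ⊢
  exact ⟨hy.1, h hy.2⟩

lemma IsCA.eq_one_of_le (hD : IsCA N D) {S S' : LocalConfig N} (h : (S : Finset Site) ⊆ S')
    (h1 : D S = 1) : D S' = 1 :=
  le_antisymm (hD.le_one _) (h1 ▸ hD.mono _ _ h)

lemma subset_step (D : LocalConfig N → ℝ) (A : Set Site) : A ⊆ step D A := Set.subset_union_left

lemma zero_mem_view (h0 : (0 : Site) ∈ N) {A : Set Site} {x : Site} (hx : x ∈ A) :
    (0 : Site) ∈ (view N A x : Finset Site) := mem_view.2 ⟨h0, by simpa using hx⟩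

lemma IsCA.mem_step_iff (hD : IsCA N D) {A : Set Site} {x : Site} :
    x ∈ step D A ↔ D (view N A x) = 1 := by
  constructor
  · rintro (h | h)
    · exact hD.solid _ (zero_mem_view hD.zero_mem h)
    · exact h
  · exact fun h => Or.inr h

lemma IsCA.step_mono (hD : IsCA N D) {A B : Set Site} (h : A ⊆ B) : step D A ⊆ step D B := by
  intro x hx
  rw [hD.mem_step_iff] at hx ⊢
  exact hD.eq_one_of_le (view_mono h x) hx

lemma IsCA.step_shift (hD : IsCA N D) (z : Site) (A : Set Site) :
    step D (shift z A) = shift z (step D A) := by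
  ext x
  rw [hD.mem_step_iff, mem_shift, hD.mem_step_iff, view_shift]

lemma IsCA.iterate_step_shift (hD : IsCA N D) (z : Site) (A : Set Site) (t : ℕ) :
    (step D)^[t] (shift z A) = shift z ((step D)^[t] A) := by
  induction t with
  | zero => rfl
  | succ t ih => rw [Function.iterate_succ_apply', ih, hD.step_shift, Function.iterate_succ_apply']

lemma IsCA.iterate_step_mono (hD : IsCA N D) {A B : Set Site} (h : A ⊆ B) (t : ℕ) :
    (step D)^[t] A ⊆ (step D)^[t] B := by
  induction t with
  | zero => exact h
  | succ t ih =>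
    rw [Function.iterate_succ_apply', Function.iterate_succ_apply']; exact hD.step_mono ih

lemma iterate_step_subset (D : LocalConfig N → ℝ) (A : Set Site) {s t : ℕ} (h : s ≤ t) :
    (step D)^[s] A ⊆ (step D)^[t] A := by
  induction t, h using Nat.le_induction with
  | base => exact subset_rfl
  | succ t _ ih => rw [Function.iterate_succ_apply']; exact ih.trans (subset_step _ _)

/-- Growth by contact: a newly occupied site has an occupied site in its neighborhood. -/
lemma IsCA.exists_mem_of_mem_step (hD : IsCA N D) {A : Set Site} {x : Site} (hx : x ∈ step D A) :
    ∃ y ∈ A, y ∈ box x (radius N) := by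
  rw [hD.mem_step_iff] at hx
  have hne : (view N A x : Finset Site) ≠ ∅ := fun h => by
    rw [hD.contact _ h] at hx; exact zero_ne_one hx
  obtain ⟨y, hy⟩ := Finset.nonempty_of_ne_empty hne
  rw [mem_view] at hy
  exact ⟨_, hy.2, add_mem_box hy.1 x⟩

lemma IsCA.step_Hs_subset (hD : IsCA N D) {u : Plane} (hu : ‖u‖ = 1) (s : ℝ) :
    step D (Hs u s) ⊆ Hs u (s + 2 * radius N) := by
  intro x hx
  obtain ⟨y, hy, hyx⟩ := hD.exists_mem_of_mem_step hx
  have := abs_le.1 (abs_lev_sub_le hu hyx)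
  rw [mem_Hs] at hy ⊢
  linarith

/-- The speed `w` with which `𝒯̄` moves the closed half-space is the increment of the level for the
lattice dynamics started from the sites of level at most `s`, for every real `s`. -/
lemma IsCA.step_Hs (hD : IsCA N D) {u : Plane} (hu : ‖u‖ = 1) {w : ℝ}
    (hw : planeStep D (halfSpace u) = shiftedHalfSpace u w) (s : ℝ) :
    step D (Hs u s) = Hs u (s + w) := by
  have huu : inner ℝ u u = (1 : ℝ) := by rw [real_inner_self_eq_norm_sq, hu]; norm_num
  ext x
  have h1 : (toPlane x - s • u) ∈ planeStep D (halfSpace u) ↔ x ∈ step D (Hs u s) := by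
    rw [planeStep, Set.mem_ofPred_eq, hD.mem_step_iff, hD.mem_step_iff]
    suffices h : view N {z | toPlane z + (toPlane x - s • u) ∈ halfSpace u} 0 = view N (Hs u s) x by
      rw [h]
    refine view_congr fun y _ => ?_
    rw [Set.mem_ofPred_eq, halfSpace, Set.mem_ofPred_eq, mem_Hs, inner_add_left, inner_sub_left,
      inner_smul_left, huu, lev_add, zero_add]
    simp only [lev, conj_trivial, mul_one]
    constructor <;> intro h <;> linarith
  rw [← h1, hw, mem_shiftedHalfSpace hu, inner_sub_left, inner_smul_left, huu, mem_Hs]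
  simp only [lev, conj_trivial, mul_one]
  constructor <;> intro h <;> linarith

lemma IsCA.fillsSpace_shift (hD : IsCA N D) {A : Set Site} (h : FillsSpace D A) (z : Site) :
    FillsSpace D (shift z A) := by
  rw [FillsSpace, Set.eq_univ_iff_forall] at h ⊢
  intro x
  obtain ⟨t, ht⟩ := Set.mem_iUnion.1 (h (x + z))
  refine Set.mem_iUnion.2 ⟨t, ?_⟩
  rw [hD.iterate_step_shift]
  exact ht

lemma IsCA.fillsSpace_mono (hD : IsCA N D) {A B : Set Site} (hAB : A ⊆ B) (h : FillsSpace D A) :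
    FillsSpace D B := by
  rw [FillsSpace, Set.eq_univ_iff_forall] at h ⊢
  intro x
  obtain ⟨t, ht⟩ := Set.mem_iUnion.1 (h x)
  exact Set.mem_iUnion.2 ⟨t, hD.iterate_step_mono hAB t ht⟩

lemma IsCA.fillsSpace_Hs (hD : IsCA N D) (hsuper : Supercritical D) {u : Plane} (hu : ‖u‖ = 1)
    (s : ℝ) : FillsSpace D (Hs u s) := by
  obtain ⟨w, hw, hw'⟩ := hsuper u hu
  have key : ∀ t : ℕ, (step D)^[t] (Hs u s) = Hs u (s + t * w) := by
    intro t
    induction t with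
    | zero => simp
    | succ t ih =>
      rw [Function.iterate_succ_apply', ih, hD.step_Hs hu hw']; congr 1; push_cast; ring
  rw [FillsSpace, Set.eq_univ_iff_forall]
  intro x
  obtain ⟨t, ht⟩ := exists_nat_ge ((lev u x - s) / w)
  refine Set.mem_iUnion.2 ⟨t, ?_⟩
  rw [key, mem_Hs]
  rw [div_le_iff₀ hw] at ht
  linarith

/-! ### Local functionals of random sets -/

/-- The functional `h` of the occupied set depends only on the sites of `box x r`. -/
def LocalOn (x : Site) (r : ℕ) (h : Set Site → ℝ) : Prop :=
  ∀ A B : Set Site, (∀ y ∈ box x r, y ∈ A ↔ y ∈ B) → h A = h B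

lemma LocalOn.mono {x : Site} {r r' : ℕ} {h : Set Site → ℝ} (hh : LocalOn x r h) (hr : r ≤ r') :
    LocalOn x r' h := fun A B hAB => hh A B fun y hy => hAB y (box_mono x hr hy)

lemma LocalOn.comp {x : Site} {r : ℕ} {h : Set Site → ℝ} (hh : LocalOn x r h) (f : ℝ → ℝ) :
    LocalOn x r (fun A => f (h A)) := fun A B hAB => congrArg f (hh A B hAB)

lemma LocalOn.comp₂ {x : Site} {r : ℕ} {h g : Set Site → ℝ} (hh : LocalOn x r h)
    (hg : LocalOn x r g) (f : ℝ → ℝ → ℝ) : LocalOn x r (fun A => f (h A) (g A)) :=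
  fun A B hAB => congrArg₂ f (hh A B hAB) (hg A B hAB)

lemma localOn_const (x : Site) (r : ℕ) (c : ℝ) : LocalOn x r (fun _ => c) := fun _ _ _ => rfl

lemma LocalOn.sum {ι : Type*} {x : Site} {r : ℕ} {s : Finset ι} {h : ι → Set Site → ℝ}
    (hh : ∀ i ∈ s, LocalOn x r (h i)) : LocalOn x r (fun A => ∑ i ∈ s, h i A) :=
  fun A B hAB => Finset.sum_congr rfl fun i hi => hh i hi A B hAB

lemma LocalOn.eq_inter {x : Site} {r : ℕ} {h : Set Site → ℝ} (hh : LocalOn x r h) (A : Set Site) :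
    h A = h (A ∩ box x r) :=
  hh _ _ fun y hy => by simp [hy]

open Classical in
/-- A local functional of a set is a finite combination of indicators of local configurations. -/
lemma LocalOn.eq_sum {x : Site} {r : ℕ} {h : Set Site → ℝ} (hh : LocalOn x r h) (A : Set Site) :
    h A = ∑ B ∈ (box x r).powerset,
      (if ∀ y ∈ box x r, y ∈ A ↔ y ∈ B then h (B : Set Site) else 0) := by
  rw [Finset.sum_eq_single ((box x r).filter (· ∈ A))]
  · rw [if_pos]
    · exact hh _ _ fun y hy => by simp at *; tauto
    · intro y hy; simp [hy]
  · intro B hB hne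
    rw [if_neg]
    intro h
    apply hne
    ext y
    rw [Finset.mem_powerset] at hB
    rw [Finset.mem_filter]
    exact ⟨fun hy => ⟨hB hy, (h y (hB hy)).2 hy⟩, fun hy => (h y hy.1).1 hy.2⟩
  · intro h
    exact absurd (Finset.mem_powerset.2 (Finset.filter_subset _ _)) h

section RandomSet

variable {Ω : Type*} [MeasurableSpace Ω] {μ : Measure Ω} {X : Ω → Set Site}

lemma measurableSet_config (hm : ∀ x, MeasurableSet {ω | x ∈ X ω}) (W : Finset Site)
    (B : Set Site) : MeasurableSet {ω | ∀ y ∈ W, y ∈ X ω ↔ y ∈ B} := by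
  have : {ω | ∀ y ∈ W, y ∈ X ω ↔ y ∈ B} = ⋂ y ∈ W, {ω | y ∈ X ω ↔ y ∈ B} := by
    ext; simp
  rw [this]
  refine W.measurableSet_biInter fun y _ => ?_
  by_cases hy : y ∈ B
  · simpa [hy] using hm y
  · simp only [hy, iff_false]
    exact (hm y).compl

lemma LocalOn.measurable {x : Site} {r : ℕ} {h : Set Site → ℝ} (hh : LocalOn x r h)
    (hm : ∀ x, MeasurableSet {ω | x ∈ X ω}) : Measurable (fun ω => h (X ω)) := by
  classical
  have : (fun ω => h (X ω)) = fun ω => ∑ B ∈ (box x r).powerset,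
      (if ∀ y ∈ box x r, y ∈ X ω ↔ y ∈ B then h (B : Set Site) else 0) :=
    funext fun ω => hh.eq_sum _
  rw [this]
  refine Finset.measurable_sum _ fun B _ => ?_
  exact Measurable.ite (measurableSet_config hm _ (B : Set Site)) measurable_const measurable_const

lemma LocalOn.exists_bound {x : Site} {r : ℕ} {h : Set Site → ℝ} (hh : LocalOn x r h) :
    ∃ c, ∀ A, |h A| ≤ c := by
  classical
  refine ⟨∑ B ∈ (box x r).powerset, |h (B : Set Site)|, fun A => ?_⟩
  rw [hh.eq_sum A]
  refine (Finset.abs_sum_le_sum_abs _ _).trans (Finset.sum_le_sum fun B _ => ?_)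
  split_ifs
  · exact le_rfl
  · simp

lemma LocalOn.integrable [IsFiniteMeasure μ] {x : Site} {r : ℕ} {h : Set Site → ℝ}
    (hh : LocalOn x r h) (hm : ∀ x, MeasurableSet {ω | x ∈ X ω}) :
    Integrable (fun ω => h (X ω)) μ := by
  obtain ⟨c, hc⟩ := hh.exists_bound
  exact Integrable.of_bound (hh.measurable hm).aestronglyMeasurable c
    (ae_of_all _ fun ω => hc _)

open Classical in
lemma LocalOn.integral_eq_sum [IsFiniteMeasure μ] {x : Site} {r : ℕ} {h : Set Site → ℝ}
    (hh : LocalOn x r h) (hm : ∀ x, MeasurableSet {ω | x ∈ X ω}) :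
    ∫ ω, h (X ω) ∂μ = ∑ B ∈ (box x r).powerset,
      μ.real {ω | ∀ y ∈ box x r, y ∈ X ω ↔ y ∈ B} * h (B : Set Site) := by
  have e : ∀ ω, h (X ω) = ∑ B ∈ (box x r).powerset,
      {ω | ∀ y ∈ box x r, y ∈ X ω ↔ y ∈ B}.indicator (fun _ => h (B : Set Site)) ω := by
    intro ω
    refine (hh.eq_sum (X ω)).trans (Finset.sum_congr rfl fun B _ => ?_)
    rw [Set.indicator_apply]
    rfl
  rw [integral_congr_ae (ae_of_all μ e)]
  have hms : ∀ B : Finset Site, MeasurableSet {ω | ∀ y ∈ box x r, y ∈ X ω ↔ y ∈ B} :=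
    fun B => measurableSet_config hm _ (B : Set Site)
  rw [integral_finsetSum _ fun B _ => (integrable_const _).indicator (hms B)]
  refine Finset.sum_congr rfl fun B _ => ?_
  rw [integral_indicator_const _ (hms B), smul_eq_mul]

open Classical in
/-- For a random set with independent memberships, the law of a local configuration depends only on
the probabilities of the single memberships. -/
lemma real_config_eq_prod [IsProbabilityMeasure μ]
    (hm : ∀ x, MeasurableSet {ω | x ∈ X ω})
    (hind : iIndepFun (fun x ω => (x ∈ X ω : Prop)) μ) (W B : Finset Site) :
    μ.real {ω | ∀ y ∈ W, y ∈ X ω ↔ y ∈ B} =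
      ∏ y ∈ W, if y ∈ B then μ.real {ω | y ∈ X ω} else 1 - μ.real {ω | y ∈ X ω} := by
  have h := hind.measure_inter_preimage_eq_mul W (sets := fun y => {P : Prop | P ↔ y ∈ B})
    (fun y _ => MeasurableSet.of_discrete)
  have e : {ω | ∀ y ∈ W, y ∈ X ω ↔ y ∈ B} =
      ⋂ y ∈ W, (fun ω => (y ∈ X ω : Prop)) ⁻¹' {P : Prop | P ↔ y ∈ B} := by
    ext; simp
  rw [measureReal_def, e, h, ENNReal.toReal_prod]
  refine Finset.prod_congr rfl fun y _ => ?_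
  rw [← measureReal_def]
  split_ifs with hy
  · congr 1; ext; simp [hy]
  · rw [← probReal_compl_eq_one_sub (hm y)]; congr 1; ext; simp [hy]

lemma LocalOn.integral_congr {Ω' : Type*} [MeasurableSpace Ω'] {μ' : Measure Ω'}
    {X' : Ω' → Set Site} [IsProbabilityMeasure μ] [IsProbabilityMeasure μ']
    {x : Site} {r : ℕ} {h : Set Site → ℝ}
    (hh : LocalOn x r h) (hm : ∀ x, MeasurableSet {ω | x ∈ X ω})
    (hm' : ∀ x, MeasurableSet {ω | x ∈ X' ω})
    (hind : iIndepFun (fun x ω => (x ∈ X ω : Prop)) μ)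
    (hind' : iIndepFun (fun x ω => (x ∈ X' ω : Prop)) μ')
    (heq : ∀ x, μ.real {ω | x ∈ X ω} = μ'.real {ω | x ∈ X' ω}) :
    ∫ ω, h (X ω) ∂μ = ∫ ω, h (X' ω) ∂μ' := by
  rw [hh.integral_eq_sum hm, hh.integral_eq_sum hm']
  refine Finset.sum_congr rfl fun B _ => ?_
  rw [real_config_eq_prod hm hind, real_config_eq_prod hm' hind']
  simp_rw [heq]

end RandomSet

/-! ### The transition operator -/

/-- Independent uniform random variables attached to the sites. -/
def unif : Measure (Site → unitInterval) := Measure.infinitePi fun _ => volume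

instance : IsProbabilityMeasure unif := by unfold unif; infer_instance

/-- One step of the dynamics of `π`, driven by uniform variables: `x` becomes occupied if its
variable is at most `π` of what `x` sees. Insisting on `0 < π` makes the inclusion in the
deterministic step hold for every value of the variables, not only almost surely. -/
def ustep (π : LocalConfig N → ℝ) (U : Site → unitInterval) (A : Set Site) : Set Site :=
  {x | 0 < π (view N A x) ∧ (U x : ℝ) ≤ π (view N A x)}

/-- The transition operator of the dynamics of `π`, acting on local functionals. -/
def transfer (π : LocalConfig N → ℝ) (h : Set Site → ℝ) (A : Set Site) : ℝ :=
  ∫ U, h (ustep π U A) ∂unif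

lemma measurableSet_mem_ustep (π : LocalConfig N → ℝ) (A : Set Site) (x : Site) :
    MeasurableSet {U | x ∈ ustep π U A} := by
  simp only [ustep, Set.mem_ofPred_eq]
  refine MeasurableSet.inter (MeasurableSet.const _) ?_
  have h : Measurable fun U : Site → unitInterval => (U x : ℝ) :=
    measurable_subtype_coe.comp (measurable_pi_apply x)
  exact measurableSet_le h measurable_const

lemma LocalOn.integrable_ustep {x : Site} {r : ℕ} {h : Set Site → ℝ} (hh : LocalOn x r h)
    (π : LocalConfig N → ℝ) (A : Set Site) : Integrable (fun U => h (ustep π U A)) unif :=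
  hh.integrable (measurableSet_mem_ustep π A)

lemma ustep_local {A B : Set Site} {x : Site} (h : ∀ y ∈ box x (radius N), y ∈ A ↔ y ∈ B)
    (U : Site → unitInterval) : x ∈ ustep π U A ↔ x ∈ ustep π U B := by
  simp only [ustep, Set.mem_ofPred_eq, view_congr_box h]

lemma LocalOn.transfer_local {x : Site} {r : ℕ} {h : Set Site → ℝ} (hh : LocalOn x r h)
    (π : LocalConfig N → ℝ) : LocalOn x (r + radius N) (transfer π h) := by
  intro A B hAB
  refine integral_congr_ae (ae_of_all _ fun U => hh _ _ fun y hy => ustep_local (fun z hz => ?_) U)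
  exact hAB z (mem_box_trans hy hz)

lemma IsPerturbation.ustep_subset_step (hπ : IsPerturbation D p π) (U : Site → unitInterval)
    (A : Set Site) : ustep π U A ⊆ step D A :=
  fun _ hx => Or.inr ((hπ.support _).2 hx.1)

lemma IsPerturbation.subset_ustep (hπ : IsPerturbation D p π) (U : Site → unitInterval)
    (A : Set Site) : A ⊆ ustep π U A := by
  intro x hx
  have h1 : π (view N A x) = 1 := hπ.rule.solid _ (zero_mem_view hπ.rule.zero_mem hx)
  simp only [ustep, Set.mem_ofPred_eq, h1]
  exact ⟨one_pos, (U x).2.2⟩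

lemma IsPerturbation.ustep_mono (hπ : IsPerturbation D p π) (U : Site → unitInterval)
    {A B : Set Site} (h : A ⊆ B) : ustep π U A ⊆ ustep π U B := by
  intro x hx
  have := hπ.rule.mono _ _ (view_mono h x)
  exact ⟨hx.1.trans_le this, hx.2.trans this⟩

lemma IsPerturbation.pos (hπ : IsPerturbation D p π) : 0 < p := hπ.least.1.1

lemma IsPerturbation.le_one (hπ : IsPerturbation D p π) : p ≤ 1 := by
  obtain ⟨S, hS⟩ := hπ.least.1.2
  exact hS ▸ hπ.rule.le_one S

lemma IsPerturbation.le_of_eq_one (hπ : IsPerturbation D p π) {S : LocalConfig N} (h : D S = 1) :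
    p ≤ π S := hπ.least.2 ⟨(hπ.support S).1 h, S, rfl⟩

lemma unif_real_le (x : Site) {q : ℝ} (h0 : 0 ≤ q) (h1 : q ≤ 1) :
    unif.real {U | (U x : ℝ) ≤ q} = q := by
  have h : unif.real {U | (U x : ℝ) ≤ q} =
      (volume : Measure unitInterval).real (Set.Iic ⟨q, h0, h1⟩) := by
    have := (measurePreserving_eval_infinitePi (fun _ : Site => (volume : Measure unitInterval)) x)
    rw [← this.measureReal_preimage measurableSet_Iic.nullMeasurableSet]
    rfl
  rw [h, measureReal_def, unitInterval.volume_Iic, ENNReal.toReal_ofReal h0]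

lemma unif_real_mem_ustep (hπ : IsRule N π) (A : Set Site) (x : Site) :
    unif.real {U | x ∈ ustep π U A} = π (view N A x) := by
  simp only [ustep, Set.mem_ofPred_eq]
  by_cases h : 0 < π (view N A x)
  · simp only [h, true_and]
    exact unif_real_le x h.le (hπ.le_one _)
  · simp only [h, false_and]
    simp [le_antisymm (not_lt.1 h) (hπ.nonneg _)]

lemma iIndepFun_mem_ustep (π : LocalConfig N → ℝ) (A : Set Site) :
    iIndepFun (fun x U => (x ∈ ustep π U A : Prop)) unif := by
  have h := iIndepFun_infinitePi (ι := Site) (P := fun _ => (volume : Measure unitInterval))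
    (X := fun x (v : unitInterval) => (0 < π (view N A x) ∧ (v : ℝ) ≤ π (view N A x) : Prop))
    (fun x => by
      refine measurableSet_setOfPred.1 (MeasurableSet.inter (MeasurableSet.const _) ?_)
      exact measurableSet_le measurable_subtype_coe measurable_const)
  exact h

/-- A one-step lower bound: prescribing for each site of a box a range of length at least `q` for
its uniform variable has probability at least `q` to the number of sites. -/
lemma pow_le_unif_real (W : Finset Site) {q : ℝ} (h0 : 0 ≤ q) (E : Site → Set unitInterval)
    (hE : ∀ y, MeasurableSet (E y)) (hq : ∀ y ∈ W, q ≤ (volume : Measure unitInterval).real (E y)) :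
    q ^ W.card ≤ unif.real {U | ∀ y ∈ W, U y ∈ E y} := by
  have e : {U : Site → unitInterval | ∀ y ∈ W, U y ∈ E y} = Set.pi W E := by ext; simp [Set.mem_pi]
  rw [e, measureReal_def, unif, Measure.infinitePi_pi _ (fun y _ => hE y), ENNReal.toReal_prod,
    ← Finset.prod_const]
  exact Finset.prod_le_prod (fun _ _ => h0) hq

/-! ### Monotonicity, linearity and translation invariance -/

lemma transfer_mono {x x' : Site} {r r' : ℕ} {h g : Set Site → ℝ} (hh : LocalOn x r h)
    (hg : LocalOn x' r' g) {A : Set Site} (hle : ∀ U, h (ustep π U A) ≤ g (ustep π U A)) :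
    transfer π h A ≤ transfer π g A :=
  integral_mono (hh.integrable_ustep π A) (hg.integrable_ustep π A) hle

lemma IsPerturbation.transfer_monotone (hπ : IsPerturbation D p π) {x : Site} {r : ℕ}
    {h : Set Site → ℝ} (hh : LocalOn x r h) (hm : Monotone h) : Monotone (transfer π h) :=
  fun A B hAB => integral_mono (hh.integrable_ustep π A) (hh.integrable_ustep π B)
    fun U => hm (hπ.ustep_mono U hAB)

lemma transfer_const (c : ℝ) (A : Set Site) : transfer π (fun _ => c) A = c := by simp [transfer]

lemma transfer_add {x x' : Site} {r r' : ℕ} {h g : Set Site → ℝ} (hh : LocalOn x r h)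
    (hg : LocalOn x' r' g) (A : Set Site) :
    transfer π (fun B => h B + g B) A = transfer π h A + transfer π g A :=
  integral_add (hh.integrable_ustep π A) (hg.integrable_ustep π A)

lemma transfer_const_mul (c : ℝ) (h : Set Site → ℝ) (A : Set Site) :
    transfer π (fun B => c * h B) A = c * transfer π h A :=
  integral_const_mul c _

lemma transfer_sum {ι : Type*} {s : Finset ι} {x : ι → Site} {r : ι → ℕ} {h : ι → Set Site → ℝ}
    (hh : ∀ i ∈ s, LocalOn (x i) (r i) (h i)) (A : Set Site) :
    transfer π (fun B => ∑ i ∈ s, h i B) A = ∑ i ∈ s, transfer π (h i) A :=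
  integral_finsetSum s fun i hi => (hh i hi).integrable_ustep π A

/-- The transition operator commutes with lattice translations. -/
lemma transfer_shift (hπ : IsRule N π) {x : Site} {r : ℕ} {h : Set Site → ℝ} (hh : LocalOn x r h)
    (z : Site) (A : Set Site) :
    transfer π h (shift z A) = transfer π (fun B => h (shift z B)) A := by
  refine hh.integral_congr (X := fun U => ustep π U (shift z A))
    (X' := fun U => shift z (ustep π U A)) (measurableSet_mem_ustep π _)
    (fun y => measurableSet_mem_ustep π A (y + z)) (iIndepFun_mem_ustep π _) ?_ ?_
  · exact (iIndepFun_mem_ustep π A).precomp (g := fun y => y + z) (add_left_injective z)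
  · intro y
    rw [unif_real_mem_ustep hπ, view_shift]
    exact (unif_real_mem_ustep hπ A (y + z)).symm

/-! ### Iterates of the transition operator -/

/-- The `t`-step transition operator. -/
def iter (π : LocalConfig N → ℝ) (t : ℕ) (h : Set Site → ℝ) : Set Site → ℝ := (transfer π)^[t] h

@[simp] lemma iter_zero (h : Set Site → ℝ) : iter π 0 h = h := rfl

lemma iter_succ (t : ℕ) (h : Set Site → ℝ) : iter π (t + 1) h = iter π t (transfer π h) := rfl

lemma iter_succ' (t : ℕ) (h : Set Site → ℝ) : iter π (t + 1) h = transfer π (iter π t h) :=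
  Function.iterate_succ_apply' _ _ _

lemma iter_add (s t : ℕ) (h : Set Site → ℝ) : iter π (s + t) h = iter π s (iter π t h) :=
  Function.iterate_add_apply _ _ _ _

lemma LocalOn.iter_local {x : Site} {r : ℕ} {h : Set Site → ℝ} (hh : LocalOn x r h)
    (π : LocalConfig N → ℝ) (t : ℕ) : LocalOn x (r + t * radius N) (iter π t h) := by
  induction t with
  | zero => simpa using hh
  | succ t ih => rw [iter_succ']; convert ih.transfer_local π using 1; ring

/-- An inequality between local functionals that holds on a class of sets closed under the random
step is preserved by the transition operators. -/
lemma iter_le_iter {𝒞 : Set Site → Prop} (hcl : ∀ A, 𝒞 A → ∀ U, 𝒞 (ustep π U A))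
    {x x' : Site} {r r' : ℕ} {h g : Set Site → ℝ} (hh : LocalOn x r h)
    (hg : LocalOn x' r' g) (hle : ∀ A, 𝒞 A → h A ≤ g A) (t : ℕ) {A : Set Site} (hA : 𝒞 A) :
    iter π t h A ≤ iter π t g A := by
  induction t generalizing A with
  | zero => exact hle A hA
  | succ t ih =>
    rw [iter_succ', iter_succ']
    exact transfer_mono (hh.iter_local π t) (hg.iter_local π t) fun U => ih (hcl A hA U)

lemma iter_mono {x x' : Site} {r r' : ℕ} {h g : Set Site → ℝ} (hh : LocalOn x r h)
    (hg : LocalOn x' r' g) (hle : ∀ A, h A ≤ g A) (t : ℕ) (A : Set Site) :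
    iter π t h A ≤ iter π t g A :=
  iter_le_iter (𝒞 := fun _ => True) (fun _ _ _ => trivial) hh hg (fun A _ => hle A) t trivial

lemma IsPerturbation.iter_monotone (hπ : IsPerturbation D p π) {x : Site} {r : ℕ}
    {h : Set Site → ℝ} (hh : LocalOn x r h) (hm : Monotone h) (t : ℕ) :
    Monotone (iter π t h) := by
  induction t with
  | zero => exact hm
  | succ t ih => rw [iter_succ']; exact hπ.transfer_monotone (hh.iter_local π t) ih

lemma iter_const (c : ℝ) (t : ℕ) : iter π t (fun _ => c) = fun _ => c := by
  induction t with
  | zero => rfl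
  | succ t ih => rw [iter_succ', ih]; funext A; exact transfer_const c A

lemma iter_add_fun {x x' : Site} {r r' : ℕ} {h g : Set Site → ℝ} (hh : LocalOn x r h)
    (hg : LocalOn x' r' g) (t : ℕ) (A : Set Site) :
    iter π t (fun B => h B + g B) A = iter π t h A + iter π t g A := by
  induction t generalizing A with
  | zero => rfl
  | succ t ih =>
    simp only [iter_succ']
    rw [← transfer_add (hh.iter_local π t) (hg.iter_local π t)]
    congr 1
    exact funext ih

lemma iter_const_mul (c : ℝ) (h : Set Site → ℝ) (t : ℕ) (A : Set Site) :
    iter π t (fun B => c * h B) A = c * iter π t h A := by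
  induction t generalizing A with
  | zero => rfl
  | succ t ih =>
    simp only [iter_succ']
    rw [← transfer_const_mul]
    congr 1
    exact funext ih

lemma iter_sum {ι : Type*} {s : Finset ι} {x : ι → Site} {r : ι → ℕ} {h : ι → Set Site → ℝ}
    (hh : ∀ i ∈ s, LocalOn (x i) (r i) (h i)) (t : ℕ) (A : Set Site) :
    iter π t (fun B => ∑ i ∈ s, h i B) A = ∑ i ∈ s, iter π t (h i) A := by
  induction t generalizing A with
  | zero => rfl
  | succ t ih =>
    simp only [iter_succ']
    rw [← transfer_sum fun i hi => (hh i hi).iter_local π t]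
    congr 1
    exact funext ih

lemma iter_shift (hπ : IsRule N π) {x : Site} {r : ℕ} {h : Set Site → ℝ} (hh : LocalOn x r h)
    (z : Site) (t : ℕ) (A : Set Site) :
    iter π t h (shift z A) = iter π t (fun B => h (shift z B)) A := by
  induction t generalizing A with
  | zero => rfl
  | succ t ih =>
    simp only [iter_succ']
    rw [transfer_shift hπ (hh.iter_local π t)]
    congr 1
    exact funext ih

/-! ### Occupation probabilities started from half-spaces -/

open Classical in
/-- The indicator that `x` is occupied. -/
def occ (x : Site) (A : Set Site) : ℝ := if x ∈ A then 1 else 0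

open Classical in
/-- The indicator that `x` is vacant. -/
def vac (x : Site) (A : Set Site) : ℝ := if x ∈ A then 0 else 1

lemma occ_of_mem {x : Site} {A : Set Site} (h : x ∈ A) : occ x A = 1 := by simp [occ, h]
lemma occ_of_notMem {x : Site} {A : Set Site} (h : x ∉ A) : occ x A = 0 := by simp [occ, h]
lemma vac_of_mem {x : Site} {A : Set Site} (h : x ∈ A) : vac x A = 0 := by simp [vac, h]
lemma vac_of_notMem {x : Site} {A : Set Site} (h : x ∉ A) : vac x A = 1 := by simp [vac, h]

lemma occ_nonneg (x : Site) (A : Set Site) : 0 ≤ occ x A := by unfold occ; split_ifs <;> simp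
lemma vac_nonneg (x : Site) (A : Set Site) : 0 ≤ vac x A := by unfold vac; split_ifs <;> simp

lemma occ_add_vac (x : Site) (A : Set Site) : occ x A + vac x A = 1 := by
  unfold occ vac; split_ifs <;> simp

lemma occ_monotone (x : Site) : Monotone (occ x) := by
  intro A B h
  by_cases hx : x ∈ A
  · rw [occ_of_mem hx, occ_of_mem (h hx)]
  · rw [occ_of_notMem hx]; exact occ_nonneg _ _

lemma localOn_occ_of_mem {x y : Site} {r : ℕ} (hy : y ∈ box x r) : LocalOn x r (occ y) := by
  intro A B h
  classical exact if_congr (h y hy) rfl rfl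

lemma localOn_occ (x : Site) : LocalOn x 0 (occ x) := localOn_occ_of_mem (self_mem_box x 0)

lemma localOn_vac_of_mem {x y : Site} {r : ℕ} (hy : y ∈ box x r) : LocalOn x r (vac y) := by
  intro A B h
  classical exact if_congr (h y hy) rfl rfl

lemma localOn_vac (x : Site) : LocalOn x 0 (vac x) := localOn_vac_of_mem (self_mem_box x 0)

lemma occ_shift (x z : Site) (A : Set Site) : occ x (shift z A) = occ (x + z) A := rfl

lemma iter_nonneg {x : Site} {r : ℕ} {h : Set Site → ℝ} (hh : LocalOn x r h) (h0 : ∀ A, 0 ≤ h A)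
    (t : ℕ) (A : Set Site) : 0 ≤ iter π t h A := by
  have := iter_mono (π := π) (localOn_const x r 0) hh h0 t A
  rwa [iter_const] at this

lemma iter_occ_add_vac (x : Site) (t : ℕ) (A : Set Site) :
    iter π t (occ x) A + iter π t (vac x) A = 1 := by
  rw [← iter_add_fun (localOn_occ x) (localOn_vac x)]
  simp only [occ_add_vac]
  rw [iter_const]

/-- The probability that a site at height `s` above a half-space is occupied at time `t`, when the
dynamics start from the half-space. -/
def occProb (π : LocalConfig N → ℝ) (u : Plane) (t : ℕ) (s : ℝ) : ℝ := iter π t (occ 0) (Hs u (-s))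

/-- The probability that a site at height `s` above a half-space is vacant at time `t`, when the
dynamics start from the half-space. -/
def vacProb (π : LocalConfig N → ℝ) (u : Plane) (t : ℕ) (s : ℝ) : ℝ := iter π t (vac 0) (Hs u (-s))

lemma occProb_add_vacProb (t : ℕ) (s : ℝ) : occProb π u t s + vacProb π u t s = 1 :=
  iter_occ_add_vac _ _ _

lemma occProb_nonneg (t : ℕ) (s : ℝ) : 0 ≤ occProb π u t s :=
  iter_nonneg (localOn_occ 0) (occ_nonneg 0) _ _

lemma vacProb_nonneg (t : ℕ) (s : ℝ) : 0 ≤ vacProb π u t s :=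
  iter_nonneg (localOn_vac 0) (vac_nonneg 0) _ _

lemma iter_occ_Hs (hπ : IsRule N π) (u : Plane) (t : ℕ) (x : Site) (m : ℝ) :
    iter π t (occ x) (Hs u m) = occProb π u t (lev u x - m) := by
  have := iter_shift hπ (localOn_occ 0) x t (Hs u m)
  rw [shift_Hs] at this
  simp only [occ_shift, zero_add] at this
  rw [occProb, neg_sub, this]

lemma iter_vac_Hs (hπ : IsRule N π) (u : Plane) (t : ℕ) (x : Site) (m : ℝ) :
    iter π t (vac x) (Hs u m) = vacProb π u t (lev u x - m) := by
  linarith [iter_occ_add_vac (π := π) x t (Hs u m), iter_occ_Hs hπ u t x m,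
    occProb_add_vacProb (π := π) (u := u) t (lev u x - m)]

namespace IsPerturbation

lemma iter_occ_mono (hπ : IsPerturbation D p π) (x : Site) (t : ℕ) :
    Monotone (iter π t (occ x)) := hπ.iter_monotone (localOn_occ x) (occ_monotone x) t

lemma iter_vac_anti (hπ : IsPerturbation D p π) (x : Site) (t : ℕ) :
    Antitone (iter π t (vac x)) := by
  intro A B h
  linarith [hπ.iter_occ_mono x t h, iter_occ_add_vac (π := π) x t A,
    iter_occ_add_vac (π := π) x t B]

lemma occProb_antitone (hπ : IsPerturbation D p π) (u : Plane) (t : ℕ) :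
    Antitone (occProb π u t) :=
  fun _ _ h => hπ.iter_occ_mono 0 t (Hs_mono u (neg_le_neg h))

lemma vacProb_monotone (hπ : IsPerturbation D p π) (u : Plane) (t : ℕ) :
    Monotone (vacProb π u t) :=
  fun _ _ h => hπ.iter_vac_anti 0 t (Hs_mono u (neg_le_neg h))

lemma occProb_time_mono (hπ : IsPerturbation D p π) (u : Plane) (s : ℝ) :
    Monotone (fun t => occProb π u t s) := by
  refine monotone_nat_of_le_succ fun t => ?_
  rw [occProb, occProb, iter_succ]
  refine iter_mono (localOn_occ 0) ((localOn_occ 0).transfer_local π) (fun A => ?_) t _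
  rw [← transfer_const (π := π) (occ 0 A) A]
  exact transfer_mono (localOn_const 0 0 _) (localOn_occ 0)
    fun U => occ_monotone 0 (hπ.subset_ustep U A)

lemma vacProb_time_anti (hπ : IsPerturbation D p π) (u : Plane) (s : ℝ) :
    Antitone (fun t => vacProb π u t s) := by
  intro t t' h
  have := hπ.occProb_time_mono u s h
  simp only at *
  linarith [occProb_add_vacProb (π := π) (u := u) t s, occProb_add_vacProb (π := π) (u := u) t' s]

end IsPerturbation

lemma occProb_zero (s : ℝ) : occProb π u 0 s = if s ≤ 0 then 1 else 0 := by
  simp [occProb, occ, mem_Hs]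

lemma vacProb_zero (s : ℝ) : vacProb π u 0 s = if s ≤ 0 then 0 else 1 := by
  simp [vacProb, vac, mem_Hs]

lemma vacProb_of_nonpos (hπ : IsPerturbation D p π) (t : ℕ) {s : ℝ} (hs : s ≤ 0) :
    vacProb π u t s = 0 := by
  refine le_antisymm ?_ (vacProb_nonneg t s)
  have := hπ.vacProb_time_anti u s (Nat.zero_le t)
  simpa [vacProb_zero, hs] using this

/-- If the deterministic step raises half-spaces by at most `v`, then so does the random one. -/
lemma occProb_succ_le (hπ : IsPerturbation D p π) {v : ℝ}
    (hv : ∀ m, step D (Hs u m) ⊆ Hs u (m + v)) (t : ℕ) (s : ℝ) :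
    occProb π u (t + 1) s ≤ occProb π u t (s - v) := by
  rw [occProb, iter_succ', ← transfer_const (π := π) (occProb π u t (s - v)) (Hs u (-s))]
  refine transfer_mono ((localOn_occ 0).iter_local π t) (localOn_const 0 0 _) fun U => ?_
  refine (hπ.iter_occ_mono 0 t ((hπ.ustep_subset_step U _).trans (hv _))).trans (le_of_eq ?_)
  rw [occProb]; congr 2; ring

lemma occProb_add_le (hπ : IsPerturbation D p π) {v : ℝ}
    (hv : ∀ m, step D (Hs u m) ⊆ Hs u (m + v)) (t i : ℕ) (s : ℝ) :
    occProb π u (t + i) s ≤ occProb π u t (s - i * v) := by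
  induction i generalizing s with
  | zero => simp
  | succ i ih =>
    refine (occProb_succ_le hπ hv (t + i) s).trans ((ih _).trans (le_of_eq ?_))
    congr 1; push_cast; ring

lemma occProb_eq_zero (hπ : IsPerturbation D p π) {v : ℝ}
    (hv : ∀ m, step D (Hs u m) ⊆ Hs u (m + v)) {t : ℕ} {s : ℝ} (hs : t * v < s) :
    occProb π u t s = 0 := by
  refine le_antisymm ?_ (occProb_nonneg t s)
  have := occProb_add_le hπ hv 0 t s
  rw [zero_add, occProb_zero, if_neg (by linarith)] at this
  exact this

/-! ### Recursions over time blocks -/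

lemma iter_occ_empty (hD : IsCA N D) (hπ : IsPerturbation D p π) (x : Site) (t : ℕ) :
    iter π t (occ x) ∅ = 0 := by
  induction t with
  | zero => exact occ_of_notMem (by simp)
  | succ t ih =>
    rw [iter_succ']
    have : ∀ U, ustep π U ∅ = ∅ := fun U => by
      refine Set.subset_empty_iff.1 fun y hy => ?_
      obtain ⟨z, hz, -⟩ := hD.exists_mem_of_mem_step (hπ.ustep_subset_step U _ hy)
      exact hz
    simp only [transfer, this, ih, integral_zero]

/-- If a site at height `b` is unlikely to be occupied after `K` steps, then a site is occupied
after `n + K` steps only if some site of the surrounding box not much below was occupied after `n`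
steps. -/
lemma occProb_add_le_block (hD : IsCA N D) (hπ : IsPerturbation D p π) (hu : ‖u‖ = 1) {K : ℕ}
    {b κ : ℝ} (hκ : 0 ≤ κ) (hb : occProb π u K b ≤ κ) (n : ℕ) (s : ℝ) :
    occProb π u (n + K) s ≤ (box 0 (K * radius N)).card *
      (occProb π u n (s - b) + κ * occProb π u n (s - 2 * (K * radius N : ℕ))) := by
  classical
  set W := box 0 (K * radius N) with hW
  have hloc : LocalOn 0 (K * radius N) (iter π K (occ 0)) := by
    simpa using (localOn_occ 0).iter_local π K
  have hlocc : ∀ y ∈ W, LocalOn 0 (K * radius N) (occ y) := fun y hy => localOn_occ_of_mem hy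
  have key : ∀ B, iter π K (occ 0) B ≤
      (∑ y ∈ W.filter (fun y => -b ≤ lev u y), occ y B) + κ * ∑ y ∈ W, occ y B := by
    intro B
    have hs1 : 0 ≤ ∑ y ∈ W.filter (fun y => -b ≤ lev u y), occ y B :=
      Finset.sum_nonneg fun y _ => occ_nonneg y B
    have hs2 : 0 ≤ κ * ∑ y ∈ W, occ y B :=
      mul_nonneg hκ (Finset.sum_nonneg fun y _ => occ_nonneg y B)
    by_cases h1 : ∃ y ∈ W, -b ≤ lev u y ∧ y ∈ B
    · obtain ⟨y, hy, hyb, hyB⟩ := h1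
      have h2 : occ y B ≤ ∑ y ∈ W.filter (fun y => -b ≤ lev u y), occ y B :=
        Finset.single_le_sum (f := fun y => occ y B) (fun y _ => occ_nonneg y B)
          (Finset.mem_filter.2 ⟨hy, hyb⟩)
      rw [occ_of_mem hyB] at h2
      have h3 : iter π K (occ 0) B ≤ 1 := by
        linarith [iter_occ_add_vac (π := π) 0 K B,
          iter_nonneg (π := π) (localOn_vac 0) (vac_nonneg 0) K B]
      linarith
    · push Not at h1
      rw [hloc.eq_inter B]
      by_cases h2 : ∃ y ∈ W, y ∈ B
      · obtain ⟨y, hy, hyB⟩ := h2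
        have h3 : occ y B ≤ ∑ y ∈ W, occ y B :=
          Finset.single_le_sum (f := fun y => occ y B) (fun y _ => occ_nonneg y B) hy
        rw [occ_of_mem hyB] at h3
        have h4 : iter π K (occ 0) (B ∩ W) ≤ occProb π u K b := by
          refine hπ.iter_occ_mono 0 K fun z hz => ?_
          by_contra hlt
          exact h1 z hz.2 (not_le.1 hlt).le hz.1
        nlinarith
      · push Not at h2
        have : B ∩ W = ∅ := by
          ext z; simp only [Set.mem_inter_iff, Finset.mem_coe, Set.mem_empty_iff_false, iff_false]
          exact fun h => h2 z h.2 h.1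
        rw [this, iter_occ_empty hD hπ]
        positivity
  have hl1 : LocalOn 0 (K * radius N)
      (fun B => ∑ y ∈ W.filter (fun y => -b ≤ lev u y), occ y B) :=
    LocalOn.sum fun y hy => hlocc y (Finset.mem_filter.1 hy).1
  have hl2 : LocalOn 0 (K * radius N) (fun B => ∑ y ∈ W, occ y B) := LocalOn.sum hlocc
  rw [occProb, iter_add]
  refine (iter_mono hloc (hl1.comp₂ (hl2.comp (κ * ·)) (· + ·)) key n _).trans ?_
  rw [iter_add_fun hl1 (hl2.comp (κ * ·)), iter_const_mul,
    iter_sum (fun y _ => localOn_occ y), iter_sum (fun y _ => localOn_occ y)]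
  simp only [iter_occ_Hs hπ.rule, sub_neg_eq_add]
  rw [mul_add, mul_left_comm]
  refine add_le_add ?_ (mul_le_mul_of_nonneg_left ?_ hκ)
  · calc ∑ y ∈ W.filter (fun y => -b ≤ lev u y), occProb π u n (lev u y + s)
        ≤ ∑ y ∈ W.filter (fun y => -b ≤ lev u y), occProb π u n (s - b) := by
          refine Finset.sum_le_sum fun y hy => hπ.occProb_antitone u n ?_
          linarith [(Finset.mem_filter.1 hy).2]
      _ ≤ W.card * occProb π u n (s - b) := by
          rw [Finset.sum_const, nsmul_eq_mul]
          exact mul_le_mul_of_nonneg_right (by exact_mod_cast Finset.card_filter_le _ _)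
            (occProb_nonneg _ _)
  · rw [← nsmul_eq_mul, ← Finset.sum_const]
    refine Finset.sum_le_sum fun y hy => hπ.occProb_antitone u n ?_
    linarith [(abs_le.1 (abs_lev_le hu hy)).1]

/-- If a site at height `a` is unlikely to be vacant after `K` steps, then a site is vacant after
`n + K` steps only if some site of the surrounding box not much above was vacant after `n` steps. -/
lemma vacProb_add_le_block (hπ : IsPerturbation D p π) {K : ℕ}
    {a κ : ℝ} (hκ : 0 ≤ κ) (ha : vacProb π u K a ≤ κ) (n : ℕ) (s : ℝ) :
    vacProb π u (n + K) s ≤ (box 0 (K * radius N)).card * vacProb π u n (s - a)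
      + κ * vacProb π u n s := by
  classical
  set W := box 0 (K * radius N) with hW
  have hloc : LocalOn 0 (K * radius N) (iter π K (vac 0)) := by
    simpa using (localOn_vac 0).iter_local π K
  have hlvac : ∀ y ∈ W, LocalOn 0 (K * radius N) (vac y) := fun y hy => localOn_vac_of_mem hy
  have key : ∀ B, iter π K (vac 0) B ≤
      (∑ y ∈ W.filter (fun y => lev u y ≤ -a), vac y B) + κ * vac 0 B := by
    intro B
    have hs1 : 0 ≤ ∑ y ∈ W.filter (fun y => lev u y ≤ -a), vac y B :=
      Finset.sum_nonneg fun y _ => vac_nonneg y B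
    by_cases h0 : (0 : Site) ∈ B
    · have h1 : iter π K (vac 0) B ≤ 0 := by
        have := iter_le_iter (π := π) (𝒞 := fun B => (0 : Site) ∈ B)
          (fun A hA U => hπ.subset_ustep U A hA) (localOn_vac 0) (localOn_const 0 0 0)
          (fun A hA => (vac_of_mem hA).le) K h0
        rwa [iter_const] at this
      rw [vac_of_mem h0]; linarith
    · rw [vac_of_notMem h0, mul_one]
      by_cases h1 : ∃ y ∈ W, lev u y ≤ -a ∧ y ∉ B
      · obtain ⟨y, hy, hyb, hyB⟩ := h1
        have h2 : vac y B ≤ ∑ y ∈ W.filter (fun y => lev u y ≤ -a), vac y B :=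
          Finset.single_le_sum (f := fun y => vac y B) (fun y _ => vac_nonneg y B)
            (Finset.mem_filter.2 ⟨hy, hyb⟩)
        rw [vac_of_notMem hyB] at h2
        have h3 : iter π K (vac 0) B ≤ 1 := by
          linarith [iter_occ_add_vac (π := π) 0 K B,
            iter_nonneg (π := π) (localOn_occ 0) (occ_nonneg 0) K B]
        linarith
      · push Not at h1
        have h4 : iter π K (vac 0) B ≤ vacProb π u K a := by
          rw [vacProb, hloc.eq_inter (Hs u (-a))]
          exact hπ.iter_vac_anti 0 K fun z hz => h1 z hz.2 hz.1
        linarith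
  have hl1 : LocalOn 0 (K * radius N)
      (fun B => ∑ y ∈ W.filter (fun y => lev u y ≤ -a), vac y B) :=
    LocalOn.sum fun y hy => hlvac y (Finset.mem_filter.1 hy).1
  rw [vacProb, iter_add]
  refine (iter_mono hloc (hl1.comp₂ (((localOn_vac 0).mono (Nat.zero_le _)).comp (κ * ·)) (· + ·))
    key n _).trans ?_
  rw [iter_add_fun hl1 ((localOn_vac 0).comp (κ * ·)), iter_const_mul,
    iter_sum (fun y _ => localOn_vac y)]
  simp only [iter_vac_Hs hπ.rule, sub_neg_eq_add, lev_zero, zero_add]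
  refine add_le_add ?_ le_rfl
  calc ∑ y ∈ W.filter (fun y => lev u y ≤ -a), vacProb π u n (lev u y + s)
      ≤ ∑ y ∈ W.filter (fun y => lev u y ≤ -a), vacProb π u n (s - a) := by
        refine Finset.sum_le_sum fun y hy => hπ.vacProb_monotone u n ?_
        linarith [(Finset.mem_filter.1 hy).2]
    _ ≤ W.card * vacProb π u n (s - a) := by
        rw [Finset.sum_const, nsmul_eq_mul]
        exact mul_le_mul_of_nonneg_right (by exact_mod_cast Finset.card_filter_le _ _)
          (vacProb_nonneg _ _)

/-- Iterating the upper block recursion: an exponential bound on overshooting the speed `b' / K`. -/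
lemma occProb_mul_le_exp (hD : IsCA N D) (hπ : IsPerturbation D p π) (hu : ‖u‖ = 1) {K : ℕ}
    {b b' κ θ : ℝ} (hκ : 0 ≤ κ) (hθ : 0 ≤ θ) (hb : occProb π u K b ≤ κ)
    (hθb : (box 0 (K * radius N)).card *
      (Real.exp (θ * b) + κ * Real.exp (θ * (2 * (K * radius N : ℕ)))) ≤ Real.exp (θ * b'))
    (n : ℕ) (s : ℝ) : occProb π u (n * K) s ≤ Real.exp (-(θ * (s - n * b'))) := by
  induction n generalizing s with
  | zero =>
    rw [Nat.zero_mul, occProb_zero]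
    split_ifs with h
    · apply Real.one_le_exp; simp; exact mul_nonpos_of_nonneg_of_nonpos hθ h
    · positivity
  | succ n ih =>
    rw [Nat.succ_mul]
    refine (occProb_add_le_block hD hπ hu hκ hb (n * K) s).trans ?_
    have h1 := ih (s - b)
    have h2 := ih (s - 2 * (K * radius N : ℕ))
    have e1 : Real.exp (-(θ * (s - b - n * b'))) =
        Real.exp (-(θ * (s - n * b'))) * Real.exp (θ * b) := by rw [← Real.exp_add]; congr 1; ring
    have e2 : Real.exp (-(θ * (s - 2 * (K * radius N : ℕ) - n * b'))) =
        Real.exp (-(θ * (s - n * b'))) * Real.exp (θ * (2 * (K * radius N : ℕ))) := by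
      rw [← Real.exp_add]; congr 1; ring
    have e3 : Real.exp (-(θ * (s - (n + 1 : ℕ) * b'))) =
        Real.exp (-(θ * (s - n * b'))) * Real.exp (θ * b') := by
      rw [← Real.exp_add]; congr 1; push_cast; ring
    rw [e1] at h1
    rw [e2] at h2
    rw [e3]
    calc _ ≤ ((box 0 (K * radius N)).card : ℝ) * (Real.exp (-(θ * (s - n * b'))) * Real.exp (θ * b)
          + κ * (Real.exp (-(θ * (s - n * b'))) * Real.exp (θ * (2 * (K * radius N : ℕ))))) := by
          gcongr
      _ = Real.exp (-(θ * (s - n * b'))) * ((box 0 (K * radius N)).card *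
          (Real.exp (θ * b) + κ * Real.exp (θ * (2 * (K * radius N : ℕ))))) := by ring
      _ ≤ _ := by gcongr

/-- Iterating the lower block recursion: an exponential bound on lagging behind the speed
`a' / K`. -/
lemma vacProb_mul_le_exp (hπ : IsPerturbation D p π) {K : ℕ}
    {a a' κ θ : ℝ} (hκ : 0 ≤ κ) (hθ : 0 ≤ θ) (ha : vacProb π u K a ≤ κ)
    (hθa : (box 0 (K * radius N)).card * Real.exp (-(θ * a)) + κ ≤ Real.exp (-(θ * a')))
    (n : ℕ) (s : ℝ) : vacProb π u (n * K) s ≤ Real.exp (θ * (s - n * a')) := by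
  induction n generalizing s with
  | zero =>
    rw [Nat.zero_mul, vacProb_zero]
    split_ifs with h
    · positivity
    · apply Real.one_le_exp; simp; exact mul_nonneg hθ (not_le.1 h).le
  | succ n ih =>
    rw [Nat.succ_mul]
    refine (vacProb_add_le_block hπ hκ ha (n * K) s).trans ?_
    have h1 := ih (s - a)
    have h2 := ih s
    have e1 : Real.exp (θ * (s - a - n * a')) =
        Real.exp (θ * (s - n * a')) * Real.exp (-(θ * a)) := by rw [← Real.exp_add]; congr 1; ring
    have e3 : Real.exp (θ * (s - (n + 1 : ℕ) * a')) =
        Real.exp (θ * (s - n * a')) * Real.exp (-(θ * a')) := by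
      rw [← Real.exp_add]; congr 1; push_cast; ring
    rw [e1] at h1
    rw [e3]
    calc _ ≤ ((box 0 (K * radius N)).card : ℝ) * (Real.exp (θ * (s - n * a')) *
          Real.exp (-(θ * a))) + κ * Real.exp (θ * (s - n * a')) := by gcongr
      _ = Real.exp (θ * (s - n * a')) *
          ((box 0 (K * radius N)).card * Real.exp (-(θ * a)) + κ) := by ring
      _ ≤ _ := by gcongr

/-! ### Uniform local regularity -/

lemma mem_box_of_dist_le {x y : Site} {n : ℕ} (h : dist (toPlane x) (toPlane y) ≤ n) :
    y ∈ box x n := by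
  have key : ∀ i, |toPlane x i - toPlane y i| ≤ n := by
    intro i
    have := PiLp.norm_apply_le (toPlane x - toPlane y) i
    rw [← dist_eq_norm] at this
    simpa using this.trans h
  have h0 := key 0
  have h1 := key 1
  simp only [toPlane] at h0 h1
  rw [mem_box, abs_sub_comm, abs_sub_comm y.2]
  simp at h0 h1
  exact ⟨by exact_mod_cast h0, by exact_mod_cast h1⟩

lemma evolve_congr_shift {ξ ξ' : Site → ℕ → LocalConfig N → Bool} {A B : Set Site} (z : Site)
    (t : ℕ) (x : Site) (hA : ∀ y ∈ box x (t * radius N), y ∈ A ↔ y + z ∈ B)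
    (hξ : ∀ y ∈ box x (t * radius N), ∀ s S, ξ y s S = ξ' (y + z) s S) :
    x ∈ evolve ξ A t ↔ x + z ∈ evolve ξ' B t := by
  induction t generalizing x with
  | zero => exact hA x (self_mem_box _ _)
  | succ t ih =>
    have hv : view N (evolve ξ A t) x = view N (evolve ξ' B t) (x + z) := by
      refine view_congr fun y hy => ?_
      rw [add_right_comm]
      have hsub : ∀ w ∈ box (x + y) (t * radius N), w ∈ box x ((t + 1) * radius N) := by
        intro w hw
        have := mem_box_trans (add_mem_box hy x) hw
        rwa [show radius N + t * radius N = (t + 1) * radius N by ring] at this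
      exact ih (x + y) (fun w hw => hA w (hsub w hw)) fun w hw => hξ w (hsub w hw)
    simp only [evolve, Set.mem_ofPred_eq]
    rw [hv, hξ x (self_mem_box _ _)]

lemma IsCA.isAssignment_step (hD : IsCA N D) [DecidablePred fun S => D S = 1] :
    IsAssignment D (fun _ _ S => decide (D S = 1)) where
  mono x t S₁ S₂ h h1 := by
    simp only [decide_eq_true_eq] at *
    exact hD.eq_one_of_le h h1
  solid x t S h := by simpa using hD.solid S h
  sufficient x t S h := by simpa using h

lemma IsCA.evolve_step (hD : IsCA N D) [DecidablePred fun S => D S = 1] (A : Set Site) (t : ℕ) :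
    evolve (fun _ _ S => decide (D S = 1)) A t = (step D)^[t] A := by
  induction t with
  | zero => rfl
  | succ t ih =>
    ext x
    rw [Function.iterate_succ_apply', hD.mem_step_iff, ← ih]
    simp [evolve]

/-- Some finite set fills space. -/
lemma exists_finite_fillsSpace (hD : IsCA N D) (hsuper : Supercritical D)
    (hreg : LocallyRegular D) : ∃ (G : Set Site) (r : ℕ), G ⊆ box 0 r ∧ FillsSpace D G := by
  classical
  set u : Plane := !₂[1, 0] with hu_def
  have hu : ‖u‖ = 1 := by
    rw [EuclideanSpace.norm_eq]; simp [hu_def]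
  have hfill := hD.fillsSpace_Hs hsuper hu 0
  obtain ⟨C, hC⟩ := hreg _ hfill
  obtain ⟨n, hn⟩ := exists_nat_ge C
  have hx : ((n + 1 : ℤ), (0 : ℤ)) ∈ ⋃ t : ℕ, (step D)^[t] (Hs u 0) := by
    rw [FillsSpace] at hfill; rw [hfill]; trivial
  obtain ⟨t, ht⟩ := Set.mem_iUnion.1 hx
  rw [← hD.evolve_step] at ht
  obtain ⟨G, -, hGC, hG⟩ := hC _ hD.isAssignment_step t _ ht fun a ha => by
    by_contra! hlt
    have h1 := (mem_box.1 (mem_box_of_dist_le (hlt.le.trans hn))).1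
    rw [mem_Hs, lev_eq] at ha
    simp only [hu_def] at ha
    simp at ha
    rw [abs_le] at h1
    have := h1.1
    simp only at this
    linarith
  refine ⟨G, (n + 1) + n, fun g hg => ?_, hG⟩
  have h1 := mem_box_of_dist_le ((hGC g hg).trans hn)
  refine mem_box_trans ?_ h1
  rw [mem_box]
  simp only [Prod.fst_zero, Prod.snd_zero, sub_zero, abs_zero]
  constructor
  · rw [abs_of_nonneg (by positivity)]; push_cast; exact le_rfl
  · positivity

/-- The constant of local regularity can be taken independent of the initial set, which need not
fill space. Otherwise counterexamples for larger and larger constants, placed far apart from one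
another and next to a finite set that fills space, would form a single initial set without a
constant. -/
lemma exists_uniform_regular (hD : IsCA N D) (hsuper : Supercritical D)
    (hreg : LocallyRegular D) : ∃ C : ℕ, ∀ (A₀ : Set Site) (ξ : Site → ℕ → LocalConfig N → Bool),
      IsAssignment D ξ → ∀ (t : ℕ) (x : Site), x ∈ evolve ξ A₀ t → (∀ a ∈ A₀, a ∉ box x C) →
        ∃ G : Set Site, G ⊆ evolve ξ A₀ t ∧ G ⊆ box x C ∧ FillsSpace D G := by
  classical
  by_contra! hcon
  choose A ξ hξ t x hx hfar hno using hcon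
  obtain ⟨G₀, r₀, hG₀r, hG₀⟩ := exists_finite_fillsSpace hD hsuper hreg
  -- What happens in `box (x n) n` up to time `t n` depends only on `box (x n) (ρ n)`.
  set ρ : ℕ → ℕ := fun n => n + t n * radius N with hρ
  -- The first coordinate of the place to which the `n`th example is moved, chosen so that the boxes
  -- of radius `ρ n` around these places are disjoint from one another and from `G₀`.
  set M : ℕ → ℕ := fun n => r₀ + 1 + ρ n + ∑ k ∈ Finset.range n, 2 * (ρ k + 1) with hM
  have hM0 : ∀ n, r₀ + ρ n < M n := fun n => by simp only [hM]; omega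
  have hMlt : ∀ m n, m < n → M m + ρ m + ρ n < M n := by
    intro m n hmn
    have h1 : ∑ k ∈ Finset.range (m + 1), 2 * (ρ k + 1) ≤ ∑ k ∈ Finset.range n, 2 * (ρ k + 1) :=
      Finset.sum_le_sum_of_subset (Finset.range_mono hmn)
    rw [Finset.sum_range_succ] at h1
    simp only [hM]
    omega
  set c : ℕ → Site := fun n => ((M n : ℤ), 0) with hc
  have huniq : ∀ m n y, y ∈ box (c m) (ρ m) → y ∈ box (c n) (ρ n) → m = n := by
    have aux : ∀ m n y, m < n → y ∈ box (c m) (ρ m) → y ∈ box (c n) (ρ n) → False := by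
      intro m n y hmn h1 h2
      have h3 := hMlt m n hmn
      have h4 := (mem_box.1 h1).1
      have h5 := (mem_box.1 h2).1
      simp only [hc, abs_le] at h4 h5
      omega
    intro m n y h1 h2
    rcases lt_trichotomy m n with h | h | h
    · exact (aux m n y h h1 h2).elim
    · exact h
    · exact (aux n m y h h2 h1).elim
  -- The set `G₀` makes the initial set fill space; outside the boxes nothing ever grows.
  set B : Set Site := G₀ ∪ {y | ∃ n, y ∈ box (c n) (ρ n) ∧ y - c n + x n ∈ A n} with hB
  set ζ : Site → ℕ → LocalConfig N → Bool := fun y s S =>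
    if h : ∃ n, y ∈ box (c n) (ρ n) then ξ h.choose (y - c h.choose + x h.choose) s S
    else decide ((0 : Site) ∈ (S : Finset Site)) with hζ
  have hζeq : ∀ n y, y ∈ box (c n) (ρ n) → ∀ s S, ζ y s S = ξ n (y - c n + x n) s S := by
    intro n y hy s S
    have h : ∃ n, y ∈ box (c n) (ρ n) := ⟨n, hy⟩
    have e : h.choose = n := huniq _ _ y h.choose_spec hy
    simp only [hζ, dif_pos h, e]
  have hζA : IsAssignment D ζ := by
    constructor
    · intro y s S₁ S₂ hS h1
      by_cases h : ∃ n, y ∈ box (c n) (ρ n)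
      · obtain ⟨n, hn⟩ := h
        rw [hζeq n y hn] at h1 ⊢
        exact (hξ n).mono _ _ _ _ hS h1
      · simp only [hζ, dif_neg h, decide_eq_true_eq] at h1 ⊢
        exact hS h1
    · intro y s S h0
      by_cases h : ∃ n, y ∈ box (c n) (ρ n)
      · obtain ⟨n, hn⟩ := h
        rw [hζeq n y hn]
        exact (hξ n).solid _ _ _ h0
      · simpa only [hζ, dif_neg h, decide_eq_true_eq] using h0
    · intro y s S h1
      by_cases h : ∃ n, y ∈ box (c n) (ρ n)
      · obtain ⟨n, hn⟩ := h
        rw [hζeq n y hn] at h1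
        exact (hξ n).sufficient _ _ _ h1
      · simp only [hζ, dif_neg h, decide_eq_true_eq] at h1
        exact hD.solid _ h1
  -- The example whose index exceeds the constant of `B` contradicts local regularity.
  obtain ⟨C, hC⟩ := hreg B (hD.fillsSpace_mono Set.subset_union_left hG₀)
  obtain ⟨n, hn⟩ := exists_nat_ge C
  have hBn : ∀ y, y ∈ box (x n) (ρ n) → (y ∈ A n ↔ y + (c n - x n) ∈ B) := by
    intro y hy
    have hy' : y + (c n - x n) ∈ box (c n) (ρ n) := by
      have := (mem_box_add_right (z := c n - x n)).2 hy
      rwa [add_sub_cancel] at this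
    have e : y + (c n - x n) - c n + x n = y := by abel
    constructor
    · intro h
      exact Or.inr ⟨n, hy', by rwa [e]⟩
    · rintro (h | ⟨m, hm, hmA⟩)
      · exfalso
        have h1 := (mem_box.1 (hG₀r h)).1
        have h2 := (mem_box.1 hy').1
        have h3 := hM0 n
        simp only [hc, Prod.fst_zero, sub_zero, abs_le] at h1 h2
        omega
      · obtain rfl := huniq m n _ hm hy'
        rwa [e] at hmA
  have hevol : ∀ y ∈ box (x n) n,
      (y ∈ evolve (ξ n) (A n) (t n) ↔ y + (c n - x n) ∈ evolve ζ B (t n)) := by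
    intro y hy
    refine evolve_congr_shift _ _ _ (fun w hw => hBn w (mem_box_trans hy hw)) fun w hw s S => ?_
    have hw' := (mem_box_add_right (z := c n - x n)).2 (mem_box_trans hy hw)
    rw [add_sub_cancel] at hw'
    rw [hζeq n _ hw']
    congr 1
    abel
  have hcn : c n ∈ evolve ζ B (t n) := by
    have := (hevol (x n) (self_mem_box _ _)).1 (hx n)
    rwa [add_sub_cancel] at this
  obtain ⟨G, hGB, hGC, hG⟩ := hC ζ hζA (t n) (c n) hcn fun a ha => by
    by_contra! hlt
    have h1 := mem_box_of_dist_le (hlt.le.trans hn)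
    have h2 : a - (c n - x n) ∈ box (x n) n := by
      rw [← mem_box_add_right (z := c n - x n)]
      simpa using h1
    have h3 := (hBn _ (box_mono _ (Nat.le_add_right _ _) h2)).2 (by simpa using ha)
    exact hfar n _ h3 h2
  refine hno n (shift (c n - x n) G) ?_ ?_ (hD.fillsSpace_shift hG _)
  · intro y hy
    have h1 := mem_box_of_dist_le ((hGC _ hy).trans hn)
    have h2 : y ∈ box (x n) n := by
      rw [← mem_box_add_right (z := c n - x n)]
      simpa using h1
    exact (hevol y h2).2 (hGB hy)
  · intro y hy
    have h1 := mem_box_of_dist_le ((hGC _ hy).trans hn)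
    rw [Finset.mem_coe, ← mem_box_add_right (z := c n - x n)]
    simpa using h1

/-- The sets that an assignment can produce from the half-space of sites of level at most `m`. -/
def Reach (D : LocalConfig N → ℝ) (u : Plane) (m : ℝ) (A : Set Site) : Prop :=
  ∃ ξ t, IsAssignment D ξ ∧ A = evolve ξ (Hs u m) t

lemma reach_Hs (hD : IsCA N D) (u : Plane) (m : ℝ) : Reach D u m (Hs u m) := by
  classical
  exact ⟨_, 0, hD.isAssignment_step, rfl⟩

lemma Reach.ustep (hπ : IsPerturbation D p π) {m : ℝ} {A : Set Site}
    (hA : Reach D u m A) (U : Site → unitInterval) : Reach D u m (ustep π U A) := by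
  classical
  obtain ⟨ξ, t, hξ, rfl⟩ := hA
  set ζ : Site → ℕ → LocalConfig N → Bool := fun x s S =>
    if s < t then ξ x s S else decide (0 < π S ∧ (U x : ℝ) ≤ π S) with hζ
  have hζ1 : ∀ x s S, s < t → ζ x s S = ξ x s S := fun x s S h => if_pos h
  have hζ2 : ∀ x S, ζ x t S = decide (0 < π S ∧ (U x : ℝ) ≤ π S) :=
    fun x S => if_neg (lt_irrefl t)
  have hlt : ∀ s ≤ t, evolve ζ (Hs u m) s = evolve ξ (Hs u m) s := by
    intro s
    induction s with
    | zero => exact fun _ => rfl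
    | succ s ih =>
      intro hs
      ext x
      simp only [evolve, Set.mem_ofPred_eq, ih (Nat.le_of_succ_le hs), hζ1 _ _ _ hs]
  refine ⟨ζ, t + 1, ⟨?_, ?_, ?_⟩, ?_⟩
  · intro x s S₁ S₂ hS h1
    by_cases hs : s < t
    · simp only [hζ, if_pos hs] at h1 ⊢
      exact hξ.mono _ _ _ _ hS h1
    · simp only [hζ, if_neg hs, decide_eq_true_eq] at h1 ⊢
      exact ⟨h1.1.trans_le (hπ.rule.mono _ _ hS), h1.2.trans (hπ.rule.mono _ _ hS)⟩
  · intro x s S h0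
    by_cases hs : s < t
    · simp only [hζ, if_pos hs]
      exact hξ.solid _ _ _ h0
    · simp only [hζ, if_neg hs, decide_eq_true_eq, hπ.rule.solid S h0]
      exact ⟨one_pos, (U x).2.2⟩
  · intro x s S h1
    by_cases hs : s < t
    · simp only [hζ, if_pos hs] at h1
      exact hξ.sufficient _ _ _ h1
    · simp only [hζ, if_neg hs, decide_eq_true_eq] at h1
      exact (hπ.support S).2 h1.1
  · ext x
    simp only [evolve, hlt t le_rfl, Set.mem_ofPred_eq, hζ2, decide_eq_true_eq, _root_.ustep]

/-- Every occupied site of a set reached from a half-space has a set that fills space nearby, within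
a distance that does not depend on the half-space. -/
lemma exists_reach_regular (hD : IsCA N D) (hsuper : Supercritical D) (hreg : LocallyRegular D) :
    ∃ C : ℕ, ∀ u : Plane, ‖u‖ = 1 → ∀ (m : ℝ) (A : Set Site), Reach D u m A → ∀ y ∈ A,
      ∃ G ⊆ A, G ⊆ box y C ∧ FillsSpace D G := by
  obtain ⟨C, hC⟩ := exists_uniform_regular hD hsuper hreg
  obtain ⟨G₀, r₀, hG₀r, hG₀⟩ := exists_finite_fillsSpace hD hsuper hreg
  refine ⟨C + (4 * r₀ + r₀), ?_⟩
  rintro u hu m A ⟨ξ, t, hξ, rfl⟩ y hy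
  by_cases hfar : ∀ a ∈ Hs u m, a ∉ box y C
  · obtain ⟨G, h1, h2, h3⟩ := hC _ ξ hξ t y hy hfar
    exact ⟨G, h1, fun g hg => box_mono _ (Nat.le_add_right _ _) (h2 hg), h3⟩
  · push Not at hfar
    obtain ⟨a, ha, hay⟩ := hfar
    obtain ⟨z, hz, hzu⟩ := exists_lev_le hu r₀
    have hsub : Hs u m ⊆ evolve ξ (Hs u m) t := by
      have h0 : (0 : Site) ∈ N := hD.zero_mem
      clear hy
      induction t with
      | zero => exact subset_rfl
      | succ t ih => exact fun x hx => hξ.solid _ _ _ (zero_mem_view h0 (ih hx))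
    refine ⟨shift (-(a + z)) G₀, ?_, ?_, hD.fillsSpace_shift hG₀ _⟩
    · intro g hg
      apply hsub
      have h1 := (abs_le.1 (abs_lev_le hu (hG₀r hg))).2
      rw [mem_Hs] at ha ⊢
      rw [← sub_eq_add_neg, lev_sub, lev_add] at h1
      linarith
    · intro g hg
      refine mem_box_trans hay (mem_box_trans (y := a + z) ?_ ?_)
      · have := (mem_box_add_right (z := a)).2 hz
        rwa [zero_add, add_comm] at this
      · have := (mem_box_add_right (z := a + z)).2 (hG₀r hg)
        rwa [zero_add, neg_add_cancel_right] at this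

/-! ### Filling in a deterministic step -/

lemma exists_nat_forall_mem_of_mono {α : Type*} (s : Finset α) {P : α → ℕ → Prop}
    (hP : ∀ a m n, m ≤ n → P a m → P a n) (h : ∀ a ∈ s, ∃ n, P a n) : ∃ n, ∀ a ∈ s, P a n := by
  choose! f hf using h
  exact ⟨s.sup f, fun a ha => hP a _ _ (Finset.le_sup ha) (hf a ha)⟩

/-- There is a time after which the deterministic dynamics, started from any set containing a
reachable set `A`, have certainly covered any given site of `step D A`. -/
lemma exists_fill_time (hD : IsCA N D) (hsuper : Supercritical D) (hreg : LocallyRegular D) :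
    ∃ τ : ℕ, ∀ u : Plane, ‖u‖ = 1 → ∀ (m : ℝ) (A : Set Site), Reach D u m A → ∀ y ∈ step D A,
      ∀ B, A ⊆ B → y ∈ (step D)^[τ] B := by
  classical
  obtain ⟨C, hC⟩ := exists_reach_regular hD hsuper hreg
  -- There are finitely many subsets of a box, so those that fill space cover a neighborhood of the
  -- origin within a common time.
  have key : ∃ τ : ℕ, ∀ G ∈ (box 0 C).powerset, FillsSpace D (G : Set Site) →
      ∀ z ∈ box 0 (radius N), z ∈ (step D)^[τ] (G : Set Site) := by
    refine exists_nat_forall_mem_of_mono _ (fun G m n hmn h hG z hz =>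
      iterate_step_subset D _ hmn (h hG z hz)) fun G _ => ?_
    by_cases hG : FillsSpace D (G : Set Site)
    · obtain ⟨n, hn⟩ := exists_nat_forall_mem_of_mono (box 0 (radius N))
        (P := fun z n => z ∈ (step D)^[n] (G : Set Site))
        (fun z m n hmn h => iterate_step_subset D _ hmn h) fun z _ => by
          rw [FillsSpace, Set.eq_univ_iff_forall] at hG
          exact Set.mem_iUnion.1 (hG z)
      exact ⟨n, fun _ => hn⟩
    · exact ⟨0, fun h => (hG h).elim⟩
  obtain ⟨τ, hτ⟩ := key
  refine ⟨τ, fun u hu m A hA y hy B hAB => ?_⟩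
  obtain ⟨a, ha, hay⟩ := hD.exists_mem_of_mem_step hy
  obtain ⟨G, hGA, hGC, hG⟩ := hC u hu m A hA a ha
  have hcoe : (((box 0 C).filter (· ∈ shift a G) : Finset Site) : Set Site) = shift a G := by
    ext z
    simp only [Finset.coe_filter, Set.mem_ofPred_eq, and_iff_right_iff_imp]
    intro hz
    rw [← mem_box_add_right (z := a), zero_add]
    exact hGC hz
  have h := hτ ((box 0 C).filter (· ∈ shift a G))
    (Finset.mem_powerset.2 (Finset.filter_subset _ _))
  rw [hcoe] at h
  have h2 := h (hD.fillsSpace_shift hG a) (y - a) (by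
    rw [← mem_box_add_right (z := a), zero_add, sub_add_cancel]
    exact mem_box_comm.1 hay)
  rw [hD.iterate_step_shift, mem_shift, sub_add_cancel] at h2
  exact hD.iterate_step_mono (hGA.trans hAB) τ h2

/-- With probability at least `p` to the number of sites, the random step agrees with the
deterministic one in a box. -/
lemma IsPerturbation.pow_mul_le_transfer (hD : IsCA N D) (hπ : IsPerturbation D p π) {x : Site}
    {r : ℕ} {h : Set Site → ℝ} (hh : LocalOn x r h) (hm : Monotone h) (h0 : ∀ A, 0 ≤ h A)
    (B : Set Site) : p ^ (box x r).card * h (step D B) ≤ transfer π h B := by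
  set E : Set (Site → unitInterval) := {U | ∀ y ∈ box x r, U y ∈ {v : unitInterval | (v : ℝ) ≤ p}}
    with hE
  have hEm : MeasurableSet {v : unitInterval | (v : ℝ) ≤ p} :=
    measurableSet_le measurable_subtype_coe measurable_const
  have hvol : p ≤ (volume : Measure unitInterval).real {v : unitInterval | (v : ℝ) ≤ p} := by
    have e : {v : unitInterval | (v : ℝ) ≤ p} = Set.Iic ⟨p, hπ.pos.le, hπ.le_one⟩ := rfl
    rw [e, measureReal_def, unitInterval.volume_Iic, ENNReal.toReal_ofReal hπ.pos.le]
  have h1 : p ^ (box x r).card ≤ unif.real E :=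
    pow_le_unif_real _ hπ.pos.le (fun _ => _) (fun _ => hEm) fun _ _ => hvol
  have hEmeas : MeasurableSet E := by
    have : E = ⋂ y ∈ box x r, {U | U y ∈ {v : unitInterval | (v : ℝ) ≤ p}} := by
      ext; simp [hE]
    rw [this]
    exact Finset.measurableSet_biInter _ fun y _ => measurable_pi_apply y hEm
  calc p ^ (box x r).card * h (step D B) ≤ unif.real E * h (step D B) :=
        mul_le_mul_of_nonneg_right h1 (h0 _)
    _ = ∫ U, E.indicator (fun _ => h (step D B)) U ∂unif := by
        rw [integral_indicator_const _ hEmeas, smul_eq_mul]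
    _ ≤ transfer π h B := by
        refine integral_mono ((integrable_const _).indicator hEmeas) (hh.integrable_ustep π B) ?_
        intro U
        by_cases hU : U ∈ E
        · simp only [Set.indicator_of_mem hU]
          rw [hh.eq_inter (step D B)]
          refine hm fun y hy => ?_
          have hy1 := hD.mem_step_iff.1 hy.1
          exact ⟨(hπ.support _).1 hy1, (hU y hy.2).trans (hπ.le_of_eq_one hy1)⟩
        · simp only [Set.indicator_of_notMem hU]
          exact h0 _

lemma IsPerturbation.pow_le_iter_occ (hD : IsCA N D) (hπ : IsPerturbation D p π) (x : Site)
    {τ t : ℕ} (ht : t ≤ τ) {B : Set Site} (hx : x ∈ (step D)^[t] B) :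
    p ^ (t * (box 0 (τ * radius N)).card) ≤ iter π t (occ x) B := by
  induction t generalizing B with
  | zero => simp [occ_of_mem (show x ∈ B from hx)]
  | succ t ih =>
    have ih' := ih (Nat.le_of_succ_le ht) (B := step D B) hx
    rw [iter_succ']
    have hloc : LocalOn x (τ * radius N) (iter π t (occ x)) :=
      ((localOn_occ x).iter_local π t).mono
        (by rw [zero_add]; exact Nat.mul_le_mul_right _ (Nat.le_of_succ_le ht))
    refine le_trans ?_ (hπ.pow_mul_le_transfer hD hloc (hπ.iter_occ_mono x t)
      (iter_nonneg (localOn_occ x) (occ_nonneg x) t) B)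
    rw [card_box x, ← card_box 0, Nat.succ_mul, pow_add, mul_comm]
    exact mul_le_mul_of_nonneg_left ih' (pow_nonneg hπ.pos.le _)

/-- In each of `j` successive periods of length `τ`, a site that the deterministic dynamics reach
from `A` in time `τ` has a chance bounded below to be reached. -/
lemma IsPerturbation.iter_vac_le_pow (hD : IsCA N D) (hπ : IsPerturbation D p π) {x : Site} {τ : ℕ}
    {A : Set Site} (hA : ∀ B, A ⊆ B → x ∈ (step D)^[τ] B) (j : ℕ) :
    iter π (j * τ) (vac x) A ≤ (1 - p ^ (τ * (box 0 (τ * radius N)).card)) ^ j := by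
  set q := p ^ (τ * (box 0 (τ * radius N)).card) with hq
  have hq1 : q ≤ 1 := pow_le_one₀ hπ.pos.le hπ.le_one
  have hcl : ∀ B, A ⊆ B → ∀ U, A ⊆ ustep π U B := fun B hB U => hB.trans (hπ.subset_ustep U B)
  have h1 : ∀ B, A ⊆ B → iter π τ (vac x) B ≤ (1 - q) * vac x B := by
    intro B hB
    by_cases hx : x ∈ B
    · have := iter_le_iter (π := π) (𝒞 := fun B => x ∈ B)
        (fun A hA U => hπ.subset_ustep U A hA) (localOn_vac x) (localOn_const 0 0 0)
        (fun A hA => (vac_of_mem hA).le) τ hx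
      rw [iter_const] at this
      rw [vac_of_mem hx, mul_zero]
      exact this
    · rw [vac_of_notMem hx, mul_one]
      linarith [hπ.pow_le_iter_occ hD x le_rfl (hA B hB), iter_occ_add_vac (π := π) x τ B]
  induction j with
  | zero =>
    simp only [zero_mul, iter_zero, pow_zero]
    linarith [occ_add_vac x A, occ_nonneg x A]
  | succ j ih =>
    rw [Nat.succ_mul, iter_add]
    have := iter_le_iter (π := π) (𝒞 := fun B => A ⊆ B) hcl ((localOn_vac x).iter_local π τ)
      ((localOn_vac x).comp ((1 - q) * ·)) h1 (j * τ) subset_rfl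
    refine this.trans ?_
    rw [iter_const_mul, pow_succ']
    exact mul_le_mul_of_nonneg_left ih (by linarith)

/-! ### Concentration of the truncated hitting time -/

/-- The expectation, for the dynamics started from `A`, of the hitting time of the origin truncated
at `n`: the sum over `r < n` of the probabilities that the origin is vacant at time `r`. -/
def hit (π : LocalConfig N → ℝ) (n : ℕ) (A : Set Site) : ℝ :=
  ∑ r ∈ Finset.range n, iter π r (vac 0) A

lemma localOn_iter_vac {r n : ℕ} (h : r ≤ n) :
    LocalOn 0 (n * radius N) (iter π r (vac 0)) :=
  ((localOn_vac 0).iter_local π r).mono (by rw [zero_add]; exact Nat.mul_le_mul_right _ h)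

lemma localOn_hit (π : LocalConfig N → ℝ) (n : ℕ) : LocalOn 0 (n * radius N) (hit π n) :=
  LocalOn.sum fun _ hr => localOn_iter_vac (Finset.mem_range.1 hr).le

lemma hit_succ (n : ℕ) (A : Set Site) : hit π (n + 1) A = vac 0 A + transfer π (hit π n) A := by
  have h : transfer π (hit π n) A = ∑ r ∈ Finset.range n, transfer π (iter π r (vac 0)) A :=
    transfer_sum (fun r hr => localOn_iter_vac (Finset.mem_range.1 hr).le) A
  rw [h, hit, Finset.sum_range_succ', add_comm]
  simp only [iter_succ', iter_zero]

lemma iter_vac_nonneg (x : Site) (t : ℕ) (A : Set Site) : 0 ≤ iter π t (vac x) A :=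
  iter_nonneg (localOn_vac x) (vac_nonneg x) t A

lemma iter_vac_le_one (x : Site) (t : ℕ) (A : Set Site) : iter π t (vac x) A ≤ 1 := by
  linarith [iter_occ_add_vac (π := π) x t A,
    iter_nonneg (π := π) (localOn_occ x) (occ_nonneg x) t A]

lemma hit_nonneg (n : ℕ) (A : Set Site) : 0 ≤ hit π n A :=
  Finset.sum_nonneg fun r _ => iter_vac_nonneg 0 r A

lemma hit_le (n : ℕ) (A : Set Site) : hit π n A ≤ n := by
  refine (Finset.sum_le_sum fun r _ => iter_vac_le_one 0 r A).trans ?_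
  simp

lemma IsPerturbation.hit_anti (hπ : IsPerturbation D p π) (n : ℕ) : Antitone (hit π n) :=
  fun _ _ h => Finset.sum_le_sum fun r _ => hπ.iter_vac_anti 0 r h

/-- Starting from `step D A` instead of `A` hardly shortens the expected hitting time, if the sites
of `step D A` are soon occupied for the dynamics started from `A`. -/
lemma hit_sub_hit_step_le (hπ : IsPerturbation D p π) {A : Set Site} {m : ℕ} {σ : ℝ}
    (hσ : ∀ y ∈ step D A, iter π m (vac y) A ≤ σ) (hσ0 : 0 ≤ σ) (k : ℕ) :
    hit π k A - hit π k (step D A) ≤ m + k * ((box 0 (k * radius N)).card * σ) := by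
  classical
  set W := (box 0 (k * radius N)).filter (· ∈ step D A) with hW
  have hWsub : ∀ y ∈ W, y ∈ box 0 (k * radius N) := fun y hy => (Finset.mem_filter.1 hy).1
  -- truncated hitting time is bounded by `k`.
  have h1 : hit π k A ≤ m + iter π m (hit π k) A := by
    calc hit π k A ≤ hit π (m + k) A := by
          refine Finset.sum_le_sum_of_subset_of_nonneg
            (Finset.range_mono (Nat.le_add_left _ _)) fun r _ _ => iter_vac_nonneg 0 r A
      _ = hit π m A + ∑ r ∈ Finset.range k, iter π (m + r) (vac 0) A := by
          rw [hit, Finset.sum_range_add]; rfl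
      _ = hit π m A + iter π m (hit π k) A := by
          have : iter π m (hit π k) A = ∑ r ∈ Finset.range k, iter π m (iter π r (vac 0)) A :=
            iter_sum (fun r hr => localOn_iter_vac (Finset.mem_range.1 hr).le) m A
          rw [this]
          simp only [iter_add]
      _ ≤ _ := add_le_add_left (hit_le m A) _
  have hlsum : LocalOn 0 (k * radius N) (fun B => ∑ y ∈ W, vac y B) :=
    LocalOn.sum fun y hy => localOn_vac_of_mem (hWsub y hy)
  have h2 : ∀ B, hit π k B ≤ hit π k (step D A) + k * ∑ y ∈ W, vac y B := by
    intro B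
    have hs : 0 ≤ ∑ y ∈ W, vac y B := Finset.sum_nonneg fun y _ => vac_nonneg y B
    by_cases h : ∃ y ∈ W, y ∉ B
    · obtain ⟨y, hy, hyB⟩ := h
      have h3 : vac y B ≤ ∑ y ∈ W, vac y B :=
        Finset.single_le_sum (f := fun y => vac y B) (fun y _ => vac_nonneg y B) hy
      rw [vac_of_notMem hyB] at h3
      nlinarith [hit_le (π := π) k B, hit_nonneg (π := π) k (step D A),
        (Nat.cast_nonneg k : (0 : ℝ) ≤ k)]
    · push Not at h
      have h3 : hit π k B ≤ hit π k (step D A) := by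
        rw [(localOn_hit π k).eq_inter (step D A)]
        exact hπ.hit_anti k fun y hy => h y (Finset.mem_filter.2 ⟨hy.2, hy.1⟩)
      have : 0 ≤ (k : ℝ) * ∑ y ∈ W, vac y B := by positivity
      linarith
  have h3 : iter π m (hit π k) A ≤ hit π k (step D A) + k * ∑ y ∈ W, iter π m (vac y) A := by
    refine (iter_mono (localOn_hit π k) ((localOn_const 0 (k * radius N) _).comp₂
      (hlsum.comp (k * ·)) (· + ·)) h2 m A).trans (le_of_eq ?_)
    rw [iter_add_fun (localOn_const 0 (k * radius N) _) (hlsum.comp (k * ·)), iter_const,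
      iter_const_mul, iter_sum fun y _ => localOn_vac y]
  have h4 : ∑ y ∈ W, iter π m (vac y) A ≤ (box 0 (k * radius N)).card * σ := by
    refine (Finset.sum_le_sum fun y hy => hσ y (Finset.mem_filter.1 hy).2).trans ?_
    rw [Finset.sum_const, nsmul_eq_mul]
    exact mul_le_mul_of_nonneg_right (by exact_mod_cast Finset.card_filter_le _ _) hσ0
  have h5 := mul_le_mul_of_nonneg_left h4 (Nat.cast_nonneg k : (0 : ℝ) ≤ k)
  linarith

/-- The exponential moment `E exp (l * T)` of the hitting time `T` of the origin truncated at `n`,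
for the dynamics started from the given set. -/
def expHit (π : LocalConfig N → ℝ) (l : ℝ) : ℕ → Set Site → ℝ
  | 0 => fun _ => 1
  | n + 1 => fun A => Real.exp (l * vac 0 A) * transfer π (expHit π l n) A

lemma localOn_expHit (π : LocalConfig N → ℝ) (l : ℝ) (n : ℕ) :
    LocalOn 0 (n * radius N) (expHit π l n) := by
  induction n with
  | zero => exact localOn_const _ _ _
  | succ n ih =>
    refine LocalOn.comp₂ (((localOn_vac 0).mono (Nat.zero_le _)).comp fun v => Real.exp (l * v))
      (g := transfer π (expHit π l n)) ?_ (· * ·)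
    rw [Nat.succ_mul]
    exact ih.transfer_local π

lemma expHit_nonneg (l : ℝ) (n : ℕ) (A : Set Site) : 0 ≤ expHit π l n A := by
  induction n generalizing A with
  | zero => exact zero_le_one
  | succ n ih => exact mul_nonneg (Real.exp_nonneg _) (integral_nonneg fun U => ih _)

lemma IsPerturbation.expHit_of_mem (hπ : IsPerturbation D p π) (l : ℝ) (n : ℕ) {A : Set Site}
    (hA : (0 : Site) ∈ A) : expHit π l n A = 1 := by
  induction n generalizing A with
  | zero => rfl
  | succ n ih =>
    have : ∀ U, expHit π l n (ustep π U A) = 1 := fun U => ih (hπ.subset_ustep U A hA)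
    simp [expHit, vac_of_mem hA, transfer, this]

lemma one_le_expHit {l : ℝ} (hl : 0 ≤ l) (n : ℕ) (A : Set Site) : 1 ≤ expHit π l n A := by
  induction n generalizing A with
  | zero => exact le_rfl
  | succ n ih =>
    refine one_le_mul_of_one_le_of_one_le (Real.one_le_exp (mul_nonneg hl (vac_nonneg _ _))) ?_
    rw [← transfer_const (π := π) 1 A]
    exact transfer_mono (localOn_const 0 0 1) (localOn_expHit π l n) fun U => ih _

lemma iter_vac_eq_zero (hπ : IsPerturbation D p π) {x : Site} {A : Set Site} (hx : x ∈ A) (t : ℕ) :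
    iter π t (vac x) A = 0 := by
  refine le_antisymm ?_ (iter_vac_nonneg x t A)
  have := iter_le_iter (π := π) (𝒞 := fun B => x ∈ B)
    (fun A hA U => hπ.subset_ustep U A hA) (localOn_vac x) (localOn_const 0 0 0)
    (fun A hA => (vac_of_mem hA).le) t hx
  rwa [iter_const] at this

lemma exp_mul_iter_vac_le (hπ : IsPerturbation D p π) {l : ℝ} (hl : 0 ≤ l) {t n : ℕ} (ht : t < n)
    (A : Set Site) : Real.exp (l * (t + 1)) * iter π t (vac 0) A ≤ expHit π l n A := by
  induction t generalizing n A with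
  | zero =>
    by_cases h0 : (0 : Site) ∈ A
    · simp [vac_of_mem h0, expHit_nonneg]
    · obtain ⟨n, rfl⟩ := Nat.exists_eq_add_of_lt ht
      simp only [zero_add, iter_zero, expHit, vac_of_notMem h0, Nat.cast_zero, mul_one]
      refine le_mul_of_one_le_right (Real.exp_nonneg _) ?_
      rw [← transfer_const (π := π) 1 A]
      exact transfer_mono (localOn_const 0 0 1) (localOn_expHit π l n) fun U => one_le_expHit hl _ _
  | succ t ih =>
    by_cases h0 : (0 : Site) ∈ A
    · rw [iter_vac_eq_zero hπ h0, mul_zero]; exact expHit_nonneg _ _ _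
    · obtain ⟨n, rfl⟩ : ∃ n', n = n' + 1 := ⟨n - 1, by omega⟩
      simp only [expHit, vac_of_notMem h0, mul_one]
      have e : Real.exp (l * ((t + 1 : ℕ) + 1)) = Real.exp l * Real.exp (l * (t + 1)) := by
        rw [← Real.exp_add]; congr 1; push_cast; ring
      rw [e, mul_assoc, iter_succ', ← transfer_const_mul]
      refine mul_le_mul_of_nonneg_left ?_ (Real.exp_nonneg _)
      exact transfer_mono (((localOn_vac 0).iter_local π t).comp _) (localOn_expHit π l n)
        fun U => ih (by omega) _

lemma exp_mul_iter_occ_le (hπ : IsPerturbation D p π) {l : ℝ} (hl : 0 ≤ l) {t n : ℕ} (ht : t < n)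
    (A : Set Site) : Real.exp (-(l * t)) * iter π t (occ 0) A ≤ expHit π (-l) n A := by
  induction t generalizing n A with
  | zero =>
    by_cases h0 : (0 : Site) ∈ A
    · simp [occ_of_mem h0, hπ.expHit_of_mem _ _ h0]
    · simp [occ_of_notMem h0, expHit_nonneg]
  | succ t ih =>
    obtain ⟨n, rfl⟩ : ∃ n', n = n' + 1 := ⟨n - 1, by omega⟩
    simp only [expHit]
    have e : Real.exp (-(l * (t + 1 : ℕ))) = Real.exp (-l) * Real.exp (-(l * t)) := by
      rw [← Real.exp_add]; congr 1; push_cast; ring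
    rw [e, mul_assoc, iter_succ', ← transfer_const_mul]
    refine mul_le_mul (Real.exp_le_exp.2 ?_) ?_ ?_ (Real.exp_nonneg _)
    · nlinarith [occ_add_vac 0 A, occ_nonneg 0 A]
    · exact transfer_mono (((localOn_occ 0).iter_local π t).comp _) (localOn_expHit π (-l) n)
        fun U => ih (by omega) _
    · exact integral_nonneg fun U => mul_nonneg (Real.exp_nonneg _)
        (iter_nonneg (localOn_occ 0) (occ_nonneg 0) t _)

/-- A Hoeffding bound for one step: the random step from `A` leads to a set between `A` and
`step D A`, so an antitone functional varies over its outcomes by at most what it varies between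
these two. The bound follows from `exp y ≤ 1 + y + y ^ 2` for `|y| ≤ 1`. -/
lemma IsPerturbation.transfer_exp_le (hπ : IsPerturbation D p π) {x : Site} {r : ℕ}
    {h : Set Site → ℝ} (hh : LocalOn x r h) (hm : Antitone h) {A : Set Site} {d l : ℝ}
    (hd : h A - h (step D A) ≤ d) (hl : |l| * d ≤ 1) :
    transfer π (fun B => Real.exp (l * h B)) A ≤ Real.exp (l * transfer π h A + l ^ 2 * d ^ 2) := by
  set e := transfer π h A with he
  have hd0 : 0 ≤ d := by linarith [hm (subset_step D A)]
  have hle : ∀ U, h (ustep π U A) ≤ h A := fun U => hm (hπ.subset_ustep U A)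
  have hge : ∀ U, h (step D A) ≤ h (ustep π U A) := fun U => hm (hπ.ustep_subset_step U A)
  have e1 : e ≤ h A := by
    rw [← transfer_const (π := π) (h A) A]
    exact transfer_mono hh (localOn_const 0 0 _) hle
  have e2 : h (step D A) ≤ e := by
    rw [← transfer_const (π := π) (h (step D A)) A]
    exact transfer_mono (localOn_const 0 0 _) hh hge
  have key : ∀ U, Real.exp (l * h (ustep π U A)) ≤
      Real.exp (l * e) * (1 + l ^ 2 * d ^ 2 + (l * h (ustep π U A) - l * e)) := by
    intro U
    set Y := h (ustep π U A) with hY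
    have habs : |Y - e| ≤ d := by
      rw [abs_le]; constructor <;> linarith [hle U, hge U]
    have h1 : |l * (Y - e)| ≤ 1 := by
      rw [abs_mul]
      exact (mul_le_mul_of_nonneg_left habs (abs_nonneg l)).trans hl
    have h2 := (abs_le.1 (Real.abs_exp_sub_one_sub_id_le h1)).2
    have h3 : (Y - e) ^ 2 ≤ d ^ 2 := sq_le_sq' (abs_le.1 habs).1 (abs_le.1 habs).2
    have h4 : (l * (Y - e)) ^ 2 ≤ l ^ 2 * d ^ 2 := by
      rw [mul_pow]; exact mul_le_mul_of_nonneg_left h3 (sq_nonneg l)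
    have h5 : Real.exp (l * Y) = Real.exp (l * e) * Real.exp (l * (Y - e)) := by
      rw [← Real.exp_add]; congr 1; ring
    rw [h5]
    refine mul_le_mul_of_nonneg_left ?_ (Real.exp_nonneg _)
    linarith
  have h1 : transfer π (fun B => Real.exp (l * h B)) A ≤ transfer π
      (fun B => Real.exp (l * e) * (1 + l ^ 2 * d ^ 2 + (l * h B - l * e))) A :=
    transfer_mono (hh.comp fun v => Real.exp (l * v))
      (hh.comp fun v => Real.exp (l * e) * (1 + l ^ 2 * d ^ 2 + (l * v - l * e))) key
  have h2 : transfer π (fun B => Real.exp (l * e) * (1 + l ^ 2 * d ^ 2 + (l * h B - l * e))) A =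
      Real.exp (l * e) * (1 + l ^ 2 * d ^ 2) := by
    have e3 : (fun B => Real.exp (l * e) * (1 + l ^ 2 * d ^ 2 + (l * h B - l * e))) = fun B =>
        Real.exp (l * e) * (1 + l ^ 2 * d ^ 2 - l * e) + Real.exp (l * e) * l * h B := by
      funext B; ring
    rw [e3, transfer_add (localOn_const x r _) (hh.comp (Real.exp (l * e) * l * ·)), transfer_const,
      transfer_const_mul, ← he]
    ring
  rw [h2] at h1
  refine h1.trans ?_
  rw [Real.exp_add]
  refine mul_le_mul_of_nonneg_left ?_ (Real.exp_nonneg _)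
  linarith [Real.add_one_le_exp (l ^ 2 * d ^ 2)]

/-- An Azuma–Hoeffding bound for the truncated hitting time, under a bound on the effect of a
deterministic step that need only hold on a class of sets closed under the random step. -/
lemma expHit_le (hπ : IsPerturbation D p π) {𝒞 : Set Site → Prop}
    (hcl : ∀ A, 𝒞 A → ∀ U, 𝒞 (ustep π U A)) {n : ℕ} {d l : ℝ}
    (hd : ∀ k < n, ∀ A, 𝒞 A → hit π k A - hit π k (step D A) ≤ d) (hl : |l| * d ≤ 1)
    {k : ℕ} (hk : k ≤ n) {A : Set Site} (hA : 𝒞 A) :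
    expHit π l k A ≤ Real.exp (l * hit π k A + k * (l ^ 2 * d ^ 2)) := by
  induction k generalizing A with
  | zero => simp [expHit, hit]
  | succ k ih =>
    have h1 : transfer π (expHit π l k) A ≤
        transfer π (fun B => Real.exp (k * (l ^ 2 * d ^ 2)) * Real.exp (l * hit π k B)) A := by
      refine transfer_mono (localOn_expHit π l k) (((localOn_hit π k).comp
        fun v => Real.exp (k * (l ^ 2 * d ^ 2)) * Real.exp (l * v))) fun U => ?_
      refine (ih (Nat.le_of_succ_le hk) (hcl A hA U)).trans (le_of_eq ?_)
      rw [← Real.exp_add]; congr 1; ring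
    rw [transfer_const_mul] at h1
    have h2 := hπ.transfer_exp_le (localOn_hit π k) (hπ.hit_anti k) (hd k hk A hA) hl
    rw [expHit, hit_succ]
    calc _ ≤ Real.exp (l * vac 0 A) * (Real.exp (k * (l ^ 2 * d ^ 2)) *
          Real.exp (l * transfer π (hit π k) A + l ^ 2 * d ^ 2)) := by
          refine mul_le_mul_of_nonneg_left (h1.trans ?_) (Real.exp_nonneg _)
          exact mul_le_mul_of_nonneg_left h2 (Real.exp_nonneg _)
      _ = _ := by
          rw [← Real.exp_add, ← Real.exp_add]; congr 1; push_cast; ring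

set_option maxHeartbeats 800000 in
/-- For the dynamics started from a half-space, the truncated hitting time of the origin
concentrates around its mean at a scale `j ^ 4`, with errors uniform in the perturbation and in the
half-space. -/
lemma exists_concentration (hD : IsCA N D) (hsuper : Supercritical D) (hreg : LocallyRegular D)
    (hp0 : 0 < p) (hp1 : p ≤ 1) : ∃ c : ℝ, 0 ≤ c ∧ ∃ j₀ : ℕ, ∀ j ≥ j₀, ∀ π : LocalConfig N → ℝ,
      IsPerturbation D p π → ∀ u : Plane, ‖u‖ = 1 → ∀ (s : ℝ) (t : ℕ), t < 2 * j ^ 4 →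
        vacProb π u t s ≤ Real.exp (c + (hit π (2 * j ^ 4) (Hs u (-s)) - t) / j ^ 3) ∧
        occProb π u t s ≤ Real.exp (c + (t - hit π (2 * j ^ 4) (Hs u (-s))) / j ^ 3) := by
  obtain ⟨τ, hτ⟩ := exists_fill_time hD hsuper hreg
  set R := radius N with hR
  set q := p ^ (τ * (box 0 (τ * radius N)).card) with hq
  have hq0 : 0 < q := pow_pos hp0 _
  have hq1 : q ≤ 1 := pow_le_one₀ hp0.le hp1
  have hlim : Filter.Tendsto (fun j : ℕ => 2 * (4 * R + 1 : ℝ) ^ 2 * ((j : ℝ) ^ 12 * (1 - q) ^ j))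
      Filter.atTop (nhds 0) := by
    have := (tendsto_pow_const_mul_const_pow_of_abs_lt_one 12 (r := 1 - q)
      (by rw [abs_of_nonneg] <;> linarith)).const_mul (2 * (4 * R + 1 : ℝ) ^ 2)
    simpa using this
  obtain ⟨j₁, hj₁⟩ := Filter.eventually_atTop.1 (hlim.eventually (ge_mem_nhds one_pos))
  -- Within the time `j * τ` all of `step D A` is covered, up to an error that contributes at most
  -- `1` to the expected hitting time.
  set c : ℝ := τ + 1 with hc
  have hc0 : 0 ≤ c := by positivity
  refine ⟨2 * c ^ 2, by positivity, max j₁ (τ + 1), fun j hj π hπ u hu s t ht => ?_⟩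
  have hj1 : j₁ ≤ j := (le_max_left _ _).trans hj
  have hjτ : τ + 1 ≤ j := (le_max_right _ _).trans hj
  have hjc : c ≤ j := by rw [hc]; exact_mod_cast hjτ
  have hjpos : (1 : ℝ) ≤ j := by exact_mod_cast (by omega : 1 ≤ j)
  have hj0 : (0 : ℝ) < j := by linarith
  set n := 2 * j ^ 4 with hn
  set d : ℝ := c * j with hd
  have hdk : ∀ k < n, ∀ A, Reach D u (-s) A → hit π k A - hit π k (step D A) ≤ d := by
    intro k hk A hA
    have h1 := hit_sub_hit_step_le hπ (A := A) (m := j * τ) (σ := (1 - q) ^ j)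
      (fun y hy => hπ.iter_vac_le_pow hD (hτ u hu _ A hA y hy) j)
      (pow_nonneg (by linarith) j) k
    have hk' : (k : ℝ) ≤ 2 * j ^ 4 := by exact_mod_cast hk.le
    have hj4 : (1 : ℝ) ≤ j ^ 4 := one_le_pow₀ hjpos
    have h2 : (k : ℝ) * ((box 0 (k * radius N)).card * (1 - q) ^ j) ≤ 1 := by
      refine le_trans ?_ (hj₁ j hj1)
      rw [card_box]
      push_cast
      have h3 : 2 * ((k : ℝ) * R) + 1 ≤ (4 * R + 1) * j ^ 4 := by
        have : (k : ℝ) * R ≤ 2 * j ^ 4 * R := mul_le_mul_of_nonneg_right hk' (by positivity)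
        linarith
      calc (k : ℝ) * ((2 * (k * R) + 1) ^ 2 * (1 - q) ^ j)
          ≤ (2 * j ^ 4) * (((4 * R + 1) * j ^ 4) ^ 2 * (1 - q) ^ j) := by
            have : 0 ≤ (1 - q) ^ j := pow_nonneg (by linarith) j
            gcongr
        _ = _ := by ring
    rw [hd, hc]
    push_cast at h1
    linarith
  set l : ℝ := 1 / j ^ 3 with hl
  have hl0 : 0 ≤ l := by positivity
  have hld : l * d ≤ 1 := by
    rw [hl, hd, div_mul_eq_mul_div, one_mul, div_le_one (by positivity)]
    calc c * j ≤ j * j := mul_le_mul_of_nonneg_right hjc hj0.le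
      _ ≤ j * j * j := le_mul_of_one_le_right (by positivity) hjpos
      _ = j ^ 3 := by ring
  -- The parameter `l` is such that the variance term of the Azuma bound does not depend on `j`.
  have hnl : (n : ℝ) * (l ^ 2 * d ^ 2) = 2 * c ^ 2 := by
    rw [hn, hl, hd]; push_cast; field_simp
  have hcl : ∀ A, Reach D u (-s) A → ∀ U, Reach D u (-s) (ustep π U A) :=
    fun A hA U => hA.ustep hπ U
  constructor
  · have h1 : Real.exp (l * (t + 1)) * vacProb π u t s ≤ _ :=
      exp_mul_iter_vac_le hπ hl0 ht (Hs u (-s))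
    have h2 := expHit_le hπ hcl hdk (l := l) (by rwa [abs_of_nonneg hl0]) le_rfl
      (reach_Hs hD u (-s))
    rw [hnl] at h2
    have h3 := (le_div_iff₀' (Real.exp_pos _)).2 (h1.trans h2)
    rw [← Real.exp_sub] at h3
    refine h3.trans (Real.exp_le_exp.2 ?_)
    rw [div_eq_mul_one_div _ ((j : ℝ) ^ 3), ← hl]
    linarith
  · have h1 : Real.exp (-(l * t)) * occProb π u t s ≤ _ :=
      exp_mul_iter_occ_le hπ hl0 ht (Hs u (-s))
    have h2 := expHit_le hπ hcl hdk (l := -l) (by rwa [abs_neg, abs_of_nonneg hl0]) le_rfl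
      (reach_Hs hD u (-s))
    rw [neg_sq, hnl] at h2
    have h3 := (le_div_iff₀' (Real.exp_pos _)).2 (h1.trans h2)
    rw [← Real.exp_sub] at h3
    refine h3.trans (Real.exp_le_exp.2 ?_)
    rw [div_eq_mul_one_div _ ((j : ℝ) ^ 3), ← hl]
    linarith

/-! ### From concentration in time to a narrow transition in space -/

lemma hit_Hs (π : LocalConfig N → ℝ) (u : Plane) (n : ℕ) (s : ℝ) :
    hit π n (Hs u (-s)) = ∑ r ∈ Finset.range n, vacProb π u r s := rfl

lemma vacProb_eq_one (hD : IsCA N D) (hπ : IsPerturbation D p π) (hu : ‖u‖ = 1) {t : ℕ} {s : ℝ}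
    (hs : t * (2 * radius N) < s) : vacProb π u t s = 1 := by
  linarith [occProb_add_vacProb (π := π) (u := u) t s, occProb_eq_zero hπ (hD.step_Hs_subset hu) hs]

lemma le_vacProb_add (hD : IsCA N D) (hπ : IsPerturbation D p π) (hu : ‖u‖ = 1) (t i : ℕ) (s : ℝ) :
    vacProb π u t s ≤ vacProb π u (i + t) (s + i * (2 * radius N)) := by
  have h := occProb_add_le hπ (hD.step_Hs_subset hu) t i (s + i * (2 * radius N))
  rw [add_sub_cancel_right, add_comm t i] at h
  linarith [occProb_add_vacProb (π := π) (u := u) t s,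
    occProb_add_vacProb (π := π) (u := u) (i + t) (s + i * (2 * radius N))]

/-- Raising the height by what the deterministic dynamics can gain in `i` steps lengthens the
truncated hitting time by nearly `i`. -/
lemma hit_add_le (hD : IsCA N D) (hπ : IsPerturbation D p π) (hu : ‖u‖ = 1) {n i : ℕ} (hi : i ≤ n)
    {s : ℝ} (hs : 0 ≤ s) : hit π n (Hs u (-s)) + i - i * vacProb π u (n - i) s ≤
      hit π n (Hs u (-(s + i * (2 * radius N)))) := by
  obtain ⟨m, rfl⟩ := Nat.exists_eq_add_of_le hi
  have hR : (1 : ℝ) ≤ radius N := by exact_mod_cast one_le_radius N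
  have h1 : ∑ r ∈ Finset.range i, vacProb π u r (s + i * (2 * radius N)) = i := by
    rw [Finset.sum_congr rfl (g := fun _ => (1 : ℝ))]
    · simp
    · intro r hr
      have : (r : ℝ) < i := by exact_mod_cast Finset.mem_range.1 hr
      exact vacProb_eq_one hD hπ hu (by nlinarith)
  have h2 : ∑ r ∈ Finset.range m, vacProb π u r s ≤
      ∑ r ∈ Finset.range m, vacProb π u (i + r) (s + i * (2 * radius N)) :=
    Finset.sum_le_sum fun r _ => le_vacProb_add hD hπ hu r i s
  have h3 : ∑ r ∈ Finset.range i, vacProb π u (m + r) s ≤ i * vacProb π u m s := by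
    refine (Finset.sum_le_sum fun r _ =>
      hπ.vacProb_time_anti u s (Nat.le_add_right m r)).trans ?_
    simp
  have e1 : ∑ r ∈ Finset.range (i + m), vacProb π u r s = ∑ r ∈ Finset.range m, vacProb π u r s +
      ∑ r ∈ Finset.range i, vacProb π u (m + r) s := by
    rw [add_comm i m, Finset.sum_range_add]
  have e2 := Finset.sum_range_add (fun r => vacProb π u r (s + i * (2 * radius N))) i m
  rw [hit_Hs, hit_Hs, e1, e2, h1, Nat.add_sub_cancel_left]
  linarith

/-- Concentration of the hitting time within `Δ` gives two heights, not far apart, of which after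
`K` steps the lower is very probably occupied and the upper very probably vacant. -/
lemma exists_window (hD : IsCA N D) (hπ : IsPerturbation D p π) (hu : ‖u‖ = 1) {K i : ℕ} {Δ κ : ℝ}
    (hΔ : 0 < Δ) (hi0 : 1 ≤ i) (hi : 4 * Δ ≤ i) (hiK : i + 2 * Δ ≤ K) (hκ : κ ≤ 1 / 2)
    (hvac : ∀ s, ∀ t < 2 * K, hit π (2 * K) (Hs u (-s)) + Δ ≤ t → vacProb π u t s ≤ κ)
    (hocc : ∀ s, ∀ t < 2 * K, t ≤ hit π (2 * K) (Hs u (-s)) - Δ → occProb π u t s ≤ κ) :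
    ∃ a b : ℝ, 0 ≤ a ∧ a ≤ 2 * (K * radius N : ℕ) ∧ a ≤ b ∧ b - a ≤ 4 * radius N * i ∧
      vacProb π u K a ≤ κ ∧ occProb π u K b ≤ κ := by
  classical
  have hR : (1 : ℝ) ≤ radius N := by exact_mod_cast one_le_radius N
  have hi1 : (1 : ℝ) ≤ i := by exact_mod_cast hi0
  have hKpos : 0 < K := by
    have : (0 : ℝ) < K := by linarith
    exact_mod_cast this
  set H : ℝ → ℝ := fun s => hit π (2 * K) (Hs u (-s)) with hH
  have hHmono : Monotone H := fun s s' h => hπ.hit_anti _ (Hs_mono u (neg_le_neg h))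
  have hH0 : H 0 = 0 := by
    simp only [hH, hit_Hs]
    exact Finset.sum_eq_zero fun r _ => vacProb_of_nonpos hπ r le_rfl
  set st : ℕ → ℝ := fun k => k * (i * (2 * radius N)) with hst
  have hst0 : ∀ k, 0 ≤ st k := fun k => by positivity
  have hstsucc : ∀ k, st (k + 1) = st k + i * (2 * radius N) := fun k => by
    simp only [hst]; push_cast; ring
  have hex : ∃ k, K - Δ < H (st k) := by
    refine ⟨2 * K + 1, ?_⟩
    have h1 : H (st (2 * K + 1)) = 2 * K := by
      simp only [hH, hit_Hs]
      rw [Finset.sum_congr rfl (g := fun _ => (1 : ℝ))]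
      · simp
      · intro r hr
        have hr' : (r : ℝ) < 2 * K := by exact_mod_cast Finset.mem_range.1 hr
        refine vacProb_eq_one hD hπ hu ?_
        simp only [hst]
        push_cast
        have h2 : (radius N : ℝ) * 1 ≤ radius N * i := by gcongr
        nlinarith
    rw [h1]
    have : (0 : ℝ) ≤ K := by positivity
    linarith
  -- The first height of an arithmetic progression at which the mean hitting time exceeds `K - Δ`;
  -- the height before it serves as `a`, the height after it as `b`.
  have hk := Nat.find_spec hex
  set k := Nat.find hex with hkdef
  have hk1 : k ≠ 0 := by
    intro h0
    rw [h0] at hk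
    simp only [hst, Nat.cast_zero, zero_mul, hH0] at hk
    linarith
  obtain ⟨m, hm⟩ := Nat.exists_eq_succ_of_ne_zero hk1
  have hma : H (st m) ≤ K - Δ := not_lt.1 (Nat.find_min hex (by omega))
  have hvK : vacProb π u K (st m) ≤ κ := hvac _ K (by omega) (by simp only [hH] at hma; linarith)
  refine ⟨st m, st (k + 1), hst0 m, ?_, ?_, ?_, hvK, ?_⟩
  · by_contra! hlt
    have h1 : (K : ℝ) ≤ H (st m) := by
      calc (K : ℝ) = ∑ r ∈ Finset.range K, vacProb π u r (st m) := by
            rw [Finset.sum_congr rfl (g := fun _ => (1 : ℝ))]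
            · simp
            · intro r hr
              have hr' : (r : ℝ) ≤ K := by exact_mod_cast (Finset.mem_range.1 hr).le
              refine vacProb_eq_one hD hπ hu ?_
              push_cast at hlt
              nlinarith
        _ ≤ H (st m) := by
            simp only [hH, hit_Hs]
            exact Finset.sum_le_sum_of_subset_of_nonneg (Finset.range_mono (by omega))
              fun r _ _ => vacProb_nonneg r _
    linarith
  · rw [hm, hstsucc, hstsucc]
    have : (0 : ℝ) ≤ i * (2 * radius N) := by positivity
    linarith
  · rw [hm, hstsucc, hstsucc]
    linarith
  · refine hocc _ K (by omega) ?_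
    have hgoal : K + Δ ≤ H (st (k + 1)) := by
      by_cases hcase : K + Δ ≤ H (st k)
      · refine hcase.trans (hHmono ?_)
        rw [hstsucc]
        have : (0 : ℝ) ≤ i * (2 * radius N) := by positivity
        linarith
      · have hiK' : i ≤ 2 * K := by
          have : (i : ℝ) ≤ (2 * K : ℕ) := by push_cast; linarith
          exact_mod_cast this
        have h1 := hit_add_le hD hπ hu hiK' (hst0 k)
        have h2 : vacProb π u (2 * K - i) (st k) ≤ κ := by
          refine hvac _ _ (by omega) ?_
          rw [Nat.cast_sub hiK']
          push_cast
          simp only [hH] at hcase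
          linarith
        rw [← hstsucc] at h1
        simp only [hH] at hk hcase ⊢
        nlinarith
    simp only [hH] at hgoal
    linarith

set_option maxHeartbeats 400000 in
/-- At suitable scales, uniformly over the perturbations and the directions, the probabilities of
overshooting a speed `β` and of lagging behind a speed `α` that is almost `β` decay
exponentially. -/
lemma exists_scale (hD : IsCA N D) (hsuper : Supercritical D) (hreg : LocallyRegular D)
    (hp0 : 0 < p) (hp1 : p ≤ 1) {ε : ℝ} (hε : 0 < ε) : ∃ K : ℕ, 1 ≤ K ∧ ∃ θ : ℝ, 0 < θ ∧
      ∀ π : LocalConfig N → ℝ, IsPerturbation D p π → ∀ u : Plane, ‖u‖ = 1 →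
        ∃ α β : ℝ, -ε ≤ α ∧ β ≤ α + ε ∧
          (∀ (n : ℕ) (s : ℝ), occProb π u (n * K) s ≤ Real.exp (-(θ * (s - n * K * β)))) ∧
          (∀ (n : ℕ) (s : ℝ), vacProb π u (n * K) s ≤ Real.exp (θ * (s - n * K * α))) := by
  obtain ⟨c, hc0, j₀, hconc⟩ := exists_concentration hD hsuper hreg hp0 hp1
  obtain ⟨R, hRdef⟩ : ∃ x : ℝ, x = (radius N : ℝ) := ⟨_, rfl⟩
  have hR : (1 : ℝ) ≤ R := by rw [hRdef]; exact_mod_cast one_le_radius N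
  -- The hitting time is to be known up to `δ * K`, which makes the window shorter than `ε * K / 2`.
  obtain ⟨δ, hδ0, hδ1, hδ2⟩ : ∃ δ : ℝ, 0 < δ ∧ 16 * R * δ ≤ ε / 4 ∧ δ ≤ 1 / 12 := by
    refine ⟨min (ε / (64 * R)) (1 / 12), by positivity, ?_, min_le_right _ _⟩
    have h1 : min (ε / (64 * R)) (1 / 12) ≤ ε / (64 * R) := min_le_left _ _
    rw [le_div_iff₀ (by positivity)] at h1
    linarith
  have hlim : Filter.Tendsto (fun j : ℕ => 2 * (2 * R + 1) ^ 2 * Real.exp (ε * c / (8 * R)) *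
      ((j : ℝ) ^ 8 * Real.exp (-(ε * δ / (8 * R))) ^ j)) Filter.atTop (nhds 0) := by
    have hlt : |Real.exp (-(ε * δ / (8 * R)))| < 1 := by
      rw [abs_of_pos (Real.exp_pos _), Real.exp_lt_one_iff]
      have : 0 < ε * δ / (8 * R) := by positivity
      linarith
    simpa using (tendsto_pow_const_mul_const_pow_of_abs_lt_one 8 hlt).const_mul
      (2 * (2 * R + 1) ^ 2 * Real.exp (ε * c / (8 * R)))
  obtain ⟨j, hj1, hj2, hj3, hj4, hj5⟩ : ∃ j : ℕ, j₀ ≤ j ∧ 2 ≤ j ∧ (c + 1) / δ ≤ j ∧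
      16 * R / ε ≤ j ∧ 2 * (2 * R + 1) ^ 2 * Real.exp (ε * c / (8 * R)) *
      ((j : ℝ) ^ 8 * Real.exp (-(ε * δ / (8 * R))) ^ j) ≤ 1 := by
    have h1 := (Filter.eventually_ge_atTop j₀).and ((Filter.eventually_ge_atTop 2).and
      ((tendsto_natCast_atTop_atTop.eventually_ge_atTop ((c + 1) / δ)).and
      ((tendsto_natCast_atTop_atTop.eventually_ge_atTop (16 * R / ε)).and
      (hlim.eventually (ge_mem_nhds one_pos)))))
    exact h1.exists
  rw [div_le_iff₀ hδ0] at hj3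
  rw [div_le_iff₀ hε] at hj4
  have hj2' : (2 : ℝ) ≤ j := by exact_mod_cast hj2
  have hj0 : (0 : ℝ) < j := by linarith
  obtain ⟨K, hK⟩ : ∃ x : ℕ, x = j ^ 4 := ⟨_, rfl⟩
  have hKr : (K : ℝ) = (j : ℝ) ^ 4 := by rw [hK]; push_cast; ring
  have hjK : (j : ℝ) * 8 ≤ K := by
    rw [hKr]
    have : (2 : ℝ) ^ 3 ≤ j ^ 3 := by gcongr
    calc (j : ℝ) * 8 ≤ j * j ^ 3 := by gcongr; linarith
      _ = j ^ 4 := by ring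
  have hK0 : (0 : ℝ) < K := by linarith
  have hK1 : 1 ≤ K := by exact_mod_cast hK0
  obtain ⟨θ, hθ⟩ : ∃ x : ℝ, x = (δ * j - c) / (2 * R * K) := ⟨_, rfl⟩
  have hθ0 : 0 < θ := by
    rw [hθ]
    exact div_pos (by linarith) (by positivity)
  obtain ⟨κ, hκ⟩ : ∃ x : ℝ, x = Real.exp (c - δ * j) := ⟨_, rfl⟩
  -- The rate `θ` is such that `κ` compensates for the largest height `2 * R * K` gained in a block.
  have hκθ : κ = Real.exp (-(θ * (2 * R * K))) := by
    rw [hκ, hθ, div_mul_cancel₀ _ (by positivity)]; congr 1; ring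
  have hκ2 : κ ≤ 1 / 2 := by
    have h1 : κ ≤ Real.exp (-1) := hκ ▸ Real.exp_le_exp.2 (by linarith)
    have h2 := Real.exp_neg_one_lt_half
    linarith
  obtain ⟨X, hX⟩ : ∃ x : ℝ, x = ((box 0 (K * radius N)).card : ℝ) := ⟨_, rfl⟩
  have hXeq : X = (2 * (K * R) + 1) ^ 2 := by rw [hX, card_box, hRdef]; push_cast; ring
  have hX1 : 1 ≤ X := by
    have : 0 ≤ K * R := by positivity
    rw [hXeq]; exact one_le_pow₀ (by linarith)
  -- Allowing for an error `ε * K / 4` in height outweighs the number of sites of the box.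
  have hXexp : 2 * X ≤ Real.exp (θ * (ε * K / 4)) := by
    have e1 : θ * (ε * K / 4) = j * (ε * δ / (8 * R)) - ε * c / (8 * R) := by
      rw [hθ]; field_simp; ring
    have e2 : Real.exp (-(ε * δ / (8 * R))) ^ j * Real.exp (j * (ε * δ / (8 * R))) = 1 := by
      rw [← Real.exp_nat_mul, ← Real.exp_add]; simp
    have h1 : X ≤ (2 * R + 1) ^ 2 * j ^ 8 := by
      have : 2 * (K * R) + 1 ≤ (2 * R + 1) * j ^ 4 := by
        have hK1' : (1 : ℝ) ≤ K := by exact_mod_cast hK1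
        rw [← hKr]; linarith
      rw [hXeq, show (2 * R + 1) ^ 2 * (j : ℝ) ^ 8 = ((2 * R + 1) * j ^ 4) ^ 2 by ring]
      gcongr
    rw [e1, Real.exp_sub, le_div_iff₀ (Real.exp_pos _)]
    calc 2 * X * Real.exp (ε * c / (8 * R))
        ≤ 2 * ((2 * R + 1) ^ 2 * j ^ 8) * Real.exp (ε * c / (8 * R)) := by gcongr
      _ = (2 * (2 * R + 1) ^ 2 * Real.exp (ε * c / (8 * R)) *
          ((j : ℝ) ^ 8 * Real.exp (-(ε * δ / (8 * R))) ^ j)) *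
            Real.exp (j * (ε * δ / (8 * R))) := by
          rw [mul_assoc (2 * (2 * R + 1) ^ 2 * Real.exp (ε * c / (8 * R))), mul_assoc ((j : ℝ) ^ 8),
            e2]; ring
      _ ≤ 1 * Real.exp (j * (ε * δ / (8 * R))) := by gcongr
      _ = _ := one_mul _
  replace hconc := hconc j hj1
  rw [← hK] at hconc
  refine ⟨K, hK1, θ, hθ0, fun π hπ u hu => ?_⟩
  obtain ⟨i, hi1, hi2⟩ : ∃ i : ℕ, 4 * (δ * K) ≤ i ∧ (i : ℝ) < 4 * (δ * K) + 1 :=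
    ⟨_, Nat.le_ceil _, Nat.ceil_lt_add_one (by positivity)⟩
  have hi0 : 1 ≤ i := by
    have : (0 : ℝ) < i := lt_of_lt_of_le (by positivity) hi1
    exact_mod_cast this
  have hδK : δ * K ≤ K / 12 := by
    have := mul_le_mul_of_nonneg_right hδ2 hK0.le
    linarith
  have hjdiv : ∀ x : ℝ, x ≤ -(δ * K) → c + x / j ^ 3 ≤ c - δ * j := by
    intro x hx
    have : x / j ^ 3 ≤ -(δ * j) := by
      rw [div_le_iff₀ (by positivity)]
      rw [hKr] at hx
      linarith
    linarith
  obtain ⟨a, b, ha0, haK, hab, hba, hva, hob⟩ := exists_window hD hπ hu (K := K) (i := i)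
    (Δ := δ * K) (κ := κ) (by positivity) hi0 hi1 (by linarith) hκ2
    (fun s t ht h => ((hconc π hπ u hu s t ht).1).trans
      ((Real.exp_le_exp.2 (hjdiv _ (by linarith))).trans hκ.ge))
    (fun s t ht h => ((hconc π hπ u hu s t ht).2).trans
      ((Real.exp_le_exp.2 (hjdiv _ (by linarith))).trans hκ.ge))
  rw [← hRdef] at hba
  have haK' : a ≤ 2 * R * K := by
    push_cast at haK; rw [hRdef]; linarith
  have hb0 : 0 ≤ b := ha0.trans hab
  have hba' : b - a ≤ ε * K / 2 := by
    have h1 : 4 * R * (i : ℝ) ≤ 4 * R * (4 * (δ * K) + 1) := by gcongr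
    have h2 : 16 * R * δ * K ≤ ε / 4 * K := by gcongr
    have h3 : 4 * R ≤ ε / 4 * K := by
      have := mul_le_mul_of_nonneg_left hjK hε.le
      linarith
    linarith
  have e3 : θ * (2 * (K * radius N : ℕ)) = θ * (2 * R * K) := by
    rw [hRdef]; push_cast; ring
  have hκ0 : 0 ≤ κ := hκ ▸ Real.exp_nonneg _
  refine ⟨(a - ε * K / 4) / K, (b + ε * K / 4) / K, ?_, ?_, ?_, ?_⟩
  · have := mul_pos hε hK0
    rw [le_div_iff₀ hK0]; linarith
  · rw [div_le_iff₀ hK0, add_mul, div_mul_cancel₀ _ hK0.ne']; linarith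
  · intro n s
    have h := occProb_mul_le_exp hD hπ hu (K := K) (b := b) (b' := b + ε * K / 4) (κ := κ) (θ := θ)
      hκ0 hθ0.le hob ?_ n s
    · rwa [mul_assoc, mul_div_cancel₀ _ hK0.ne']
    · rw [← hX, e3, hκθ, ← Real.exp_add, neg_add_cancel, Real.exp_zero, mul_add θ, Real.exp_add]
      have h1 : 1 ≤ Real.exp (θ * b) := Real.one_le_exp (by positivity)
      calc X * (Real.exp (θ * b) + 1) ≤ X * (Real.exp (θ * b) + Real.exp (θ * b)) := by gcongr
        _ = Real.exp (θ * b) * (2 * X) := by ring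
        _ ≤ _ := by gcongr
  · intro n s
    have h := vacProb_mul_le_exp hπ (u := u) (K := K) (a := a) (a' := a - ε * K / 4) (κ := κ)
      (θ := θ) hκ0 hθ0.le hva ?_ n s
    · rwa [mul_assoc, mul_div_cancel₀ _ hK0.ne']
    · have h1 : κ ≤ X * Real.exp (-(θ * a)) := by
        rw [hκθ]
        have h2 : Real.exp (-(θ * (2 * R * K))) ≤ Real.exp (-(θ * a)) := by
          apply Real.exp_le_exp.2
          have := mul_le_mul_of_nonneg_left haK' hθ0.le
          linarith
        exact h2.trans (le_mul_of_one_le_left (Real.exp_nonneg _) hX1)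
      have e4 : Real.exp (-(θ * (a - ε * K / 4))) =
          Real.exp (-(θ * a)) * Real.exp (θ * (ε * K / 4)) := by
        rw [← Real.exp_add]; congr 1; ring
      rw [e4, ← hX]
      calc X * Real.exp (-(θ * a)) + κ ≤ Real.exp (-(θ * a)) * (2 * X) := by linarith
        _ ≤ _ := by gcongr

/-! ### The speed -/

/-- The speed of the dynamics of `π` in the direction `u`: the supremum of the `v` such that sites
at height `v * t` above the initial half-space are occupied at time `t` with probability tending
to `1`. For perturbations of a locally regular supercritical automaton this set is nonempty and
bounded above, so that the supremum is not a junk value. -/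
def speed (π : LocalConfig N → ℝ) (u : Plane) : ℝ :=
  sSup {v : ℝ | Filter.Tendsto (fun t : ℕ => vacProb π u t (v * t)) Filter.atTop (nhds 0)}

lemma tendsto_vacProb (hπ : IsPerturbation D p π) {K : ℕ} (hK : 1 ≤ K) {θ α v : ℝ} (hθ : 0 < θ)
    (hα : ∀ (n : ℕ) (s : ℝ), vacProb π u (n * K) s ≤ Real.exp (θ * (s - n * K * α)))
    (hv : v < α) :
    Filter.Tendsto (fun t : ℕ => vacProb π u t (v * t)) Filter.atTop (nhds 0) := by
  have hlim : Filter.Tendsto (fun t : ℕ => Real.exp (θ * (K * |α|) - θ * (α - v) * t))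
      Filter.atTop (nhds 0) := by
    refine Real.tendsto_exp_atBot.comp ?_
    have h1 : Filter.Tendsto (fun t : ℕ => θ * (α - v) * (t : ℝ)) Filter.atTop Filter.atTop :=
      tendsto_natCast_atTop_atTop.const_mul_atTop (mul_pos hθ (sub_pos.2 hv))
    exact (Filter.tendsto_atBot_add_const_left _ (θ * (K * |α|))
      (Filter.tendsto_neg_atTop_atBot.comp h1)).congr fun t => (sub_eq_add_neg _ _).symm
  refine squeeze_zero (fun t => vacProb_nonneg _ _) (fun t => ?_) hlim
  have h1 := hπ.vacProb_time_anti u (v * t) (Nat.div_mul_le_self t K)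
  refine (h1.trans (hα _ _)).trans (Real.exp_le_exp.2 ?_)
  have h2 : ((t / K : ℕ) : ℝ) * K ≤ t := by exact_mod_cast Nat.div_mul_le_self t K
  have h3 : (t : ℝ) ≤ ((t / K : ℕ) : ℝ) * K + K := by
    have := (Nat.lt_div_mul_add hK (a := t)).le
    exact_mod_cast this
  have h4 : t * α - K * |α| ≤ ((t / K : ℕ) : ℝ) * K * α := by
    rcases le_total 0 α with h | h
    · rw [abs_of_nonneg h]; nlinarith
    · rw [abs_of_nonpos h]
      have : (0 : ℝ) ≤ K := by positivity
      nlinarith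
  have h5 := mul_le_mul_of_nonneg_left h4 hθ.le
  linarith

lemma le_of_tendsto_vacProb {K : ℕ} (hK : 1 ≤ K) {θ β v : ℝ} (hθ : 0 < θ)
    (hβ : ∀ (n : ℕ) (s : ℝ), occProb π u (n * K) s ≤ Real.exp (-(θ * (s - n * K * β))))
    (hv : Filter.Tendsto (fun t : ℕ => vacProb π u t (v * t)) Filter.atTop (nhds 0)) : v ≤ β := by
  by_contra! hlt
  have hnK : Filter.Tendsto (fun n : ℕ => n * K) Filter.atTop Filter.atTop :=
    Filter.tendsto_id.atTop_mul_const' hK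
  have hK0 : (0 : ℝ) < K := by exact_mod_cast hK
  have h1 : Filter.Tendsto (fun n : ℕ => Real.exp (-(θ * (K * (v - β)) * n)))
      Filter.atTop (nhds 0) := by
    refine Real.tendsto_exp_atBot.comp (Filter.tendsto_neg_atTop_atBot.comp ?_)
    exact tendsto_natCast_atTop_atTop.const_mul_atTop
      (mul_pos hθ (mul_pos hK0 (sub_pos.2 hlt)))
  have h2 : Filter.Tendsto (fun n : ℕ => occProb π u (n * K) (v * (n * K : ℕ)))
      Filter.atTop (nhds 0) := by
    refine squeeze_zero (fun n => occProb_nonneg _ _) (fun n => ?_) h1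
    refine (hβ n _).trans (Real.exp_le_exp.2 (le_of_eq ?_))
    push_cast; ring
  have h3 := h2.add (hv.comp hnK)
  simp only [Function.comp_def, occProb_add_vacProb, add_zero] at h3
  exact one_ne_zero (tendsto_nhds_unique tendsto_const_nhds h3)

lemma le_step_speed_of_tendsto (hπ : IsPerturbation D p π) {v w : ℝ}
    (hw : ∀ m, step D (Hs u m) ⊆ Hs u (m + w))
    (hv : Filter.Tendsto (fun t : ℕ => vacProb π u t (v * t)) Filter.atTop (nhds 0)) : v ≤ w := by
  by_contra! hlt
  have h1 : Filter.Tendsto (fun t : ℕ => vacProb π u t (v * t)) Filter.atTop (nhds 1) := by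
    refine tendsto_const_nhds.congr' ?_
    filter_upwards [Filter.eventually_ge_atTop 1] with t ht
    have ht0 : (1 : ℝ) ≤ t := by exact_mod_cast ht
    have h2 := occProb_eq_zero hπ hw (t := t) (s := v * t) (by nlinarith)
    linarith [occProb_add_vacProb (π := π) (u := u) t (v * t)]
  exact zero_ne_one (tendsto_nhds_unique hv h1)

lemma bddAbove_speed (hD : IsCA N D) (hπ : IsPerturbation D p π) (hu : ‖u‖ = 1) :
    BddAbove {v : ℝ | Filter.Tendsto (fun t : ℕ => vacProb π u t (v * t)) Filter.atTop (nhds 0)} :=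
  ⟨2 * radius N, fun _ hv => le_step_speed_of_tendsto hπ (hD.step_Hs_subset hu) hv⟩

/-- The random speed is positive: a site that the deterministic step occupies is occupied with high
probability after a suitable number of steps. -/
lemma speed_pos (hD : IsCA N D) (hsuper : Supercritical D) (hreg : LocallyRegular D)
    (hπ : IsPerturbation D p π) (hu : ‖u‖ = 1) : 0 < speed π u := by
  obtain ⟨w, hw0, hw⟩ := hsuper u hu
  obtain ⟨τ, hτ⟩ := exists_fill_time hD hsuper hreg
  obtain ⟨q, hq⟩ : ∃ q, q = p ^ ((τ + 1) * (box 0 ((τ + 1) * radius N)).card) := ⟨_, rfl⟩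
  have hq0 : 0 < q := hq ▸ pow_pos hπ.pos _
  have hq1 : q ≤ 1 := hq ▸ pow_le_one₀ hπ.pos.le hπ.le_one
  have hvac : ∀ j : ℕ, vacProb π u (j * (τ + 1)) w ≤ (1 - q) ^ j := by
    intro j
    have h0 : (0 : Site) ∈ step D (Hs u (-w)) := by
      rw [hD.step_Hs hu hw, mem_Hs, lev_zero]; linarith
    rw [hq]
    exact hπ.iter_vac_le_pow hD (fun B hB => iterate_step_subset D B (Nat.le_succ τ)
      (hτ u hu _ _ (reach_Hs hD u (-w)) 0 h0 B hB)) j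
  obtain ⟨R, hR⟩ : ∃ R : ℝ, R = ((τ + 1) * radius N : ℕ) := ⟨_, rfl⟩
  have hR0 : 0 ≤ R := by rw [hR]; positivity
  have hlim : Filter.Tendsto (fun j : ℕ => 4 * (2 * R + 1) ^ 2 * ((j : ℝ) ^ 2 * (1 - q) ^ j))
      Filter.atTop (nhds 0) := by
    have hlt : |1 - q| < 1 := by rw [abs_of_nonneg] <;> linarith
    simpa using (tendsto_pow_const_mul_const_pow_of_abs_lt_one 2 hlt).const_mul
      (4 * (2 * R + 1) ^ 2)
  obtain ⟨j, hj1, hj2⟩ := ((Filter.eventually_ge_atTop 1).and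
    (hlim.eventually (ge_mem_nhds one_pos))).exists
  have hj1' : (1 : ℝ) ≤ j := by exact_mod_cast hj1
  obtain ⟨K, hK⟩ : ∃ K, K = j * (τ + 1) := ⟨_, rfl⟩
  have hK1 : 1 ≤ K := hK ▸ Nat.mul_pos hj1 (Nat.succ_pos τ)
  obtain ⟨X, hX⟩ : ∃ X : ℝ, X = ((box 0 (K * radius N)).card : ℝ) := ⟨_, rfl⟩
  have hXeq : X = (2 * (j * R) + 1) ^ 2 := by
    rw [hX, card_box, hK, hR]; push_cast; ring
  have hX1 : 1 ≤ X := by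
    have : 0 ≤ j * R := by positivity
    rw [hXeq]; exact one_le_pow₀ (by linarith)
  have hX0 : 0 < X := by linarith
  have hκ : 4 * X * (1 - q) ^ j ≤ 1 := by
    refine le_trans ?_ hj2
    have h1 : X ≤ (2 * R + 1) ^ 2 * j ^ 2 := by
      rw [hXeq, ← mul_pow]
      have : 0 ≤ j * R := by positivity
      exact pow_le_pow_left₀ (by linarith) (by linarith) 2
    have h2 : 0 ≤ (1 - q) ^ j := pow_nonneg (by linarith) j
    calc 4 * X * (1 - q) ^ j ≤ 4 * ((2 * R + 1) ^ 2 * j ^ 2) * (1 - q) ^ j := by gcongr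
      _ = _ := by ring
  -- With this choice of `θ`, `exp (θ * (w / 2)) = 2 * X`.
  obtain ⟨θ, hθ⟩ : ∃ θ : ℝ, θ = Real.log (2 * X) / (w / 2) := ⟨_, rfl⟩
  have hθ0 : 0 < θ := hθ ▸ div_pos (Real.log_pos (by linarith)) (by linarith)
  have hexp : Real.exp (θ * (w / 2)) = 2 * X := by
    rw [hθ, div_mul_cancel₀ _ (by positivity), Real.exp_log (by positivity)]
  have hrec := vacProb_mul_le_exp hπ (u := u) (K := K) (a := w) (a' := w / 2) (θ := θ)
    (κ := (1 - q) ^ j) (pow_nonneg (by linarith) j) hθ0.le (hK ▸ hvac j) (by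
      have e1 : Real.exp (-(θ * (w / 2))) = (2 * X)⁻¹ := by rw [Real.exp_neg, hexp]
      have e2 : Real.exp (-(θ * w)) = (2 * X)⁻¹ * (2 * X)⁻¹ := by
        rw [← e1, ← Real.exp_add]; congr 1; ring
      rw [e1, e2, ← hX]
      have h1 : (1 - q) ^ j ≤ (4 * X)⁻¹ := by
        rw [← one_div, le_div_iff₀ (by positivity)]; linarith
      have h2 : X * ((2 * X)⁻¹ * (2 * X)⁻¹) = (4 * X)⁻¹ := by field_simp; norm_num
      have h3 : (4 * X)⁻¹ + (4 * X)⁻¹ = (2 * X)⁻¹ := by field_simp; norm_num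
      linarith)
  have hK0 : (0 : ℝ) < K := by exact_mod_cast hK1
  have hpos : 0 < w / 2 / K := by positivity
  have hmem := tendsto_vacProb hπ (u := u) hK1 (α := w / 2 / K) (v := w / 2 / K / 2) hθ0
    (fun n s => by rw [mul_assoc, mul_div_cancel₀ _ hK0.ne']; exact hrec n s) (by linarith)
  have := le_csSup (bddAbove_speed hD hπ hu) hmem
  rw [speed]
  linarith

lemma speed_le_of_step (hD : IsCA N D) (hsuper : Supercritical D) (hreg : LocallyRegular D)
    (hπ : IsPerturbation D p π) (hu : ‖u‖ = 1) {w : ℝ}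
    (hw : ∀ m, step D (Hs u m) ⊆ Hs u (m + w)) : speed π u ≤ w := by
  -- The set of the supremum is nonempty, because the junk value `0` would contradict `speed_pos`.
  refine csSup_le ?_ fun v hv => le_step_speed_of_tendsto hπ hw hv
  by_contra hne
  rw [Set.not_nonempty_iff_eq_empty] at hne
  have := speed_pos hD hsuper hreg hπ hu
  rw [speed, hne, Real.sSup_empty] at this
  exact lt_irrefl _ this

/-- Exponential bounds for single sites, with constants that depend only on the automaton, on `p`
and on `ε`. -/
lemma exists_exp_bound (hD : IsCA N D) (hsuper : Supercritical D) (hreg : LocallyRegular D)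
    (hp0 : 0 < p) (hp1 : p ≤ 1) {ε : ℝ} (hε : 0 < ε) : ∃ c : ℝ, 0 < c ∧ ∃ T : ℕ,
      ∀ π : LocalConfig N → ℝ, IsPerturbation D p π → ∀ u : Plane, ‖u‖ = 1 → ∀ t ≥ T,
        (∀ s, t * (speed π u + ε) ≤ s → occProb π u t s ≤ Real.exp (-(c * t))) ∧
        (∀ s, s ≤ t * (speed π u - ε) → vacProb π u t s ≤ Real.exp (-(c * t))) := by
  obtain ⟨K, hK, θ, hθ, hscale⟩ := exists_scale hD hsuper hreg hp0 hp1 (ε := ε / 4) (by positivity)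
  obtain ⟨T, hT⟩ := exists_nat_ge (K * (2 * radius N + ε / 4) / (ε / 4))
  rw [div_le_iff₀ (by positivity)] at hT
  refine ⟨θ * (ε / 2), by positivity, T, fun π hπ u hu t ht => ?_⟩
  obtain ⟨α, β, -, hαβ, hocc, hvac⟩ := hscale π hπ u hu
  have hbdd := bddAbove_speed hD hπ hu
  have hα : α ≤ speed π u :=
    le_of_forall_lt fun v hv => by
      obtain ⟨v', hv1, hv2⟩ := exists_between hv
      exact hv1.trans_le (le_csSup hbdd (tendsto_vacProb hπ hK hθ hvac hv2))
  have hβ : speed π u ≤ β :=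
    csSup_le ⟨α - 1, tendsto_vacProb hπ hK hθ hvac (by linarith)⟩
      fun v hv => le_of_tendsto_vacProb hK hθ hocc hv
  have hw0 := speed_pos hD hsuper hreg hπ hu
  have hw2 := speed_le_of_step hD hsuper hreg hπ hu (hD.step_Hs_subset hu)
  obtain ⟨w, hw⟩ : ∃ w, w = speed π u := ⟨_, rfl⟩
  rw [← hw] at hα hβ hw0 hw2 ⊢
  have hK0 : (0 : ℝ) < K := by exact_mod_cast hK
  have ht' : (T : ℝ) ≤ t := by exact_mod_cast ht
  have hKt : K * (2 * radius N + ε / 4) ≤ t * (ε / 4) :=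
    hT.trans (mul_le_mul_of_nonneg_right ht' (by positivity))
  have hKw : K * (w + ε / 4) ≤ t * (ε / 4) :=
    le_trans (mul_le_mul_of_nonneg_left (by linarith) hK0.le) hKt
  have h2 : ((t / K : ℕ) : ℝ) * K ≤ t := by exact_mod_cast Nat.div_mul_le_self t K
  have h3' : t ≤ (t / K + 1) * K := by
    have := (Nat.lt_div_mul_add hK (a := t)).le
    linarith
  have h3 : (t : ℝ) ≤ ((t / K : ℕ) : ℝ) * K + K := by
    have : (t : ℝ) ≤ ((t / K + 1) * K : ℕ) := by exact_mod_cast h3'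
    push_cast at this
    linarith
  constructor
  · intro s hs
    have h1 := hπ.occProb_time_mono u s h3'
    refine (h1.trans (hocc _ _)).trans (Real.exp_le_exp.2 ?_)
    have h4 : ((t / K + 1 : ℕ) : ℝ) * K * β ≤ (t + K) * (w + ε / 4) := by
      push_cast
      refine mul_le_mul (by linarith) (by linarith) (by linarith) (by positivity)
    have h5 : t * (ε / 2) ≤ s - ((t / K + 1 : ℕ) : ℝ) * K * β := by linarith
    have h6 := mul_le_mul_of_nonneg_left h5 hθ.le
    linarith
  · intro s hs
    have h1 := hπ.vacProb_time_anti u s (Nat.div_mul_le_self t K)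
    refine (h1.trans (hvac _ _)).trans (Real.exp_le_exp.2 ?_)
    have h4 : t * (w - ε / 4) - K * w ≤ ((t / K : ℕ) : ℝ) * K * α := by
      have h5 : ((t / K : ℕ) : ℝ) * K * (w - ε / 4) ≤ ((t / K : ℕ) : ℝ) * K * α :=
        mul_le_mul_of_nonneg_left (by linarith) (by positivity)
      have h6 : (t - K) * w ≤ ((t / K : ℕ) : ℝ) * K * w :=
        mul_le_mul_of_nonneg_right (by linarith) hw0.le
      have h7 : ((t / K : ℕ) : ℝ) * K * (ε / 4) ≤ t * (ε / 4) :=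
        mul_le_mul_of_nonneg_right h2 (by positivity)
      linarith
    have h8 : 0 ≤ K * (ε / 4) := by positivity
    have h5 : t * (ε / 2) ≤ ((t / K : ℕ) : ℝ) * K * α - s := by linarith
    have h6 := mul_le_mul_of_nonneg_left h5 hθ.le
    linarith

/-! ### The law of the driven dynamics -/

section Driving

variable {Ω : Type*} {ξ : Ω → Site → ℕ → LocalConfig N → Bool}

/-- The occupied set at time `t` is measurable for any σ-algebra that makes the driving vectors of
the times before `t` measurable. -/
lemma measurableSet_mem_evolve (m : MeasurableSpace Ω) (A : Set Site) (t : ℕ)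
    (hξ : ∀ x, ∀ s < t, Measurable[m] fun ω => ξ ω x s) (x : Site) :
    MeasurableSet[m] {ω | x ∈ evolve (ξ ω) A t} := by
  induction t generalizing x with
  | zero => exact MeasurableSet.const _
  | succ t ih =>
    have ih' := ih fun x s hs => hξ x s (Nat.lt_succ_of_lt hs)
    have e : {ω | x ∈ evolve (ξ ω) A (t + 1)} = ⋃ S : LocalConfig N,
        (⋂ y ∈ N, {ω | x + y ∈ evolve (ξ ω) A t ↔ y ∈ (S : Finset Site)}) ∩
          {ω | ξ ω x t S = true} := by
      ext ω
      simp only [evolve, Set.mem_ofPred_eq, Set.mem_iUnion, Set.mem_inter_iff, Set.mem_iInter]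
      constructor
      · intro h
        exact ⟨view N (evolve (ξ ω) A t) x, fun y hy => by simp [mem_view, hy], h⟩
      · rintro ⟨S, hS, h⟩
        have : view N (evolve (ξ ω) A t) x = S := by
          apply Subtype.ext
          ext y
          rw [mem_view]
          constructor
          · exact fun hy => (hS y hy.1).1 hy.2
          · intro hy
            have hyN := Finset.mem_powerset.1 S.2 hy
            exact ⟨hyN, (hS y hyN).2 hy⟩
        rwa [this]
    rw [e]
    refine MeasurableSet.iUnion fun S => MeasurableSet.inter ?_ ?_
    · refine N.measurableSet_biInter fun y _ => ?_
      by_cases hy : y ∈ (S : Finset Site)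
      · simp only [hy, iff_true]
        exact ih' (x + y)
      · simp only [hy, iff_false]
        exact (ih' (x + y)).compl
    · have h1 : Measurable[m] fun ω => ξ ω x t S :=
        (measurable_pi_apply S).comp (hξ x t (Nat.lt_succ_self t))
      exact h1 (measurableSet_singleton true)

variable [MeasurableSpace Ω] {μ : Measure Ω}

lemma IsDriving.measurableSet_mem_evolve (hξ : IsDriving π μ ξ) (A : Set Site) (t : ℕ) (x : Site) :
    MeasurableSet {ω | x ∈ evolve (ξ ω) A t} :=
  _root_.measurableSet_mem_evolve _ A t (fun x s _ => hξ.measurable x s) x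

lemma integral_one_step [IsProbabilityMeasure μ] (hπ : IsRule N π) (hξ : IsDriving π μ ξ)
    (A : Set Site) (t : ℕ) {x : Site} {r : ℕ} {h : Set Site → ℝ} (hh : LocalOn x r h) :
    ∫ ω, h (evolve (ξ ω) A (t + 1)) ∂μ = ∫ ω, transfer π h (evolve (ξ ω) A t) ∂μ := by
  classical
  set W := box x (r + radius N) with hW
  set E : Finset Site → Set Ω := fun B => {ω | ∀ y ∈ W, y ∈ evolve (ξ ω) A t ↔ y ∈ B} with hE
  set Y : Finset Site → Ω → Set Site :=
    fun B ω => {z | ξ ω z t (view N (B : Set Site) z) = true} with hY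
  -- The driving vectors before time `t` and those of time `t` generate independent σ-algebras.
  set m : Site × ℕ → MeasurableSpace Ω :=
    fun z => MeasurableSpace.comap (fun ω => ξ ω z.1 z.2) inferInstance with hm
  have hmle : ∀ z, m z ≤ (inferInstance : MeasurableSpace Ω) :=
    fun z => (hξ.measurable z.1 z.2).comap_le
  have hind : Indep (⨆ z ∈ {z : Site × ℕ | z.2 < t}, m z)
      (⨆ z ∈ {z : Site × ℕ | z.2 = t}, m z) μ := by
    refine indep_iSup_of_disjoint hmle hξ.indep ?_
    rw [Set.disjoint_left]
    intro z hz hz'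
    exact (ne_of_lt hz) hz'
  have hmz : ∀ (S : Set (Site × ℕ)) (z : Site × ℕ), z ∈ S →
      Measurable[⨆ z ∈ S, m z] fun ω => ξ ω z.1 z.2 := by
    intro S z hz
    exact (comap_measurable (fun ω => ξ ω z.1 z.2)).mono
      (le_iSup₂ (f := fun z _ => m z) z hz) le_rfl
  have hEpast : ∀ B, MeasurableSet[⨆ z ∈ {z : Site × ℕ | z.2 < t}, m z] (E B) := fun B =>
    @measurableSet_config Ω (⨆ z ∈ {z : Site × ℕ | z.2 < t}, m z) (fun ω => evolve (ξ ω) A t)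
      (fun y => _root_.measurableSet_mem_evolve _ A t (fun z s hs => hmz _ (z, s) hs) y)
      W (B : Set Site)
  have hYm' : ∀ (B : Finset Site) (y : Site),
      MeasurableSet[⨆ z ∈ {z : Site × ℕ | z.2 = t}, m z] {ω | y ∈ Y B ω} := by
    intro B y
    have h1 : Measurable[⨆ z ∈ {z : Site × ℕ | z.2 = t}, m z]
        fun ω => ξ ω y t (view N (B : Set Site) y) :=
      (measurable_pi_apply _).comp (hmz _ (y, t) rfl)
    exact h1 (measurableSet_singleton true)
  have hYm : ∀ (B : Finset Site) (y : Site), MeasurableSet {ω | y ∈ Y B ω} := fun B y =>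
    ((measurable_pi_apply _).comp (hξ.measurable y t)) (measurableSet_singleton true)
  have hEm : ∀ B, MeasurableSet (E B) := fun B =>
    measurableSet_config (fun y => hξ.measurableSet_mem_evolve A t y) W (B : Set Site)
  have hYpres : ∀ B, Measurable[⨆ z ∈ {z : Site × ℕ | z.2 = t}, m z] fun ω => h (Y B ω) := fun B =>
    @LocalOn.measurable Ω (⨆ z ∈ {z : Site × ℕ | z.2 = t}, m z) (Y B) x r h hh (hYm' B)
  have hlaw : ∀ B : Finset Site, ∫ ω, h (Y B ω) ∂μ = transfer π h B := by
    intro B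
    refine hh.integral_congr (hYm B) (measurableSet_mem_ustep π _) ?_ (iIndepFun_mem_ustep π _) ?_
    · have h1 := hξ.indep.precomp (g := fun y : Site => (y, t))
        (fun a b hab => (Prod.ext_iff.1 hab).1)
      exact h1.comp
        (fun y (v : LocalConfig N → Bool) => (v (view N (B : Set Site) y) = true : Prop))
        fun y => measurableSet_setOfPred.1 ((measurable_pi_apply (X := fun _ => Bool)
          (view N (B : Set Site) y)) (measurableSet_singleton true))
    · intro y
      rw [unif_real_mem_ustep hπ]
      exact hξ.bernoulli y t _
  -- Decompose according to the configuration `B` of the past in the box on which the next step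
  -- depends: the indicator of `B` belongs to the past, the outcome `Y B` of the step to time `t`.
  have hsplit : ∀ ω, h (evolve (ξ ω) A (t + 1)) =
      ∑ B ∈ W.powerset, (E B).indicator (fun _ => (1 : ℝ)) ω * h (Y B ω) := by
    intro ω
    have hloc : LocalOn x (r + radius N) (fun C => h {z | ξ ω z t (view N C z) = true}) := by
      intro C C' hC
      refine hh _ _ fun y hy => ?_
      rw [Set.mem_ofPred_eq, Set.mem_ofPred_eq,
        view_congr_box fun z hz => hC z (mem_box_trans hy hz)]
    refine (hloc.eq_sum (evolve (ξ ω) A t)).trans (Finset.sum_congr rfl fun B _ => ?_)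
    rw [Set.indicator_apply]
    by_cases hω : ω ∈ E B
    · rw [if_pos hω, one_mul]; exact if_pos hω
    · rw [if_neg hω, zero_mul]; exact if_neg hω
  have hint : ∀ B, Integrable (fun ω => (E B).indicator (fun _ => (1 : ℝ)) ω * h (Y B ω)) μ := by
    intro B
    refine (hh.integrable (μ := μ) (hYm B)).bdd_mul (c := 1)
      ((measurable_const.indicator (hEm B)).aestronglyMeasurable) (ae_of_all _ fun ω => ?_)
    rw [Set.indicator_apply]; split_ifs <;> simp
  rw [integral_congr_ae (ae_of_all μ hsplit), integral_finsetSum _ fun B _ => hint B,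
    (hh.transfer_local π).integral_eq_sum (fun y => hξ.measurableSet_mem_evolve A t y)]
  refine Finset.sum_congr rfl fun B _ => ?_
  have hI : IndepFun ((E B).indicator (fun _ => (1 : ℝ))) (fun ω => h (Y B ω)) μ := by
    refine indep_of_indep_of_le_left (indep_of_indep_of_le_right hind ?_) ?_
    · exact (hYpres B).comap_le
    · exact (Measurable.indicator (m := ⨆ z ∈ {z : Site × ℕ | z.2 < t}, m z) measurable_const
        (hEpast B)).comap_le
  have hmul := hI.integral_fun_mul_eq_mul_integral
    ((measurable_const.indicator (hEm B)).aestronglyMeasurable)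
    (hh.measurable (hYm B)).aestronglyMeasurable
  rw [hmul, hlaw, integral_indicator_const _ (hEm B), smul_eq_mul, mul_one]

/-- The law of the dynamics depends only on `π`, and is given by the transition operator. -/
lemma IsDriving.integral_evolve [IsProbabilityMeasure μ] (hπ : IsRule N π) (hξ : IsDriving π μ ξ)
    (A : Set Site) (t : ℕ) {x : Site} {r : ℕ} {h : Set Site → ℝ} (hh : LocalOn x r h) :
    ∫ ω, h (evolve (ξ ω) A t) ∂μ = iter π t h A := by
  induction t generalizing h r with
  | zero => simp [evolve]
  | succ t ih => rw [integral_one_step hπ hξ A t hh, ih (hh.transfer_local π), iter_succ]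

lemma IsDriving.real_mem_evolve [IsProbabilityMeasure μ] (hπ : IsRule N π) (hξ : IsDriving π μ ξ)
    (t : ℕ) (x : Site) :
    μ.real {ω | x ∈ evolve (ξ ω) (Hs u 0) t} = occProb π u t (lev u x) := by
  have h := hξ.integral_evolve hπ (Hs u 0) t (localOn_occ x)
  rw [iter_occ_Hs hπ, sub_zero] at h
  rw [← h, ← mul_one (μ.real _), ← smul_eq_mul,
    ← integral_indicator_const _ (hξ.measurableSet_mem_evolve (Hs u 0) t x)]
  congr 1

lemma IsDriving.real_notMem_evolve [IsProbabilityMeasure μ] (hπ : IsRule N π)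
    (hξ : IsDriving π μ ξ) (t : ℕ) (x : Site) :
    μ.real {ω | x ∉ evolve (ξ ω) (Hs u 0) t} = vacProb π u t (lev u x) := by
  have h := probReal_compl_eq_one_sub (μ := μ) (hξ.measurableSet_mem_evolve (Hs u 0) t x)
  rw [hξ.real_mem_evolve hπ t x] at h
  have h2 := occProb_add_vacProb (π := π) (u := u) t (lev u x)
  rw [show {ω | x ∉ evolve (ξ ω) (Hs u 0) t} = {ω | x ∈ evolve (ξ ω) (Hs u 0) t}ᶜ from rfl, h]
  linarith

end Driving

/-! ### Small times -/

/-- A site further than the asymptotic speed above a half-space is not occupied in one step with a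
probability too close to `1`; otherwise half-spaces would, for a long time and with high
probability, advance faster than they do. -/
lemma exists_one_step_gap (hD : IsCA N D) (hsuper : Supercritical D) (hreg : LocallyRegular D)
    (hp0 : 0 < p) (hp1 : p ≤ 1) {ε : ℝ} (hε : 0 < ε) : ∃ δ : ℝ, 0 < δ ∧ δ ≤ 1 ∧
      ∀ π : LocalConfig N → ℝ, IsPerturbation D p π → ∀ u : Plane, ‖u‖ = 1 → ∀ (m : ℝ) (y : Site),
        m + (speed π u + ε) < lev u y → π (view N (Hs u m) y) ≤ 1 - δ := by
  obtain ⟨c, hc, T₀, hbound⟩ := exists_exp_bound hD hsuper hreg hp0 hp1 hε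
  have hlim : Filter.Tendsto (fun t : ℕ => Real.exp (-(c * t))) Filter.atTop (nhds 0) :=
    Real.tendsto_exp_atBot.comp (Filter.tendsto_neg_atTop_atBot.comp
      (tendsto_natCast_atTop_atTop.const_mul_atTop hc))
  obtain ⟨T, hT0, hT1, hT⟩ := ((Filter.eventually_ge_atTop T₀).and
    ((Filter.eventually_ge_atTop 1).and
    (hlim.eventually (ge_mem_nhds (by norm_num : (0 : ℝ) < 1 / 4))))).exists
  obtain ⟨X, hX⟩ : ∃ X : ℝ, X = ((box 0 (T * radius N)).card : ℝ) := ⟨_, rfl⟩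
  have hX1 : 1 ≤ X := by
    rw [hX, card_box]; push_cast; exact one_le_pow₀ (by
      have : (0 : ℝ) ≤ T * radius N := by positivity
      linarith)
  have hTr : (1 : ℝ) ≤ T := by exact_mod_cast hT1
  obtain ⟨δ, hδ⟩ : ∃ δ : ℝ, δ = 1 / (4 * T * X) := ⟨_, rfl⟩
  have hδ0 : 0 < δ := by rw [hδ]; positivity
  have hTX : 1 ≤ T * X := one_le_mul_of_one_le_of_one_le hTr hX1
  have hTδ : T * (X * δ) = 1 / 4 := by rw [hδ]; field_simp
  have hδ1 : δ ≤ 1 := by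
    rw [hδ, div_le_one (by positivity)]; linarith
  refine ⟨δ, hδ0, hδ1, fun π hπ u hu m₀ y hy => ?_⟩
  by_contra! hlt
  obtain ⟨v, hv⟩ : ∃ v, v = lev u y - m₀ := ⟨_, rfl⟩
  have hstep : ∀ (m : ℝ) (z : Site), lev u z ≤ m + v → 1 - π (view N (Hs u m) z) ≤ δ := by
    intro m z hz
    have h1 : (view N (Hs u m₀) y : Finset Site) ⊆ view N (Hs u m) z := by
      intro n hn
      rw [mem_view, mem_Hs, lev_add] at hn ⊢
      exact ⟨hn.1, by linarith [hn.2]⟩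
    linarith [hπ.rule.mono _ _ h1]
  -- If `y` failed the bound, half-spaces would advance by `v` in each of `T` steps, except with
  -- probability at most `1 / 4` in all; but `v` exceeds `speed π u + ε`.
  have hvac : ∀ t ≤ T, ∀ s, s ≤ t * v → vacProb π u t s ≤ t * (X * δ) := by
    intro t
    induction t with
    | zero =>
      intro _ s hs
      rw [vacProb_zero, if_pos (by simpa using hs)]; simp
    | succ t ih =>
      intro ht s hs
      have ih' := ih (Nat.le_of_succ_le ht) (s - v) (by push_cast at hs; linarith)
      set W := (box 0 (t * radius N)).filter (fun z => lev u z ≤ -s + v) with hW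
      have hloc := localOn_iter_vac (N := N) (π := π) (le_refl t)
      have hsum : LocalOn 0 (t * radius N) (fun B => ∑ z ∈ W, vac z B) :=
        LocalOn.sum fun z hz => localOn_vac_of_mem (Finset.mem_filter.1 hz).1
      have key : ∀ B, iter π t (vac 0) B ≤ vacProb π u t (s - v) + ∑ z ∈ W, vac z B := by
        intro B
        have hs0 : 0 ≤ ∑ z ∈ W, vac z B := Finset.sum_nonneg fun z _ => vac_nonneg z B
        by_cases h : ∃ z ∈ W, z ∉ B
        · obtain ⟨z, hz, hzB⟩ := h
          have h3 : vac z B ≤ ∑ z ∈ W, vac z B :=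
            Finset.single_le_sum (f := fun z => vac z B) (fun z _ => vac_nonneg z B) hz
          rw [vac_of_notMem hzB] at h3
          linarith [iter_vac_le_one (π := π) 0 t B, vacProb_nonneg (π := π) (u := u) t (s - v)]
        · push Not at h
          have h3 : iter π t (vac 0) B ≤ vacProb π u t (s - v) := by
            rw [vacProb, hloc.eq_inter (Hs u (-(s - v)))]
            refine hπ.iter_vac_anti 0 t fun z hz => h z (Finset.mem_filter.2 ⟨hz.2, ?_⟩)
            have := mem_Hs.1 hz.1
            linarith
          linarith
      have h1 : vacProb π u (t + 1) s ≤ transfer π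
          (fun B => vacProb π u t (s - v) + ∑ z ∈ W, vac z B) (Hs u (-s)) := by
        rw [vacProb, iter_succ']
        exact transfer_mono hloc ((localOn_const 0 (t * radius N) (vacProb π u t (s - v))).comp₂
          hsum (· + ·)) fun U => key _
      rw [transfer_add (localOn_const 0 (t * radius N) _) hsum, transfer_const,
        transfer_sum fun z _ => localOn_vac z] at h1
      have h2 : ∀ z ∈ W, transfer π (vac z) (Hs u (-s)) ≤ δ := by
        intro z hz
        have h3 : transfer π (occ z) (Hs u (-s)) = π (view N (Hs u (-s)) z) := by
          rw [← unif_real_mem_ustep hπ.rule, ← mul_one (unif.real _), ← smul_eq_mul,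
            ← integral_indicator_const _ (measurableSet_mem_ustep π _ z), transfer]
          congr 1
        have h4 : transfer π (occ z) (Hs u (-s)) + transfer π (vac z) (Hs u (-s)) = 1 :=
          iter_occ_add_vac (π := π) z 1 _
        linarith [hstep (-s) z (Finset.mem_filter.1 hz).2]
      have h5 : ∑ z ∈ W, transfer π (vac z) (Hs u (-s)) ≤ X * δ := by
        refine (Finset.sum_le_sum h2).trans ?_
        rw [Finset.sum_const, nsmul_eq_mul]
        refine mul_le_mul_of_nonneg_right ?_ hδ0.le
        rw [hX]
        exact_mod_cast (Finset.card_filter_le _ _).trans (Finset.card_le_card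
          (box_mono 0 (Nat.mul_le_mul_right _ (Nat.le_of_succ_le ht))))
      push_cast
      linarith
  have h1 := hvac T le_rfl (T * v) le_rfl
  have h2 := (hbound π hπ u hu T hT0).1 (T * v)
    (mul_le_mul_of_nonneg_left (by linarith) (by linarith))
  linarith [occProb_add_vacProb (π := π) (u := u) T (T * v)]

/-- With probability bounded below, the half-space advances within a box by exactly `v` in one
step, where `v` is at most the deterministic speed and sites above height `v` may remain vacant. -/
lemma pow_mul_le_transfer_Hs (hD : IsCA N D) (hπ : IsPerturbation D p π) {v q δ : ℝ}
    (hq0 : 0 ≤ q) (hqp : q ≤ p) (hqδ : q ≤ δ) (hδ1 : δ ≤ 1)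
    (hv : ∀ m, Hs u (m + v) ⊆ step D (Hs u m))
    (hgap : ∀ (m : ℝ) (y : Site), m + v < lev u y → π (view N (Hs u m) y) ≤ 1 - δ)
    {r : ℕ} {h : Set Site → ℝ} (hh : LocalOn 0 r h) (h0 : ∀ A, 0 ≤ h A) (m : ℝ) :
    q ^ (box 0 r).card * h (Hs u (m + v)) ≤ transfer π h (Hs u m) := by
  classical
  set F : Site → Set unitInterval := fun z =>
    if lev u z ≤ m + v then {a | (a : ℝ) ≤ p} else {a | 1 - δ < (a : ℝ)} with hF
  have hFm : ∀ z, MeasurableSet (F z) := by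
    intro z
    simp only [hF]
    split_ifs
    · exact measurableSet_le measurable_subtype_coe measurable_const
    · exact measurableSet_lt measurable_const measurable_subtype_coe
  have hFq : ∀ z ∈ box 0 r, q ≤ (volume : Measure unitInterval).real (F z) := by
    intro z _
    simp only [hF]
    split_ifs
    · have e : {a : unitInterval | (a : ℝ) ≤ p} = Set.Iic ⟨p, hπ.pos.le, hπ.le_one⟩ := rfl
      rwa [e, measureReal_def, unitInterval.volume_Iic, ENNReal.toReal_ofReal hπ.pos.le]
    · have e : {a : unitInterval | 1 - δ < (a : ℝ)} =
          Set.Ioi ⟨1 - δ, by linarith, by linarith⟩ := rfl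
      rw [e, measureReal_def, unitInterval.volume_Ioi, sub_sub_cancel,
        ENNReal.toReal_ofReal (by linarith)]
      exact hqδ
  set E : Set (Site → unitInterval) := {U | ∀ z ∈ box 0 r, U z ∈ F z} with hE
  have h1 : q ^ (box 0 r).card ≤ unif.real E := pow_le_unif_real _ hq0 F hFm hFq
  have hEmeas : MeasurableSet E := by
    have : E = ⋂ z ∈ box 0 r, {U | U z ∈ F z} := by
      ext; simp [hE]
    rw [this]
    exact Finset.measurableSet_biInter _ fun z _ => measurable_pi_apply z (hFm z)
  calc q ^ (box 0 r).card * h (Hs u (m + v)) ≤ unif.real E * h (Hs u (m + v)) :=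
        mul_le_mul_of_nonneg_right h1 (h0 _)
    _ = ∫ U, E.indicator (fun _ => h (Hs u (m + v))) U ∂unif := by
        rw [integral_indicator_const _ hEmeas, smul_eq_mul]
    _ ≤ transfer π h (Hs u m) := by
        refine integral_mono ((integrable_const _).indicator hEmeas) (hh.integrable_ustep π _) ?_
        intro U
        by_cases hU : U ∈ E
        · simp only [Set.indicator_of_mem hU]
          refine (hh _ _ fun z hz => ?_).le
          have hUz := hU z hz
          simp only [hF] at hUz
          rw [mem_Hs]
          split_ifs at hUz with hz'
          · have hz1 := hD.mem_step_iff.1 (hv m hz')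
            exact ⟨fun _ => ⟨(hπ.support _).1 hz1, le_trans hUz (hπ.le_of_eq_one hz1)⟩,
              fun _ => hz'⟩
          · refine ⟨fun hcon => (hz' hcon).elim, fun hmem => ?_⟩
            have h2 := hgap m z (not_le.1 hz')
            have h3 := hmem.2
            have h4 : 1 - δ < (U z : ℝ) := hUz
            linarith
        · simp only [Set.indicator_of_notMem hU]
          exact h0 _

lemma pow_mul_le_iter_Hs (hD : IsCA N D) (hπ : IsPerturbation D p π) {v q δ : ℝ}
    (hq0 : 0 ≤ q) (hqp : q ≤ p) (hqδ : q ≤ δ) (hδ1 : δ ≤ 1)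
    (hv : ∀ m, Hs u (m + v) ⊆ step D (Hs u m))
    (hgap : ∀ (m : ℝ) (y : Site), m + v < lev u y → π (view N (Hs u m) y) ≤ 1 - δ)
    {r T t : ℕ} (ht : t ≤ T) {h : Set Site → ℝ} (hh : LocalOn 0 r h) (h0 : ∀ A, 0 ≤ h A) (m : ℝ) :
    q ^ (t * (box 0 (r + T * radius N)).card) * h (Hs u (m + t * v)) ≤ iter π t h (Hs u m) := by
  induction t generalizing m with
  | zero => simp
  | succ t ih =>
    have hloc : LocalOn 0 (r + T * radius N) (iter π t h) :=
      (hh.iter_local π t).mono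
        (Nat.add_le_add_left (Nat.mul_le_mul_right _ (Nat.le_of_succ_le ht)) r)
    have h1 := pow_mul_le_transfer_Hs hD hπ hq0 hqp hqδ hδ1 hv hgap hloc (iter_nonneg hh h0 t) m
    have h2 := mul_le_mul_of_nonneg_left (ih (Nat.le_of_succ_le ht) (m + v))
      (pow_nonneg hq0 (box 0 (r + T * radius N)).card)
    rw [iter_succ']
    refine le_trans (le_of_eq ?_) (h2.trans h1)
    rw [Nat.succ_mul, pow_add, show m + v + t * v = m + (t + 1 : ℕ) * v by push_cast; ring]
    ring

/-! ### The two regimes -/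

lemma mem_box_of_norm_le {x : Site} {n : ℕ} (h : ‖toPlane x‖ ≤ n) : x ∈ box 0 n := by
  refine mem_box_of_dist_le ?_
  have : toPlane 0 = 0 := by
    ext i; fin_cases i <;> simp [toPlane]
  rwa [this, dist_zero_left]

lemma mem_shifted_toPlane (hu : ‖u‖ = 1) (s : ℝ) (x : Site) :
    toPlane x ∈ shiftedHalfSpace u s ↔ lev u x ≤ s := mem_shiftedHalfSpace hu s _

universe v

/-- For small times, the probability that the occupied set is close to the right half-space is
bounded below. -/
lemma exists_small_time_bound (hD : IsCA N D) (hsuper : Supercritical D) (hreg : LocallyRegular D)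
    (hp0 : 0 < p) (hp1 : p ≤ 1) {ε : ℝ} (hε : 0 < ε) (T : ℕ) : ∃ q : ℝ, 0 < q ∧
      ∀ π : LocalConfig N → ℝ, IsPerturbation D p π → ∀ u : Plane, ‖u‖ = 1 →
        ∀ (Ω : Type v) [MeasurableSpace Ω] (μ : Measure Ω) [IsProbabilityMeasure μ]
          (ξ : Ω → Site → ℕ → LocalConfig N → Bool), IsDriving π μ ξ → ∀ t ≤ T,
            q ≤ μ.real {ω | BetweenHalfSpaces u ((t : ℝ) ^ 2) (t * (speed π u - ε))
              (t * (speed π u + ε)) (evolve (ξ ω) (halfSpaceSites u) t)} := by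
  classical
  obtain ⟨δ, hδ0, hδ1, hgap⟩ := exists_one_step_gap hD hsuper hreg hp0 hp1 hε
  obtain ⟨q, hq⟩ : ∃ q, q = min p δ := ⟨_, rfl⟩
  have hq0 : 0 < q := hq ▸ lt_min hp0 hδ0
  have hq1 : q ≤ 1 := hq ▸ (min_le_left _ _).trans hp1
  refine ⟨q ^ (T * (box 0 (T ^ 2 + T * radius N)).card), pow_pos hq0 _,
    fun π hπ u hu Ω _ μ _ ξ hξ t ht => ?_⟩
  obtain ⟨w, hw0, hw⟩ := hsuper u hu
  have hstep := hD.step_Hs hu hw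
  have hsw : speed π u ≤ w := speed_le_of_step hD hsuper hreg hπ hu fun m => (hstep m).le
  -- The front is made to advance by exactly `v` in each step; sites beyond the reach of the
  -- deterministic step cannot become occupied, and sites above `speed π u + ε` stay vacant
  -- with probability at least `δ`.
  obtain ⟨v, hv⟩ : ∃ v, v = min (speed π u + ε) w := ⟨_, rfl⟩
  have hv1 : v ≤ speed π u + ε := hv ▸ min_le_left _ _
  have hv2 : v ≤ w := hv ▸ min_le_right _ _
  have hv3 : speed π u ≤ v := hv ▸ le_min (by linarith) hsw
  have hgapv : ∀ (m : ℝ) (y : Site), m + v < lev u y → π (view N (Hs u m) y) ≤ 1 - δ := by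
    intro m y hy
    rcases min_choice (speed π u + ε) w with hc | hc
    · exact hgap π hπ u hu m y (by rw [hv, hc] at hy; exact hy)
    · have h1 : y ∉ step D (Hs u m) := by
        rw [hstep, mem_Hs, not_le]; rw [hv, hc] at hy; exact hy
      rw [hD.mem_step_iff, hπ.support] at h1
      linarith [not_lt.1 h1]
  set Eset : Set (Set Site) := {A | ∀ x ∈ box 0 (T ^ 2), x ∈ A ↔ x ∈ Hs u (0 + t * v)} with hEset
  set h : Set Site → ℝ := fun A => if A ∈ Eset then 1 else 0 with hh
  have hloc : LocalOn 0 (T ^ 2) h := by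
    intro A B hAB
    have : A ∈ Eset ↔ B ∈ Eset := by
      simp only [hEset, Set.mem_ofPred_eq]
      exact forall₂_congr fun x hx => by rw [hAB x hx]
    simp only [hh, this]
  have h0 : ∀ A, 0 ≤ h A := fun A => by simp only [hh]; split_ifs <;> simp
  have h1 := pow_mul_le_iter_Hs hD hπ (u := u) (v := v) hq0.le (hq ▸ min_le_left _ _)
    (hq ▸ min_le_right _ _) hδ1 (fun m => (Hs_mono u (by linarith)).trans (hstep m).ge) hgapv ht
    hloc h0 0
  have h2 : h (Hs u (0 + t * v)) = 1 := if_pos fun x _ => Iff.rfl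
  rw [h2, mul_one, ← hξ.integral_evolve hπ.rule (Hs u 0) t hloc] at h1
  have hmeas : MeasurableSet {ω | evolve (ξ ω) (Hs u 0) t ∈ Eset} :=
    measurableSet_config (fun y => hξ.measurableSet_mem_evolve (Hs u 0) t y) _ _
  have h3 : ∫ ω, h (evolve (ξ ω) (Hs u 0) t) ∂μ = μ.real {ω | evolve (ξ ω) (Hs u 0) t ∈ Eset} := by
    rw [← mul_one (μ.real _), ← smul_eq_mul, ← integral_indicator_const _ hmeas]
    simp only [hh, Set.indicator_apply, Set.mem_ofPred_eq]
  rw [h3] at h1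
  calc q ^ (T * (box 0 (T ^ 2 + T * radius N)).card)
      ≤ q ^ (t * (box 0 (T ^ 2 + T * radius N)).card) :=
        pow_le_pow_of_le_one hq0.le hq1 (Nat.mul_le_mul_right _ ht)
    _ ≤ _ := h1
    _ ≤ _ := by
        refine measureReal_mono fun ω hω x hx => ?_
        have hxT : x ∈ box 0 (T ^ 2) := by
          refine mem_box_of_norm_le (hx.trans ?_)
          push_cast
          have : (t : ℝ) ≤ T := by exact_mod_cast ht
          gcongr
        have hiff : x ∈ evolve (ξ ω) (Hs u 0) t ↔ x ∈ Hs u (0 + t * v) := hω x hxT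
        have ht0 : (0 : ℝ) ≤ t := by positivity
        rw [mem_shifted_toPlane hu, mem_shifted_toPlane hu, halfSpaceSites_eq, hiff, mem_Hs,
          zero_add]
        exact ⟨fun hle => hle.trans (mul_le_mul_of_nonneg_left (by linarith) ht0),
          fun hle => hle.trans (mul_le_mul_of_nonneg_left hv1 ht0)⟩

/-- For large times, the exponential bounds for single sites survive a union bound over the sites of
the ball, at the price of halving the rate. -/
lemma exists_large_time_bound (hD : IsCA N D) (hsuper : Supercritical D) (hreg : LocallyRegular D)
    (hp0 : 0 < p) (hp1 : p ≤ 1) {ε : ℝ} (hε : 0 < ε) : ∃ c : ℝ, 0 < c ∧ ∃ T : ℕ,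
      ∀ π : LocalConfig N → ℝ, IsPerturbation D p π → ∀ u : Plane, ‖u‖ = 1 →
        ∀ (Ω : Type v) [MeasurableSpace Ω] (μ : Measure Ω) [IsProbabilityMeasure μ]
          (ξ : Ω → Site → ℕ → LocalConfig N → Bool), IsDriving π μ ξ → ∀ t ≥ T,
            1 - Real.exp (-(c * t)) ≤
              μ.real {ω | BetweenHalfSpaces u ((t : ℝ) ^ 2) (t * (speed π u - ε))
                (t * (speed π u + ε)) (evolve (ξ ω) (halfSpaceSites u) t)} := by
  classical
  obtain ⟨c, hc, T₀, hbound⟩ := exists_exp_bound hD hsuper hreg hp0 hp1 hε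
  have hlim : Filter.Tendsto (fun t : ℕ => 9 * ((t : ℝ) ^ 4 * Real.exp (-(c / 2)) ^ t))
      Filter.atTop (nhds 0) := by
    have hlt : |Real.exp (-(c / 2))| < 1 := by
      rw [abs_of_pos (Real.exp_pos _), Real.exp_lt_one_iff]; linarith
    simpa using (tendsto_pow_const_mul_const_pow_of_abs_lt_one 4 hlt).const_mul 9
  obtain ⟨T₁, hT₁⟩ := Filter.eventually_atTop.1 (hlim.eventually (ge_mem_nhds one_pos))
  refine ⟨c / 2, by positivity, max T₀ (max T₁ 1), fun π hπ u hu Ω _ μ _ ξ hξ t ht => ?_⟩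
  have ht0 : T₀ ≤ t := (le_max_left _ _).trans ht
  have ht1 : T₁ ≤ t := (le_max_left _ _).trans ((le_max_right _ _).trans ht)
  have ht2 : (1 : ℝ) ≤ t := by
    exact_mod_cast (le_max_right _ _).trans ((le_max_right _ _).trans ht)
  obtain ⟨hocc, hvac⟩ := hbound π hπ u hu t ht0
  set bad : Site → Set Ω := fun x =>
    if lev u x ≤ t * (speed π u - ε) then {ω | x ∉ evolve (ξ ω) (Hs u 0) t}
    else if t * (speed π u + ε) ≤ lev u x then {ω | x ∈ evolve (ξ ω) (Hs u 0) t} else ∅ with hbad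
  have hbadm : ∀ x, MeasurableSet (bad x) := by
    intro x
    simp only [hbad]
    split_ifs
    · exact (hξ.measurableSet_mem_evolve (Hs u 0) t x).compl
    · exact hξ.measurableSet_mem_evolve (Hs u 0) t x
    · exact MeasurableSet.empty
  have hbadle : ∀ x, μ.real (bad x) ≤ Real.exp (-(c * t)) := by
    intro x
    simp only [hbad]
    split_ifs with h1 h2
    · rw [hξ.real_notMem_evolve hπ.rule]; exact hvac _ h1
    · rw [hξ.real_mem_evolve hπ.rule]; exact hocc _ h2
    · rw [measureReal_empty]; positivity
  set B : Set Ω := ⋃ x ∈ box 0 (t ^ 2), bad x with hB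
  have hBm : MeasurableSet B := Finset.measurableSet_biUnion _ fun x _ => hbadm x
  have hBle : μ.real B ≤ Real.exp (-(c / 2 * t)) := by
    calc μ.real B ≤ ∑ x ∈ box 0 (t ^ 2), μ.real (bad x) := measureReal_biUnion_finset_le _ _
      _ ≤ ∑ x ∈ box 0 (t ^ 2), Real.exp (-(c * t)) := Finset.sum_le_sum fun x _ => hbadle x
      _ = (2 * (t : ℝ) ^ 2 + 1) ^ 2 * Real.exp (-(c * t)) := by
          rw [Finset.sum_const, card_box, nsmul_eq_mul]; push_cast; ring
      _ ≤ (9 * (t : ℝ) ^ 4) * (Real.exp (-(c / 2)) ^ t * Real.exp (-(c / 2 * t))) := by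
          have e : Real.exp (-(c / 2)) ^ t * Real.exp (-(c / 2 * t)) = Real.exp (-(c * t)) := by
            rw [← Real.exp_nat_mul, ← Real.exp_add]; congr 1; ring
          rw [e]
          refine mul_le_mul_of_nonneg_right ?_ (Real.exp_nonneg _)
          have h2 : (1 : ℝ) ≤ t ^ 2 := one_le_pow₀ ht2
          calc ((2 : ℝ) * (t : ℝ) ^ 2 + 1) ^ 2 ≤ (3 * (t : ℝ) ^ 2) ^ 2 :=
                pow_le_pow_left₀ (by positivity) (by linarith) 2
            _ = 9 * (t : ℝ) ^ 4 := by ring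
      _ = (9 * ((t : ℝ) ^ 4 * Real.exp (-(c / 2)) ^ t)) * Real.exp (-(c / 2 * t)) := by ring
      _ ≤ 1 * Real.exp (-(c / 2 * t)) :=
          mul_le_mul_of_nonneg_right (hT₁ t ht1) (Real.exp_nonneg _)
      _ = _ := one_mul _
  calc 1 - Real.exp (-(c / 2 * t)) ≤ 1 - μ.real B := by linarith
    _ = μ.real Bᶜ := (probReal_compl_eq_one_sub hBm).symm
    _ ≤ _ := by
        refine measureReal_mono fun ω hω x hx => ?_
        have hxt : x ∈ box 0 (t ^ 2) := mem_box_of_norm_le (by push_cast; exact hx)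
        have hωx : ω ∉ bad x := fun hmem => hω (Set.mem_biUnion hxt hmem)
        rw [mem_shifted_toPlane hu, mem_shifted_toPlane hu, halfSpaceSites_eq]
        constructor
        · intro hle
          by_contra hnot
          refine hωx ?_
          simp only [hbad, if_pos hle]
          exact hnot
        · intro hmem
          by_contra! hlt
          have h1 : ¬ lev u x ≤ t * (speed π u - ε) := by
            rw [not_le]
            refine lt_of_le_of_lt (mul_le_mul_of_nonneg_left (by linarith) (by linarith)) hlt
          refine hωx ?_
          simp only [hbad, if_neg h1, if_pos hlt.le]
          exact hmem

end

/-- The Kesten property: a half-space under a `p`-perturbation of a locally regular supercritical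
cellular automaton advances at a deterministic positive speed, with exponential large deviation
bounds. The constant depends only on the automaton, on `p` and on `ε`. -/
theorem theorem1 (N : Finset Site) (D : LocalConfig N → ℝ) (hD : IsCA N D)
    (hsuper : Supercritical D) (hreg : LocallyRegular D) (p : ℝ) :
    ∃ w : (LocalConfig N → ℝ) → Plane → ℝ,
      (∀ π : LocalConfig N → ℝ, IsPerturbation D p π → ∀ u : Plane, ‖u‖ = 1 → 0 < w π u) ∧
      ∀ ε : ℝ, 0 < ε → ∃ c : ℝ, 0 < c ∧
        ∀ π : LocalConfig N → ℝ, IsPerturbation D p π → ∀ u : Plane, ‖u‖ = 1 →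
          ∀ (Ω : Type*) [MeasurableSpace Ω] (μ : Measure Ω) [IsProbabilityMeasure μ]
            (ξ : Ω → Site → ℕ → LocalConfig N → Bool), IsDriving π μ ξ →
            ∀ t : ℕ,
              1 - Real.exp (-(c * t)) ≤
                μ.real {ω | BetweenHalfSpaces u ((t : ℝ) ^ 2) (t * (w π u - ε)) (t * (w π u + ε))
                  (evolve (ξ ω) (halfSpaceSites u) t)} := by
  refine ⟨speed, fun π hπ u hu => speed_pos hD hsuper hreg hπ hu, fun ε hε => ?_⟩
  -- If `p` is not in `(0, 1]`, there are no `p`-perturbations.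
  by_cases hp : 0 < p ∧ p ≤ 1
  · obtain ⟨c, hc, T, hlarge⟩ := exists_large_time_bound hD hsuper hreg hp.1 hp.2 hε
    obtain ⟨q, hq, hsmall⟩ := exists_small_time_bound hD hsuper hreg hp.1 hp.2 hε T
    refine ⟨min c (q / (T + 1)), lt_min hc (by positivity), fun π hπ u hu Ω _ μ _ ξ hξ t => ?_⟩
    rcases le_total T t with ht | ht
    · refine le_trans ?_ (hlarge π hπ u hu Ω μ ξ hξ t ht)
      have : min c (q / (T + 1)) * t ≤ c * t :=
        mul_le_mul_of_nonneg_right (min_le_left _ _) (by positivity)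
      have := Real.exp_le_exp.2 (neg_le_neg this)
      linarith
    · refine le_trans ?_ (hsmall π hπ u hu Ω μ ξ hξ t ht)
      have h1 : min c (q / (T + 1)) * t ≤ q := by
        have ht' : (t : ℝ) ≤ T + 1 := by
          have : (t : ℝ) ≤ T := by exact_mod_cast ht
          linarith
        calc min c (q / (T + 1)) * t ≤ q / (T + 1) * (T + 1) :=
              mul_le_mul (min_le_right _ _) ht' (by positivity) (by positivity)
          _ = q := div_mul_cancel₀ _ (by positivity)
      linarith [Real.add_one_le_exp (-(min c (q / (T + 1)) * t))]
  · exact ⟨1, one_pos, fun π hπ => (hp ⟨hπ.pos, hπ.le_one⟩).elim⟩
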